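/- **Prior-free Bayesian regret bound for PSRL in linear mixture MDPs.** Consider a time-inhomogeneous, finite-horizon MDP with measurable state space $\mathcal S$, action space $\mathcal A$, horizon $H$, mean rewards $R(h,s,a)\in[0,1]$, initial state law $\rho$, and transition kernel $P_\Theta(s'\mid x)=\langle\theta_h,\phi(s'\mid x)\rangle$ for $x=(h,s,a)$, $0\le h\le H-1$ (a density with respect to a reference measure, e.g. counting measure). Everything is known except $\Theta=(\theta_0,\dots,\theta_{H-1})$, $\theta_h\in\mathbb R^d$, which is drawn from a prior supported on parameters inducing proper transition kernels. For a deterministic policy $\pi$ let $\overline V^{\Theta}_\pi$ be the expected total reward of one episode under $M(\Theta)$, and let $\pi^\Theta$ be a policy maximizing $\overline V^\Theta_\pi$ over $\pi$ (chosen measurably in $\Theta$). In episode $\ell=1,\dots,L$, PSRL draws $\hat\Theta_\ell$ from the posterior of $\Theta^*$ given the states and actions observed in episodes $1,\dots,\ell-1$, and plays $\pi_\ell=\pi^{\hat\Theta_\ell}$ in $M(\Theta^*)$. Its Bayesian regret is $$\mathfrak B\mathfrak R(L)=\mathbb E\Big[\sum_{\ell=1}^{L}\big(\overline V^{\Theta^*}_{\pi^{\Theta^*}}-\overline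 V^{\Theta^*}_{\pi_\ell}\big)\Big].$$ Assume: 1. $\big\|\sum_{s'}\phi(s'\mid x)V(s')\big\|_2\le1$ for every $x$ and every measurable $V:\mathcal S\to[0,1]$ (an integral with respect to the reference measure in general); 2. $\theta^*_0,\dots,\theta^*_{H-1}$ are mutually independent under the prior; 3. $\|\theta^*_h\|_2\le B$ almost surely for all $h$. Let $\Gamma_{1,h}$ be the covariance matrix of $\theta^*_h$ under the prior, and $T=HL$. Then: * $\Gamma_{1,h}\preceq B^2I$ for every $h$; * $\log\det(I+c\,\Gamma_{1,h})\le d\log(1+cB^2)$ for every $h$ and every real $c\ge0$, in particular for $c=L$ and $c=dL$; * $\displaystyle \mathfrak B\mathfrak R(L)\le\sqrt2\,d\,\sqrt{H^4L\log(1+LB^2)}.$ Moreover there is a constant $C>0$ depending only on $B$ such that, for all $H,d,L$ and $T=HL$, $$\sqrt2\,d\sqrt{H^4L\log(1+LB^2)}\le C\,d\sqrt{H^3T\log L}\ \ (L\ge2),\qquad \sqrt2\,d\sqrt{H^4L\log(1+LB^2)}\le C\,d\sqrt{H^3T\log T}\ \ (T\ge2).$$ The rate $d\sqrt{H^3T\log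 T}$ is smaller than the rate $dH^{3/2}\sqrt T\log T$ by a factor $\sqrt{\log T}$: $\;dH^{3/2}\sqrt T\log T=\sqrt{\log T}\cdot d\sqrt{H^3T\log T}$. -/

import Mathlib

open MeasureTheory ProbabilityTheory

noncomputable section

namespace PSRL

/-- Stage-state-action triples `x = (h, s, a)`, with `h ∈ {0, …, H - 1}`. -/
abbrev SA (S A : Type*) (H : ℕ) : Type _ := Fin H × S × A

/-- Parameter sets `Θ = (θ_0, …, θ_{H-1})` of vectors in Euclidean `ℝ^d`. -/
abbrev Param (H d : ℕ) : Type := Fin H → EuclideanSpace ℝ (Fin d)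

/-- The observations `O_h = (s_0, a_0, …, s_{h-1}, a_{h-1}, s_h)` of one episode up to stage `h`:
the pairs `(s_j, a_j)` for `j < h`, and the state `s_h`. -/
abbrev Obs (S A : Type*) (h : ℕ) : Type _ := (Fin h → S × A) × S

/-- The observational history made of `n` completed episodes of horizon `H`. -/
abbrev Hist (S A : Type*) (H n : ℕ) : Type _ := Fin n → Obs S A H

theorem measurable_snoc {α : Type*} [MeasurableSpace α] (n : ℕ) :
    Measurable fun p : (Fin n → α) × α => (Fin.snoc p.1 p.2 : Fin (n + 1) → α) := by
  refine measurable_pi_iff.2 fun i => ?_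
  induction i using Fin.lastCases with
  | last => simpa using measurable_snd
  | cast j =>
    simp only [Fin.snoc_castSucc]
    exact (measurable_pi_apply j).comp measurable_fst

/-- A family of deterministic policies `π^w = (π^w_0, …, π^w_{H-1})`, `π^w_h : S → A`, indexed
measurably by `w : W`. -/
structure PolicyFamily (W S A : Type*) [MeasurableSpace W] [MeasurableSpace S] [MeasurableSpace A]
    (H : ℕ) where
  act : W → Fin H → S → A
  measurable_act : ∀ h, Measurable fun p : W × S => act p.1 h p.2

/-- A single (measurable) deterministic policy. -/
abbrev Policy (S A : Type*) [MeasurableSpace S] [MeasurableSpace A] (H : ℕ) : Type _ :=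
  PolicyFamily Unit S A H

/-- The member `π^w` of a family of policies. -/
def PolicyFamily.at {W S A : Type*} [MeasurableSpace W] [MeasurableSpace S] [MeasurableSpace A]
    {H : ℕ} (π : PolicyFamily W S A H) (w : W) : Policy S A H where
  act _ := π.act w
  measurable_act h := (π.measurable_act h).comp (measurable_const.prodMk measurable_snd)

/-- Everything the agent knows about a linear mixture MDP of horizon `H` on a state space `S` and
an action space `A`: the feature mapping `φ(s' | x) ∈ ℝ^d`, the reference measures `ν x` on the
next state with respect to which sums over `s'` are taken (counting measure on a countable `S`),
the mean reward `R(x) ∈ [0, 1]`, and the law `ρ` of the initial state. Only the parameters `Θ` of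
the transition are unknown. -/
structure LinearMixture (S A : Type*) [MeasurableSpace S] [MeasurableSpace A] (H d : ℕ) where
  ν : Kernel (SA S A H) S
  sFinite_ν : IsSFiniteKernel ν
  φ : SA S A H → S → EuclideanSpace ℝ (Fin d)
  measurable_φ : Measurable (Function.uncurry φ)
  integrable_φ : ∀ x, Integrable (φ x) (ν x)
  R : SA S A H → ℝ
  measurable_R : Measurable R
  R_mem : ∀ x, R x ∈ Set.Icc (0 : ℝ) 1
  ρ : Measure S
  isProbabilityMeasure_ρ : IsProbabilityMeasure ρ

namespace LinearMixture

variable {S A : Type*} [MeasurableSpace S] [MeasurableSpace A] {H d : ℕ}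

attribute [instance] LinearMixture.sFinite_ν LinearMixture.isProbabilityMeasure_ρ

variable (M : LinearMixture S A H d)

/-- The value-correlated feature `φ_V(x) = ∑_{s'} φ(s' | x) V(s')`. -/
def valueFeature (V : S → ℝ) (x : SA S A H) : EuclideanSpace ℝ (Fin d) :=
  ∫ s', V s' • M.φ x s' ∂(M.ν x)

/-- `⟨θ_h, φ(s' | x)⟩` for `x = (h, s, a)`. -/
def density (Θ : Param H d) (x : SA S A H) (s' : S) : ℝ := inner ℝ (Θ x.1) (M.φ x s')

/-- `Θ` induces a proper transition kernel: `⟨θ_h, φ(· | x)⟩` is a probability density for all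
`x = (h, s, a)`. -/
def Proper (Θ : Param H d) : Prop :=
  ∀ x, (∀ᵐ s' ∂(M.ν x), 0 ≤ M.density Θ x s') ∧ ∫ s', M.density Θ x s' ∂(M.ν x) = 1

theorem measurable_density :
    Measurable (Function.uncurry fun (p : Param H d × SA S A H) (s' : S) =>
      M.density p.1 p.2 s') := by
  have h1 : Measurable fun q : (Param H d × SA S A H) × S => q.1.1 q.1.2.1 :=
    (measurable_from_prod_countable_right (f := fun p : Fin H × Param H d => p.2 p.1)
      (fun h => measurable_pi_apply h)).comp
      ((measurable_fst.comp (measurable_snd.comp measurable_fst)).prodMk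
        (measurable_fst.comp measurable_fst))
  have h2 : Measurable fun q : (Param H d × SA S A H) × S => M.φ q.1.2 q.2 :=
    M.measurable_φ.comp ((measurable_snd.comp measurable_fst).prodMk measurable_snd)
  exact h1.inner h2

/-- The kernel with (truncated) density `⟨θ_h, φ(· | x)⟩`. -/
def rawTrans : Kernel (Param H d × SA S A H) S :=
  Kernel.withDensity (M.ν.prodMkLeft (Param H d))
    fun p s' => ENNReal.ofReal (M.density p.1 p.2 s')

theorem rawTrans_apply (Θ : Param H d) (x : SA S A H) :
    M.rawTrans (Θ, x) = (M.ν x).withDensity fun s' => ENNReal.ofReal (M.density Θ x s') := by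
  unfold rawTrans
  rw [Kernel.withDensity_apply _ M.measurable_density.ennreal_ofReal]
  rfl

theorem measurableSet_mass :
    MeasurableSet {p : Param H d × SA S A H | M.rawTrans p Set.univ = 1} :=
  (M.rawTrans.measurable_coe MeasurableSet.univ) (measurableSet_singleton 1)

open Classical in
/-- The transition kernel `P_Θ(x) = ⟨θ_h, φ(· | x)⟩` of the MDP `M(Θ)`. Where the density does not
have mass one (which does not happen for a proper `Θ`) the state does not move; this only makes the
kernel total. -/
def trans : Kernel (Param H d × SA S A H) S :=
  Kernel.piecewise M.measurableSet_mass M.rawTrans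
    (Kernel.deterministic (fun p => p.2.2.1)
      (measurable_fst.comp (measurable_snd.comp measurable_snd)))

instance : IsMarkovKernel M.trans := by
  refine ⟨fun p => ?_⟩
  unfold trans
  rw [Kernel.piecewise_apply]
  split_ifs with h
  · exact ⟨h⟩
  · infer_instance

theorem trans_apply_of_proper {Θ : Param H d} (hΘ : M.Proper Θ) (x : SA S A H) :
    M.trans (Θ, x) = (M.ν x).withDensity fun s' => ENNReal.ofReal (M.density Θ x s') := by
  have hint : Integrable (M.density Θ x) (M.ν x) := (M.integrable_φ x).const_inner (Θ x.1)
  have hmass : M.rawTrans (Θ, x) Set.univ = 1 := by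
    rw [rawTrans_apply, withDensity_apply _ MeasurableSet.univ, Measure.restrict_univ,
      ← ofReal_integral_eq_lintegral_ofReal hint (hΘ x).1, (hΘ x).2, ENNReal.ofReal_one]
  unfold trans
  rw [Kernel.piecewise_apply, if_pos (show (Θ, x) ∈ {p | M.rawTrans p Set.univ = 1} from hmass),
    rawTrans_apply]

section Rollout

variable {W : Type*} [MeasurableSpace W]

/-- One step at stage `h`: from the observations `(…, s_h)`, play `a_h = π^w_h(s_h)` and draw
`s_{h+1} ∼ P_Θ(h, s_h, a_h)`. -/
def step (π : PolicyFamily W S A H) (h : ℕ) (hh : h < H) :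
    Kernel ((Param H d × W) × Obs S A h) (A × S) :=
  (Kernel.deterministic (fun p : (Param H d × W) × Obs S A h => π.act p.1.2 ⟨h, hh⟩ p.2.2)
      ((π.measurable_act ⟨h, hh⟩).comp ((measurable_snd.comp measurable_fst).prodMk
        (measurable_snd.comp measurable_snd)))) ⊗ₖ
    (M.trans.comap
      (fun q : ((Param H d × W) × Obs S A h) × A => (q.1.1.1, (⟨h, hh⟩, q.1.2.2, q.2)))
      (by fun_prop))

instance (π : PolicyFamily W S A H) (h : ℕ) (hh : h < H) : IsMarkovKernel (M.step π h hh) := by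
  unfold step; infer_instance

/-- Append `(a_h, s_{h+1})` to the observations up to stage `h`. -/
def extend (h : ℕ) (q : Obs S A h × (A × S)) : Obs S A (h + 1) :=
  (Fin.snoc q.1.1 (q.1.2, q.2.1), q.2.2)

theorem measurable_extend (h : ℕ) : Measurable (extend (S := S) (A := A) h) := by
  refine Measurable.prodMk ?_ (by fun_prop)
  exact (measurable_snoc (α := S × A) h).comp
    (g := fun p : (Fin h → S × A) × (S × A) => (Fin.snoc p.1 p.2 : Fin (h + 1) → S × A))
    (f := fun q : Obs S A h × (A × S) => (q.1.1, (q.1.2, q.2.1))) (by fun_prop)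

/-- The law of the observations up to stage `h` when the policy `π^w` interacts with the MDP
`M(Θ)`, as a kernel in `(Θ, w)`. -/
def rollout (π : PolicyFamily W S A H) : (h : ℕ) → h ≤ H → Kernel (Param H d × W) (Obs S A h)
  | 0, _ => Kernel.const _ (M.ρ.map fun s => (Fin.elim0, s))
  | h + 1, hh =>
      ((rollout π h (Nat.le_of_succ_le hh)) ⊗ₖ (M.step π h hh)).map (extend h)

instance isMarkovKernel_rollout (π : PolicyFamily W S A H) (h : ℕ) (hh : h ≤ H) :
    IsMarkovKernel (M.rollout π h hh) := by
  induction h with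
  | zero =>
    have : IsProbabilityMeasure (M.ρ.map fun s => ((Fin.elim0, s) : Obs S A 0)) :=
      Measure.isProbabilityMeasure_map (by fun_prop)
    unfold rollout; infer_instance
  | succ h ih =>
    have := ih (Nat.le_of_succ_le hh)
    rw [rollout]
    exact Kernel.IsMarkovKernel.map _ (measurable_extend h)

end Rollout

/-- The cumulative (mean) reward `∑_{h<H} R(h, s_h, a_h)` along an episode. -/
def totalReward (o : Obs S A H) : ℝ := ∑ h : Fin H, M.R (h, o.1 h)

/-- The expected value of the policy `π` under the MDP `M(Θ)`: the expectation of the cumulative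
reward over an episode with `s_0 ∼ ρ`, `a_h = π_h(s_h)`, `s_{h+1} ∼ P_Θ(h, s_h, a_h)`. -/
def value (Θ : Param H d) (π : Policy S A H) : ℝ :=
  ∫ o, M.totalReward o ∂(M.rollout π H le_rfl (Θ, ()))

/-- `π` is optimal for the MDP `M(Θ)`: it maximizes the expected value. -/
def IsOptimal (Θ : Param H d) (π : Policy S A H) : Prop :=
  ∀ π' : Policy S A H, M.value Θ π' ≤ M.value Θ π

section PSRL

variable (prior : Measure (Param H d)) [IsProbabilityMeasure prior]
  (π : PolicyFamily (Param H d) S A H)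

/-- The law of the observational history of the first `n` episodes given the true parameters,
bundled with the fact that it is a Markov kernel, when posterior sampling is used with the map
`Θ ↦ π^Θ` from parameters to policies. Given the history `o` of `n` episodes, `Θ̂` is drawn from the
posterior distribution of the true parameters given `o`, independently of the true parameters;
then an episode is rolled out with `π^Θ̂` in the true MDP, and appended to `o`. -/
def histAux : (n : ℕ) → {κ : Kernel (Param H d) (Hist S A H n) // IsMarkovKernel κ}
  | 0 => ⟨Kernel.const _ (Measure.dirac Fin.elim0), inferInstance⟩
  | n + 1 =>
      let κ := (histAux n).1
      haveI : IsMarkovKernel κ := (histAux n).2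
      ⟨((κ ⊗ₖ (posterior κ prior).prodMkLeft (Param H d)) ⊗ₖ
          ((M.rollout π H le_rfl).comap
            (fun p : Param H d × (Hist S A H n × Param H d) => (p.1, p.2.2)) (by fun_prop))).map
          (fun q => (Fin.snoc q.1.1 q.2 : Hist S A H (n + 1))),
        Kernel.IsMarkovKernel.map _ ((measurable_snoc n).comp
          (g := fun p : Hist S A H n × Obs S A H => (Fin.snoc p.1 p.2 : Hist S A H (n + 1)))
          (f := fun q : (Hist S A H n × Param H d) × Obs S A H => (q.1.1, q.2))
          (by fun_prop))⟩

/-- The law of the observational history before episode `n + 1` of PSRL, given the true `Θ`. -/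
def hist (n : ℕ) : Kernel (Param H d) (Hist S A H n) := (M.histAux prior π n).1

instance (n : ℕ) : IsMarkovKernel (M.hist prior π n) := (M.histAux prior π n).2

theorem hist_succ (n : ℕ) : M.hist prior π (n + 1) =
    ((M.hist prior π n ⊗ₖ (posterior (M.hist prior π n) prior).prodMkLeft (Param H d)) ⊗ₖ
      ((M.rollout π H le_rfl).comap
        (fun p : Param H d × (Hist S A H n × Param H d) => (p.1, p.2.2)) (by fun_prop))).map
      (fun q => (Fin.snoc q.1.1 q.2 : Hist S A H (n + 1))) := rfl

/-- The distribution from which PSRL draws `Θ̂` in episode `n + 1`: the posterior distribution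
of the true parameters given the observational history. -/
def sampler (n : ℕ) : Kernel (Hist S A H n) (Param H d) := posterior (M.hist prior π n) prior

/-- The expected cumulative regret of PSRL over `L` episodes when the true parameters are `Θ`:
the sum over the episodes of the expectation of `value(π^Θ) - value(π^Θ̂)` under `M(Θ)`. -/
def regret (L : ℕ) (Θ : Param H d) : ℝ :=
  ∑ n ∈ Finset.range L, ∫ o, ∫ Θ', (M.value Θ (π.at Θ) - M.value Θ (π.at Θ'))
    ∂(M.sampler prior π n o) ∂(M.hist prior π n Θ)

/-- The Bayesian regret of PSRL over `L` episodes. -/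
def bayesRegret (L : ℕ) : ℝ := ∫ Θ, M.regret prior π L Θ ∂prior

end PSRL

end LinearMixture

/-- The covariance matrix `Γ_{1,h}` of `θ_h` under the prior. -/
def priorCov {H d : ℕ} (prior : Measure (Param H d)) (h : Fin H) : Matrix (Fin d) (Fin d) ℝ :=
  Matrix.of fun i j => covariance (fun Θ : Param H d => Θ h i) (fun Θ : Param H d => Θ h j) prior

end PSRL

end

/-! Given the history, the sample Θ̂ has the posterior law of Θ*, so Θ̂ and Θ* have the same law and
E V^{Θ*}_{π^{Θ*}} = E V^{Θ̂}_{π^{Θ̂}}. The regret of an episode is thus the mean difference of the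
values of one policy, π^{Θ̂}, in the two models M(Θ̂) and M(Θ*). The simulation lemma
(`familyValue_sub_familyValue`) and the linearity of the transitions in the parameters turn it into
∑_h H · E⟨θ̂_h - θ*_h, u_h⟩. Here u_h, of norm at most 1, is the feature of the normalized planned
value V_{h+1}/H at the triple played at stage h (`bayesRegret_eq`).

The likelihood of all observations is a product over stages and the prior is independent over
stages, so the posterior of θ*_h is computed from its own likelihood factor alone. In particular the
current episode up to s_h leaves it unchanged (`map_compProd_episode_stage`). Let m and Γ be its
mean and covariance given the past episodes, and W = (1 + cΓ)⁻¹. The parameter θ*_h may be replaced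
by m, but u_h depends on the sample θ̂_h. A weighted Young inequality separates the two: E⟨θ̂_h - m,
W(θ̂_h - m)⟩ = E tr(WΓ) ≤ d/c, and what remains is c E⟨Γu, WΓu⟩ up to an error 2/c.

This remainder is paid for by information. The next value Y = V_{h+1}(s_{h+1})/H lies in [0, 1] and
has conditional mean ⟨θ*_h, u⟩. The affine estimator m + 4(Y - ⟨m, u⟩)Γu of θ*_h has W-weighted
error at most tr(WΓ) - 4⟨Γu, WΓu⟩ on average, and the posterior mean after the episode does at least
as well. Since log det is concave, E log det(1 + cΓ) therefore falls by at least 4c E⟨Γu, WΓu⟩ in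
each episode (`expected_log_det_reduction`). No assumption on the shape of the posterior enters.

With c = L the log-determinants telescope over the episodes to at most d log(1 + LB²), because the
initial covariance is at most B²I. Optimizing the Young parameter bounds the sum of the gaps of a
stage by √(Ld(d log(1 + LB²)/4 + 2)). The additive 2 is harmless when the logarithm is large. When
it is small, the crude bound LB suffices (`le_sqrt_two_mul_of_le`). Summing over the H stages, each
with its factor H, gives the result. -/

namespace PSRL

open Matrix

/-! ### Log-determinants of positive definite matrices -/

section LogDet

variable {ι : Type*} [Fintype ι] [DecidableEq ι]

open scoped MatrixOrder Matrix.Norms.L2Operator in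
theorem exists_conjTranspose_mul_self_eq {A : Matrix ι ι ℝ} (hA : A.PosSemidef) :
    ∃ C : Matrix ι ι ℝ, A = Cᴴ * C :=
  CStarAlgebra.nonneg_iff_eq_star_mul_self.1 (Matrix.nonneg_iff_posSemidef.2 hA)

/-- This is log x ≤ x - 1 summed over the eigenvalues: the tangent of log det at the identity. -/
theorem log_det_le_trace_sub_card {X : Matrix ι ι ℝ} (hX : X.PosDef) :
    Real.log X.det ≤ X.trace - Fintype.card ι := by
  have hdet : X.det = ∏ i, hX.1.eigenvalues i := by
    simpa using hX.1.det_eq_prod_eigenvalues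
  have htr : X.trace = ∑ i, hX.1.eigenvalues i := by
    simpa using hX.1.trace_eq_sum_eigenvalues
  rw [hdet, htr, Real.log_prod (fun i _ => (hX.eigenvalues_pos i).ne')]
  calc ∑ i, Real.log (hX.1.eigenvalues i) ≤ ∑ i, (hX.1.eigenvalues i - 1) :=
        Finset.sum_le_sum fun i _ => Real.log_le_sub_one_of_pos (hX.eigenvalues_pos i)
    _ = _ := by simp [Finset.sum_sub_distrib]

/-- The logarithm of the determinant lies below its tangents. -/
theorem log_det_le_add_trace {A A' : Matrix ι ι ℝ} (hA : A.PosDef) (hA' : A'.PosDef) :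
    Real.log A'.det ≤ Real.log A.det + (A⁻¹ * (A' - A)).trace := by
  have hAu : IsUnit A.det := hA.det_pos.ne'.isUnit
  -- With A⁻¹ = CᴴC, the matrix C A' Cᴴ has determinant det A' / det A and trace tr(A⁻¹A'). This
  -- reduces the claim to the tangent at the identity.
  obtain ⟨C, hC⟩ := exists_conjTranspose_mul_self_eq hA.inv.posSemidef
  have hdC : A.det * (C.det * C.det) = 1 := by
    have h := congrArg Matrix.det hC
    rw [det_mul, det_conjTranspose, star_trivial] at h
    rw [← h, ← det_mul, Matrix.mul_nonsing_inv _ hAu, det_one]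
  have hCu : IsUnit C := by
    rw [isUnit_iff_isUnit_det, isUnit_iff_ne_zero]
    intro h
    simp [h] at hdC
  have hX : (C * A' * Cᴴ).PosDef := by
    have := hA'.conjTranspose_mul_mul_same (B := Cᴴ) (by
      rw [Matrix.mulVec_injective_iff_isUnit]; exact (isUnit_conjTranspose _).2 hCu)
    simpa using this
  have h := log_det_le_trace_sub_card hX
  have h1 : (C * A' * Cᴴ).det = A'.det * (A.det)⁻¹ := by
    rw [det_mul, det_mul, det_conjTranspose, star_trivial, eq_mul_inv_iff_mul_eq₀ hA.det_pos.ne']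
    linear_combination A'.det * hdC
  have h2 : (C * A' * Cᴴ).trace = (A⁻¹ * A').trace := by
    rw [hC, Matrix.trace_mul_comm, Matrix.mul_assoc]
  rw [h1, h2, Real.log_mul hA'.det_pos.ne' (inv_ne_zero hA.det_pos.ne'), Real.log_inv] at h
  rw [Matrix.mul_sub, Matrix.nonsing_inv_mul _ hAu, trace_sub, trace_one]
  linarith

theorem posDef_one_add_smul {Γ : Matrix ι ι ℝ} (hΓ : Γ.PosSemidef) {c : ℝ} (hc : 0 ≤ c) :
    (1 + c • Γ).PosDef :=
  PosDef.one.add_posSemidef (hΓ.smul hc)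

/-- Take the tangent at the scalar matrix (1 + cb)I: the trace assumption makes its linear term
nonpositive. -/
theorem log_det_one_add_smul_le {Γ : Matrix ι ι ℝ} (hΓ : Γ.PosSemidef) {c b : ℝ} (hc : 0 ≤ c)
    (hb : 0 ≤ b) (htr : Γ.trace ≤ Fintype.card ι * b) :
    Real.log (1 + c • Γ).det ≤ Fintype.card ι * Real.log (1 + c * b) := by
  have ha : 0 < 1 + c * b := by positivity
  have hD : ((1 + c * b) • (1 : Matrix ι ι ℝ)).PosDef := PosDef.one.smul ha
  have h := log_det_le_add_trace hD (posDef_one_add_smul hΓ hc)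
  have hinv : ((1 + c * b) • (1 : Matrix ι ι ℝ))⁻¹ = (1 + c * b)⁻¹ • 1 := by
    apply Matrix.inv_eq_right_inv
    rw [smul_mul_smul_comm, mul_inv_cancel₀ ha.ne', one_smul, mul_one]
  rw [hinv, det_smul, det_one, mul_one, Real.log_pow, smul_mul_assoc, one_mul, trace_smul, trace_sub,
    trace_add, trace_smul, trace_smul, trace_one, smul_eq_mul, smul_eq_mul, smul_eq_mul] at h
  have h3 : (1 + c * b)⁻¹ * (Fintype.card ι + c * Γ.trace - (1 + c * b) * Fintype.card ι) ≤ 0 := by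
    apply mul_nonpos_of_nonneg_of_nonpos (by positivity)
    nlinarith [mul_le_mul_of_nonneg_left htr hc]
  linarith

/-- The tangent at 1 + cΓ, evaluated at the identity, has correction -c tr((1 + cΓ)⁻¹Γ) ≤ 0. -/
theorem log_det_one_add_smul_nonneg {Γ : Matrix ι ι ℝ} (hΓ : Γ.PosSemidef) {c : ℝ} (hc : 0 ≤ c) :
    0 ≤ Real.log (1 + c • Γ).det := by
  have hA := posDef_one_add_smul hΓ hc
  have h := log_det_le_add_trace hA (PosDef.one (n := ι) (R := ℝ))
  have hW := hA.inv.posSemidef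
  have h1 : ((1 + c • Γ)⁻¹ * (1 - (1 + c • Γ))).trace ≤ 0 := by
    obtain ⟨C, hC⟩ := exists_conjTranspose_mul_self_eq hW
    have h2 : 0 ≤ (C * Γ * Cᴴ).trace := (hΓ.mul_mul_conjTranspose_same C).trace_nonneg
    have h3 : ((1 + c • Γ)⁻¹ * (1 - (1 + c • Γ))).trace = - (c * (C * Γ * Cᴴ).trace) := by
      rw [sub_add_cancel_left, hC, Matrix.mul_neg, Matrix.mul_smul, trace_neg, trace_smul,
        smul_eq_mul, Matrix.mul_assoc, trace_mul_comm]
    rw [h3]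
    nlinarith
  rw [det_one, Real.log_one] at h
  linarith

end LogDet

/-! ### Quadratic inequalities for W = (1 + cΓ)⁻¹ -/

section Resolvent

variable {ι : Type*} [Fintype ι] [DecidableEq ι] {Γ : Matrix ι ι ℝ} {c : ℝ}

/-- The regularized inverse `(1 + c Γ)⁻¹`. -/
noncomputable def resolvent (Γ : Matrix ι ι ℝ) (c : ℝ) : Matrix ι ι ℝ := (1 + c • Γ)⁻¹

theorem resolvent_mul (hΓ : Γ.PosSemidef) (hc : 0 ≤ c) :
    resolvent Γ c * (1 + c • Γ) = 1 :=
  Matrix.nonsing_inv_mul _ (posDef_one_add_smul hΓ hc).det_pos.ne'.isUnit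

theorem mul_resolvent (hΓ : Γ.PosSemidef) (hc : 0 ≤ c) :
    (1 + c • Γ) * resolvent Γ c = 1 :=
  Matrix.mul_nonsing_inv _ (posDef_one_add_smul hΓ hc).det_pos.ne'.isUnit

theorem resolvent_posSemidef (hΓ : Γ.PosSemidef) (hc : 0 ≤ c) : (resolvent Γ c).PosSemidef :=
  (posDef_one_add_smul hΓ hc).inv.posSemidef

theorem PosSemidef.dotProduct_mulVec_self_nonneg (h : Γ.PosSemidef) (v : ι → ℝ) :
    0 ≤ v ⬝ᵥ Γ *ᵥ v := by
  simpa using h.dotProduct_mulVec_nonneg v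

theorem PosSemidef.dotProduct_mulVec_symm (h : Γ.PosSemidef) (v w : ι → ℝ) :
    v ⬝ᵥ Γ *ᵥ w = w ⬝ᵥ Γ *ᵥ v := by
  have hs : Γᵀ = Γ := by simpa using h.1.eq
  rw [dotProduct_mulVec, ← mulVec_transpose, hs, dotProduct_comm]

theorem smul_resolvent_mul (hΓ : Γ.PosSemidef) (hc : 0 ≤ c) :
    c • (resolvent Γ c * Γ) = 1 - resolvent Γ c := by
  have h := resolvent_mul hΓ hc
  rw [mul_add, mul_one, Matrix.mul_smul] at h
  rw [← h]; abel

/-- Take traces in cWΓ = 1 - W and drop tr W ≥ 0. This is where the dimension enters the decoupling.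
-/
theorem trace_resolvent_mul_le (hΓ : Γ.PosSemidef) (hc : 0 < c) :
    (resolvent Γ c * Γ).trace ≤ Fintype.card ι / c := by
  have h := congrArg Matrix.trace (smul_resolvent_mul hΓ hc.le)
  rw [trace_smul, trace_sub, trace_one, smul_eq_mul] at h
  have := (resolvent_posSemidef hΓ hc.le).trace_nonneg
  rw [le_div_iff₀ hc]; linarith

/-- With y = Wx one has x = y + cΓy, and the gap between the two sides is c⟨y, Γy⟩ + c²|Γy|². -/
theorem dotProduct_resolvent_le (hΓ : Γ.PosSemidef) (hc : 0 ≤ c) (x : ι → ℝ) :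
    x ⬝ᵥ resolvent Γ c *ᵥ x ≤ x ⬝ᵥ x := by
  set y := resolvent Γ c *ᵥ x with hy
  have hx : x = y + c • Γ *ᵥ y := by
    have : (1 + c • Γ) *ᵥ y = x := by rw [hy, mulVec_mulVec, mul_resolvent hΓ hc, one_mulVec]
    rw [← this, add_mulVec, one_mulVec, smul_mulVec]
  have h1 : 0 ≤ y ⬝ᵥ Γ *ᵥ y := PosSemidef.dotProduct_mulVec_self_nonneg hΓ y
  have h2 : 0 ≤ (Γ *ᵥ y) ⬝ᵥ (Γ *ᵥ y) := by
    simpa using dotProduct_self_star_nonneg (Γ *ᵥ y)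
  have h3 : x ⬝ᵥ x = x ⬝ᵥ y + c * (y ⬝ᵥ Γ *ᵥ y) + c * (c * ((Γ *ᵥ y) ⬝ᵥ (Γ *ᵥ y))) := by
    nth_rewrite 2 [hx]
    rw [dotProduct_add, dotProduct_smul, smul_eq_mul]
    nth_rewrite 2 [hx]
    rw [add_dotProduct, smul_dotProduct, smul_eq_mul]
    ring
  rw [h3]
  nlinarith [mul_nonneg hc h1, mul_nonneg hc (mul_nonneg hc h2)]

/-- Using cWΓ = 1 - W twice, ⟨u, Γu⟩ equals c⟨Γu, WΓu⟩ + ⟨Γu, Wu⟩, and c⟨Γu, Wu⟩ = |u|² - ⟨u, Wu⟩ ≤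
|u|². The first term is the one controlled by the log-determinant. -/
theorem dotProduct_mulVec_le_resolvent (hΓ : Γ.PosSemidef) (hc : 0 < c) (u : ι → ℝ) :
    u ⬝ᵥ Γ *ᵥ u ≤
      c * ((Γ *ᵥ u) ⬝ᵥ resolvent Γ c *ᵥ (Γ *ᵥ u)) + (u ⬝ᵥ u) / c := by
  have hW := resolvent_posSemidef hΓ hc.le
  have e1 : c • (resolvent Γ c *ᵥ (Γ *ᵥ u)) = u - resolvent Γ c *ᵥ u := by
    rw [mulVec_mulVec, ← smul_mulVec, smul_resolvent_mul hΓ hc.le, sub_mulVec, one_mulVec]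
  have e2 : c * ((Γ *ᵥ u) ⬝ᵥ resolvent Γ c *ᵥ (Γ *ᵥ u)) =
      u ⬝ᵥ Γ *ᵥ u - (Γ *ᵥ u) ⬝ᵥ resolvent Γ c *ᵥ u := by
    rw [← smul_eq_mul, ← dotProduct_smul, e1, dotProduct_sub, dotProduct_comm]
  have e3 : c * ((Γ *ᵥ u) ⬝ᵥ resolvent Γ c *ᵥ u) = u ⬝ᵥ u - u ⬝ᵥ resolvent Γ c *ᵥ u := by
    rw [PosSemidef.dotProduct_mulVec_symm hW, ← smul_eq_mul, ← dotProduct_smul, e1, dotProduct_sub]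
  have h4 := PosSemidef.dotProduct_mulVec_self_nonneg hW u
  have e5 : (Γ *ᵥ u) ⬝ᵥ resolvent Γ c *ᵥ u ≤ (u ⬝ᵥ u) / c := by
    rw [le_div_iff₀ hc]; linarith
  linarith

/-- Young's inequality for the pair of dual forms W and W⁻¹ = 1 + cΓ: expand the W-square of v -
t⁻¹(1 + cΓ)u and multiply by t. -/
theorem two_mul_dotProduct_le_resolvent (hΓ : Γ.PosSemidef) (hc : 0 < c) {t : ℝ} (ht : 0 < t)
    (v u : ι → ℝ) :
    2 * (v ⬝ᵥ u) ≤ t * (v ⬝ᵥ resolvent Γ c *ᵥ v) + t⁻¹ * (u ⬝ᵥ u + c * (u ⬝ᵥ Γ *ᵥ u)) := by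
  have hW := resolvent_posSemidef hΓ hc.le
  set a := (1 + c • Γ) *ᵥ u with ha
  have e1 : resolvent Γ c *ᵥ a = u := by rw [ha, mulVec_mulVec, resolvent_mul hΓ hc.le, one_mulVec]
  have h := PosSemidef.dotProduct_mulVec_self_nonneg hW (v - t⁻¹ • a)
  have e2 : a ⬝ᵥ u = u ⬝ᵥ u + c * (u ⬝ᵥ Γ *ᵥ u) := by
    rw [ha, add_mulVec, one_mulVec, smul_mulVec, add_dotProduct, smul_dotProduct, smul_eq_mul,
      dotProduct_comm (Γ *ᵥ u)]
  have e3 : a ⬝ᵥ resolvent Γ c *ᵥ v = v ⬝ᵥ u := by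
    rw [PosSemidef.dotProduct_mulVec_symm hW, e1]
  rw [mulVec_sub, mulVec_smul, e1, sub_dotProduct, dotProduct_sub, dotProduct_sub, smul_dotProduct,
    smul_dotProduct, dotProduct_smul, dotProduct_smul, e3, e2] at h
  simp only [smul_eq_mul] at h
  have h5 := mul_nonneg ht.le h
  have ht' : t * t⁻¹ = 1 := mul_inv_cancel₀ ht.ne'
  have h6 : t * (v ⬝ᵥ resolvent Γ c *ᵥ v - t⁻¹ * v ⬝ᵥ u -
      (t⁻¹ * v ⬝ᵥ u - t⁻¹ * (t⁻¹ * (u ⬝ᵥ u + c * u ⬝ᵥ Γ *ᵥ u)))) =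
      t * (v ⬝ᵥ resolvent Γ c *ᵥ v) - 2 * (v ⬝ᵥ u) + t⁻¹ * (u ⬝ᵥ u + c * u ⬝ᵥ Γ *ᵥ u) := by
    linear_combination (-2 * (v ⬝ᵥ u) + t⁻¹ * (u ⬝ᵥ u + c * u ⬝ᵥ Γ *ᵥ u)) * ht'
  linarith [h6]

/-- Test positivity on e_i ± e_j, the diagonal entries being at most 1. The bound is uniform in Γ
and serves to make everything integrable. -/
theorem abs_resolvent_apply_le (hΓ : Γ.PosSemidef) (hc : 0 ≤ c) (i j : ι) :
    |resolvent Γ c i j| ≤ 1 := by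
  have hW := resolvent_posSemidef hΓ hc
  have e (k l : ι) : Pi.single k (1 : ℝ) ⬝ᵥ resolvent Γ c *ᵥ Pi.single l 1 = resolvent Γ c k l := by
    simp
  have key (s : ℝ) := PosSemidef.dotProduct_mulVec_self_nonneg hW
    (Pi.single i (1 : ℝ) + s • Pi.single j 1)
  have hd (k : ι) : resolvent Γ c k k ≤ 1 := by
    have := dotProduct_resolvent_le hΓ hc (Pi.single k (1 : ℝ))
    rw [e] at this
    simpa using this
  have hs : resolvent Γ c j i = resolvent Γ c i j := by
    rw [← e, ← e, PosSemidef.dotProduct_mulVec_symm hW]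
  simp only [mulVec_add, mulVec_smul, add_dotProduct, dotProduct_add, smul_dotProduct,
    dotProduct_smul, e, smul_eq_mul, hs] at key
  have h1 := key 1
  have h2 := key (-1)
  have := hd i
  have := hd j
  rw [abs_le]
  constructor <;> linarith

end Resolvent

/-! ### Measurability of matrix operations -/

section MeasurableMatrix

variable {α ι : Type*} [MeasurableSpace α] [Fintype ι]

theorem measurable_dotProduct {v w : α → ι → ℝ} (hv : ∀ i, Measurable fun x => v x i)
    (hw : ∀ i, Measurable fun x => w x i) : Measurable fun x => v x ⬝ᵥ w x := by
  simp only [dotProduct]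
  exact Finset.measurable_sum _ fun i _ => (hv i).mul (hw i)

theorem measurable_mulVec {A : α → Matrix ι ι ℝ} {v : α → ι → ℝ}
    (hA : ∀ i j, Measurable fun x => A x i j) (hv : ∀ i, Measurable fun x => v x i) (i : ι) :
    Measurable fun x => (A x *ᵥ v x) i :=
  measurable_dotProduct (hA i) hv

theorem measurable_trace_mul {A C : α → Matrix ι ι ℝ} (hA : ∀ i j, Measurable fun x => A x i j)
    (hC : ∀ i j, Measurable fun x => C x i j) : Measurable fun x => (A x * C x).trace := by
  simp only [trace, diag, mul_apply]
  exact Finset.measurable_sum _ fun i _ => Finset.measurable_sum _ fun j _ => (hA i j).mul (hC j i)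

variable [DecidableEq ι]

theorem measurable_det {A : α → Matrix ι ι ℝ} (hA : ∀ i j, Measurable fun x => A x i j) :
    Measurable fun x => (A x).det := by
  simp only [det_apply]
  exact Finset.measurable_sum _ fun σ _ =>
    (Finset.measurable_prod _ fun i _ => hA _ _).const_smul _

/-- By Cramer's rule the entries are polynomials in the entries of the matrix divided by the
determinant. With the convention that 0⁻¹ = 0 this also covers singular matrices. -/
theorem measurable_matrix_inv {A : α → Matrix ι ι ℝ} (hA : ∀ i j, Measurable fun x => A x i j)
    (i j : ι) : Measurable fun x => (A x)⁻¹ i j := by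
  simp only [inv_def, Matrix.smul_apply, Ring.inverse_eq_inv, adjugate_apply, smul_eq_mul]
  refine (measurable_det hA).inv.mul (measurable_det (A := fun x => (A x).updateRow j _) fun k l => ?_)
  by_cases hk : k = j
  · subst hk; simp
  · simpa [updateRow_ne hk] using hA k l

theorem measurable_one_add_smul {A : α → Matrix ι ι ℝ} (hA : ∀ i j, Measurable fun x => A x i j)
    (c : ℝ) (i j : ι) : Measurable fun x => (1 + c • A x) i j := by
  simp only [Matrix.add_apply, Matrix.smul_apply]
  exact measurable_const.add ((hA i j).const_smul c)

theorem measurable_resolvent {A : α → Matrix ι ι ℝ} (hA : ∀ i j, Measurable fun x => A x i j)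
    (c : ℝ) (i j : ι) : Measurable fun x => resolvent (A x) c i j :=
  measurable_matrix_inv (measurable_one_add_smul hA c) i j

end MeasurableMatrix

/-! ### Mean and covariance of a law carried by a ball -/

section Moments

variable {d : ℕ}

/-- The mean of a measure on `ℝ^d`. -/
noncomputable def meanVec (q : Measure (EuclideanSpace ℝ (Fin d))) (i : Fin d) : ℝ := ∫ θ, θ i ∂q

/-- The covariance matrix of a measure on `ℝ^d`. -/
noncomputable def covMat (q : Measure (EuclideanSpace ℝ (Fin d))) : Matrix (Fin d) (Fin d) ℝ :=
  Matrix.of fun i j => covariance (fun θ : EuclideanSpace ℝ (Fin d) => θ i) (fun θ => θ j) q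

theorem abs_apply_le_norm (θ : EuclideanSpace ℝ (Fin d)) (i : Fin d) : |θ i| ≤ ‖θ‖ := by
  simpa using PiLp.norm_apply_le θ i

theorem dotProduct_ofLp (u v : EuclideanSpace ℝ (Fin d)) : u.ofLp ⬝ᵥ v.ofLp = inner ℝ u v := by
  rw [EuclideanSpace.inner_eq_star_dotProduct]; simp [dotProduct_comm]

theorem dotProduct_ofLp_self (u : EuclideanSpace ℝ (Fin d)) : u.ofLp ⬝ᵥ u.ofLp = ‖u‖ ^ 2 := by
  rw [dotProduct_ofLp, real_inner_self_eq_norm_sq]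

variable {q : Measure (EuclideanSpace ℝ (Fin d))} [IsProbabilityMeasure q] {B : ℝ}

theorem memLp_apply (hq : ∀ᵐ θ ∂q, ‖θ‖ ≤ B) (i : Fin d) :
    MemLp (fun θ : EuclideanSpace ℝ (Fin d) => θ i) 2 q :=
  MemLp.of_bound (by fun_prop) B (hq.mono fun θ h => (abs_apply_le_norm θ i).trans h)

theorem integrable_apply (hq : ∀ᵐ θ ∂q, ‖θ‖ ≤ B) (i : Fin d) :
    Integrable (fun θ : EuclideanSpace ℝ (Fin d) => θ i) q :=
  (memLp_apply hq i).integrable one_le_two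

theorem memLp_sub_meanVec (hq : ∀ᵐ θ ∂q, ‖θ‖ ≤ B) (i : Fin d) :
    MemLp (fun θ : EuclideanSpace ℝ (Fin d) => θ i - meanVec q i) 2 q :=
  (memLp_apply hq i).sub (memLp_const _)

theorem integrable_sub_mul_sub (hq : ∀ᵐ θ ∂q, ‖θ‖ ≤ B) (i j : Fin d) :
    Integrable (fun θ : EuclideanSpace ℝ (Fin d) =>
      (θ i - meanVec q i) * (θ j - meanVec q j)) q :=
  (memLp_sub_meanVec hq i).integrable_mul (memLp_sub_meanVec hq j)

theorem abs_meanVec_le (hq : ∀ᵐ θ ∂q, ‖θ‖ ≤ B) (i : Fin d) : |meanVec q i| ≤ B := by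
  have := norm_integral_le_of_norm_le_const (μ := q) (f := fun θ => θ i) (C := B)
    (hq.mono fun θ h => (abs_apply_le_norm θ i).trans h)
  simpa [meanVec] using this

theorem integral_dotProduct_sub (hq : ∀ᵐ θ ∂q, ‖θ‖ ≤ B) (v : Fin d → ℝ) :
    ∫ θ, v ⬝ᵥ (θ.ofLp - meanVec q) ∂q = 0 := by
  simp only [dotProduct, Pi.sub_apply]
  rw [integral_finsetSum (f := fun i (θ : EuclideanSpace ℝ (Fin d)) =>
    v i * (θ i - meanVec q i)) _ fun i _ =>
    ((integrable_apply hq i).sub (integrable_const _)).const_mul _]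
  refine Finset.sum_eq_zero fun i _ => ?_
  rw [integral_const_mul, integral_sub (integrable_apply hq i) (integrable_const _)]
  simp [meanVec]

theorem integrable_dotProduct_sub_mul (hq : ∀ᵐ θ ∂q, ‖θ‖ ≤ B) (v w : Fin d → ℝ) :
    Integrable (fun θ => (v ⬝ᵥ (θ.ofLp - meanVec q)) * (w ⬝ᵥ (θ.ofLp - meanVec q))) q := by
  have h (v : Fin d → ℝ) : MemLp (fun θ : EuclideanSpace ℝ (Fin d) =>
      v ⬝ᵥ (θ.ofLp - meanVec q)) 2 q := by
    simp only [dotProduct, Pi.sub_apply]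
    exact memLp_finsetSum _ fun i _ => (memLp_sub_meanVec hq i).const_mul _
  exact (h v).integrable_mul (h w)

theorem integral_dotProduct_sub_mul (hq : ∀ᵐ θ ∂q, ‖θ‖ ≤ B) (v w : Fin d → ℝ) :
    ∫ θ, (v ⬝ᵥ (θ.ofLp - meanVec q)) * (w ⬝ᵥ (θ.ofLp - meanVec q)) ∂q = v ⬝ᵥ covMat q *ᵥ w := by
  have e (θ : EuclideanSpace ℝ (Fin d)) :
      (v ⬝ᵥ (θ.ofLp - meanVec q)) * (w ⬝ᵥ (θ.ofLp - meanVec q)) =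
        ∑ i, ∑ j, (v i * w j) * ((θ i - meanVec q i) * (θ j - meanVec q j)) := by
    simp only [dotProduct, Pi.sub_apply, Finset.sum_mul_sum]
    exact Finset.sum_congr rfl fun i _ => Finset.sum_congr rfl fun j _ => by ring
  simp only [e]
  rw [integral_finsetSum _ fun i _ => integrable_finsetSum _ fun j _ =>
    (integrable_sub_mul_sub hq i j).const_mul _]
  simp only [dotProduct, mulVec, Finset.mul_sum]
  refine Finset.sum_congr rfl fun i _ => ?_
  rw [integral_finsetSum _ fun j _ => (integrable_sub_mul_sub hq i j).const_mul _]
  refine Finset.sum_congr rfl fun j _ => ?_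
  rw [integral_const_mul]
  simp only [covMat, covariance, meanVec, of_apply]
  ring

theorem integrable_quadratic (hq : ∀ᵐ θ ∂q, ‖θ‖ ≤ B) (W : Matrix (Fin d) (Fin d) ℝ) :
    Integrable (fun θ => (θ.ofLp - meanVec q) ⬝ᵥ W *ᵥ (θ.ofLp - meanVec q)) q := by
  simp only [dotProduct, mulVec, Finset.mul_sum, Pi.sub_apply]
  refine integrable_finsetSum _ fun i _ => integrable_finsetSum _ fun j _ => ?_
  exact ((integrable_sub_mul_sub hq i j).const_mul (W i j)).congr
    (Filter.Eventually.of_forall fun θ => by ring)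

theorem integral_quadratic (hq : ∀ᵐ θ ∂q, ‖θ‖ ≤ B) (W : Matrix (Fin d) (Fin d) ℝ) :
    ∫ θ, (θ.ofLp - meanVec q) ⬝ᵥ W *ᵥ (θ.ofLp - meanVec q) ∂q = (W * covMat q).trace := by
  have e (θ : EuclideanSpace ℝ (Fin d)) :
      (θ.ofLp - meanVec q) ⬝ᵥ W *ᵥ (θ.ofLp - meanVec q) =
        ∑ i, ∑ j, W i j * ((θ j - meanVec q j) * (θ i - meanVec q i)) := by
    simp only [dotProduct, mulVec, Finset.mul_sum, Pi.sub_apply]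
    exact Finset.sum_congr rfl fun i _ => Finset.sum_congr rfl fun j _ => by ring
  simp only [e, trace, diag, mul_apply]
  rw [integral_finsetSum (f := fun i (θ : EuclideanSpace ℝ (Fin d)) =>
    ∑ j, W i j * ((θ j - meanVec q j) * (θ i - meanVec q i))) _ fun i _ =>
    integrable_finsetSum _ fun j _ => (integrable_sub_mul_sub hq j i).const_mul _]
  refine Finset.sum_congr rfl fun i _ => ?_
  rw [integral_finsetSum _ fun j _ => (integrable_sub_mul_sub hq j i).const_mul _]
  refine Finset.sum_congr rfl fun j _ => ?_
  rw [integral_const_mul]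
  simp only [covMat, covariance, meanVec, of_apply]

theorem covMat_posSemidef (hq : ∀ᵐ θ ∂q, ‖θ‖ ≤ B) : (covMat q).PosSemidef := by
  refine PosSemidef.of_dotProduct_mulVec_nonneg ?_ fun v => ?_
  · ext i j
    simp [covMat, covariance_comm]
  · rw [star_trivial, ← integral_dotProduct_sub_mul hq]
    exact integral_nonneg fun θ => mul_self_nonneg _

/-- The quadratic error of an estimate is at least the quadratic error of the mean. -/
theorem trace_mul_covMat_le (hq : ∀ᵐ θ ∂q, ‖θ‖ ≤ B) {W : Matrix (Fin d) (Fin d) ℝ}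
    (hW : W.PosSemidef) (e : Fin d → ℝ) :
    (W * covMat q).trace ≤ ∫ θ, (θ.ofLp - e) ⬝ᵥ W *ᵥ (θ.ofLp - e) ∂q := by
  have h (θ : EuclideanSpace ℝ (Fin d)) : (θ.ofLp - e) ⬝ᵥ W *ᵥ (θ.ofLp - e) =
      (θ.ofLp - meanVec q) ⬝ᵥ W *ᵥ (θ.ofLp - meanVec q) +
        2 * ((W *ᵥ (meanVec q - e)) ⬝ᵥ (θ.ofLp - meanVec q)) +
        (meanVec q - e) ⬝ᵥ W *ᵥ (meanVec q - e) := by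
    have e1 : θ.ofLp - e = (θ.ofLp - meanVec q) + (meanVec q - e) := by abel
    rw [e1, mulVec_add, add_dotProduct, dotProduct_add, dotProduct_add,
      PosSemidef.dotProduct_mulVec_symm hW (meanVec q - e) (θ.ofLp - meanVec q),
      dotProduct_comm (W *ᵥ (meanVec q - e))]
    ring
  have hi : Integrable (fun θ : EuclideanSpace ℝ (Fin d) =>
      2 * ((W *ᵥ (meanVec q - e)) ⬝ᵥ (θ.ofLp - meanVec q))) q := by
    simp only [dotProduct, Pi.sub_apply]
    exact (integrable_finsetSum _ fun i _ =>
      ((integrable_apply hq i).sub (integrable_const _)).const_mul _).const_mul _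
  rw [integral_congr_ae (Filter.Eventually.of_forall h)]
  rw [integral_add ((integrable_quadratic hq W).fun_add hi) (integrable_const _),
    integral_add (integrable_quadratic hq W) hi, integral_quadratic hq, integral_const_mul,
    integral_dotProduct_sub hq]
  have := PosSemidef.dotProduct_mulVec_self_nonneg hW (meanVec q - e)
  rw [integral_const, probReal_univ, one_smul]
  linarith

/-- The variance in direction v is at most the second moment: take W = v vᵀ and the estimate 0 in
`trace_mul_covMat_le`, then apply Cauchy–Schwarz. -/
theorem dotProduct_covMat_le (hq : ∀ᵐ θ ∂q, ‖θ‖ ≤ B) (v : Fin d → ℝ) :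
    v ⬝ᵥ covMat q *ᵥ v ≤ B ^ 2 * (v ⬝ᵥ v) := by
  have h := trace_mul_covMat_le hq (posSemidef_vecMulVec_self_star v) 0
  have e1 : (vecMulVec v (star v) * covMat q).trace = v ⬝ᵥ covMat q *ᵥ v := by
    rw [star_trivial, vecMulVec_mul, trace_vecMulVec, dotProduct_comm, ← dotProduct_mulVec]
  rw [e1] at h
  refine h.trans ?_
  have e2 (θ : EuclideanSpace ℝ (Fin d)) :
      (θ.ofLp - 0) ⬝ᵥ vecMulVec v (star v) *ᵥ (θ.ofLp - 0) = (inner ℝ θ (WithLp.toLp 2 v)) ^ 2 := by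
    rw [sub_zero, vecMulVec_mulVec, star_trivial, ← dotProduct_ofLp]
    simp [dotProduct_comm, sq]
  simp only [e2]
  have hb : ∀ᵐ θ ∂q, ‖(inner ℝ θ (WithLp.toLp 2 v)) ^ 2‖ ≤ B ^ 2 * (v ⬝ᵥ v) := by
    filter_upwards [hq] with θ hθ
    have h1 := abs_real_inner_le_norm θ (WithLp.toLp 2 v)
    have h2 : v ⬝ᵥ v = ‖(WithLp.toLp 2 v : EuclideanSpace ℝ (Fin d))‖ ^ 2 := by
      rw [← dotProduct_ofLp_self]
    rw [h2, norm_pow, Real.norm_eq_abs, ← mul_pow]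
    exact pow_le_pow_left₀ (abs_nonneg _)
      (h1.trans (mul_le_mul_of_nonneg_right hθ (norm_nonneg _))) 2
  have := norm_integral_le_of_norm_le_const hb
  simp only [probReal_univ, mul_one] at this
  exact (le_abs_self _).trans this

theorem smul_one_sub_covMat_posSemidef (hq : ∀ᵐ θ ∂q, ‖θ‖ ≤ B) :
    (B ^ 2 • (1 : Matrix (Fin d) (Fin d) ℝ) - covMat q).PosSemidef := by
  refine PosSemidef.of_dotProduct_mulVec_nonneg ?_ fun v => ?_
  · exact (IsHermitian.smul (isHermitian_one) (by simp [IsSelfAdjoint])).sub (covMat_posSemidef hq).1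
  · rw [star_trivial, sub_mulVec, smul_mulVec, one_mulVec, dotProduct_sub, dotProduct_smul,
      smul_eq_mul, sub_nonneg]
    exact dotProduct_covMat_le hq v

/-- Only the trace is needed: B²I - Γ is positive semidefinite, so tr Γ ≤ dB². -/
theorem log_det_covMat_le (hq : ∀ᵐ θ ∂q, ‖θ‖ ≤ B) {c : ℝ} (hc : 0 ≤ c) :
    Real.log (1 + c • covMat q).det ≤ d * Real.log (1 + c * B ^ 2) := by
  have h := (smul_one_sub_covMat_posSemidef hq).trace_nonneg
  have := log_det_one_add_smul_le (covMat_posSemidef hq) hc (sq_nonneg B) (by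
    rw [trace_sub, trace_smul, trace_one, smul_eq_mul] at h; linarith)
  simpa using this

end Moments

section KernelMoments

variable {d : ℕ} {𝒳 : Type*} [MeasurableSpace 𝒳] (q : Kernel 𝒳 (EuclideanSpace ℝ (Fin d)))
  [IsMarkovKernel q] {B : ℝ}

theorem measurable_meanVec (i : Fin d) : Measurable fun x => meanVec (q x) i := by
  unfold meanVec
  exact (StronglyMeasurable.integral_kernel (κ := q)
    (Measurable.stronglyMeasurable (by fun_prop))).measurable

theorem measurable_covMat (hq : ∀ x, ∀ᵐ θ ∂q x, ‖θ‖ ≤ B) (i j : Fin d) :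
    Measurable fun x => covMat (q x) i j := by
  have (x : 𝒳) : covMat (q x) i j =
      ∫ θ, θ i * θ j ∂(q x) - (∫ θ, θ i ∂(q x)) * ∫ θ, θ j ∂(q x) :=
    covariance_eq_sub (memLp_apply (hq x) i) (memLp_apply (hq x) j)
  simp only [this]
  have h1 := (StronglyMeasurable.integral_kernel (κ := q)
    (f := fun θ : EuclideanSpace ℝ (Fin d) => θ i * θ j)
    (Measurable.stronglyMeasurable (by fun_prop))).measurable
  exact h1.sub ((measurable_meanVec q i).mul (measurable_meanVec q j))

end KernelMoments

theorem integrable_of_abs_le {α : Type*} [MeasurableSpace α] {μ : Measure α} [IsFiniteMeasure μ]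
    {f : α → ℝ} (hf : Measurable f) {C : ℝ} (h : ∀ᵐ x ∂μ, |f x| ≤ C) : Integrable f μ :=
  Integrable.of_bound hf.aestronglyMeasurable C h

theorem integrable_fun_sub {α : Type*} [MeasurableSpace α] {μ : Measure α} {f g : α → ℝ}
    (hf : Integrable f μ) (hg : Integrable g μ) : Integrable (fun x => f x - g x) μ :=
  hf.sub hg

theorem abs_dotProduct_le {ι : Type*} [Fintype ι] {v w : ι → ℝ} {a b : ℝ} (ha : 0 ≤ a)
    (hv : ∀ i, |v i| ≤ a) (hw : ∀ i, |w i| ≤ b) : |v ⬝ᵥ w| ≤ Fintype.card ι * (a * b) := by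
  simp only [dotProduct]
  refine (Finset.abs_sum_le_sum_abs _ _).trans ?_
  refine (Finset.sum_le_sum fun i _ => (?_ : |v i * w i| ≤ a * b)).trans ?_
  · rw [abs_mul]
    exact mul_le_mul (hv i) (hw i) (abs_nonneg _) ha
  · simp

/-! ### Expected decrease of the log-determinant under a bounded observation -/

section Reduction

variable {d : ℕ} {𝒳 𝒵 : Type*} [MeasurableSpace 𝒳] [MeasurableSpace 𝒵]

theorem abs_covMat_le {q : Measure (EuclideanSpace ℝ (Fin d))} [IsProbabilityMeasure q] {B : ℝ}
    (hB : 0 ≤ B) (hq : ∀ᵐ θ ∂q, ‖θ‖ ≤ B) (i j : Fin d) : |covMat q i j| ≤ (2 * B) * (2 * B) := by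
  have h : ∀ᵐ θ ∂q, ‖(θ i - meanVec q i) * (θ j - meanVec q j)‖ ≤ (2 * B) * (2 * B) := by
    filter_upwards [hq] with θ hθ
    have hb (k : Fin d) : |θ k - meanVec q k| ≤ 2 * B := by
      have := (abs_sub (θ k) (meanVec q k)).trans
        (add_le_add ((abs_apply_le_norm θ k).trans hθ) (abs_meanVec_le hq k))
      linarith
    rw [norm_mul]
    exact mul_le_mul (hb i) (hb j) (abs_nonneg _) (by positivity)
  have := norm_integral_le_of_norm_le_const h
  simpa [covMat, covariance, meanVec] using this

variable {q : Kernel 𝒳 (EuclideanSpace ℝ (Fin d))} [IsMarkovKernel q]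
  {q' : Kernel 𝒵 (EuclideanSpace ℝ (Fin d))} [IsMarkovKernel q']
  {ζ : Measure 𝒵} [IsProbabilityMeasure ζ] {B : ℝ} {r : 𝒵 → 𝒳}

/-- If `q'` refines the conditional law `q`, and `Y ∈ [0, 1]` has conditional mean `⟨θ, u⟩`, then
the expected value of `log det (1 + c Γ)` decreases by at least a multiple of
`⟨Γ u, (1 + c Γ)⁻¹ Γ u⟩`. -/
theorem expected_log_det_reduction (hB : 0 ≤ B) (hq : ∀ x, ∀ᵐ θ ∂q x, ‖θ‖ ≤ B)
    (hq' : ∀ z, ∀ᵐ θ ∂q' z, ‖θ‖ ≤ B) (hr : Measurable r)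
    (hdis : (ζ ⊗ₘ q').map (Prod.map r id) = (ζ.map r) ⊗ₘ q)
    {u : 𝒳 → EuclideanSpace ℝ (Fin d)} (hu : Measurable u) (hu1 : ∀ x, ‖u x‖ ≤ 1)
    {Y : 𝒵 → ℝ} (hY : Measurable Y) (hY01 : ∀ z, Y z ∈ Set.Icc (0 : ℝ) 1)
    (hYmean : ∀ Φ : 𝒳 × EuclideanSpace ℝ (Fin d) → ℝ, Measurable Φ →
      (∃ C, ∀ᵐ p ∂(ζ ⊗ₘ q'), |Φ (r p.1, p.2)| ≤ C) →
      ∫ p, Y p.1 * Φ (r p.1, p.2) ∂(ζ ⊗ₘ q') =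
        ∫ p, inner ℝ p.2 (u (r p.1)) * Φ (r p.1, p.2) ∂(ζ ⊗ₘ q'))
    {c : ℝ} (hc : 0 ≤ c) :
    4 * c * ∫ z, (covMat (q (r z)) *ᵥ u (r z)) ⬝ᵥ
        resolvent (covMat (q (r z))) c *ᵥ (covMat (q (r z)) *ᵥ u (r z)) ∂ζ ≤
      ∫ z, Real.log (1 + c • covMat (q (r z))).det ∂ζ -
        ∫ z, Real.log (1 + c • covMat (q' z)).det ∂ζ := by
  set m : 𝒳 → Fin d → ℝ := fun x => meanVec (q x) with hm
  set Γ : 𝒳 → Matrix (Fin d) (Fin d) ℝ := fun x => covMat (q x) with hΓ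
  set W : 𝒳 → Matrix (Fin d) (Fin d) ℝ := fun x => resolvent (Γ x) c with hW
  set w : 𝒳 → Fin d → ℝ := fun x => Γ x *ᵥ (u x).ofLp with hw
  set a : 𝒳 → ℝ := fun x => w x ⬝ᵥ W x *ᵥ w x with ha
  set y : 𝒳 → ℝ := fun x => m x ⬝ᵥ (u x).ofLp with hy
  -- measurability
  have mm : ∀ i, Measurable fun x => m x i := measurable_meanVec q
  have mΓ : ∀ i j, Measurable fun x => Γ x i j := measurable_covMat q hq
  have mΓ' : ∀ i j, Measurable fun z => covMat (q' z) i j := measurable_covMat q' hq'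
  have mW : ∀ i j, Measurable fun x => W x i j := measurable_resolvent mΓ c
  have mu : ∀ i, Measurable fun x => u x i := fun i => by fun_prop
  have mw : ∀ i, Measurable fun x => w x i := measurable_mulVec mΓ mu
  have mWw : ∀ i, Measurable fun x => (W x *ᵥ w x) i := measurable_mulVec mW mw
  have ma : Measurable a := measurable_dotProduct mw mWw
  have my : Measurable y := measurable_dotProduct mm mu
  -- bounds
  have pΓ : ∀ x, (Γ x).PosSemidef := fun x => covMat_posSemidef (hq x)
  have pW : ∀ x, (W x).PosSemidef := fun x => resolvent_posSemidef (pΓ x) hc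
  have a0 : ∀ x, 0 ≤ a x := fun x => PosSemidef.dotProduct_mulVec_self_nonneg (pW x) _
  have bm : ∀ x i, |m x i| ≤ B := fun x i => abs_meanVec_le (hq x) i
  have bΓ : ∀ x i j, |Γ x i j| ≤ 2 * B * (2 * B) := fun x => abs_covMat_le hB (hq x)
  have bW : ∀ x i j, |W x i j| ≤ 1 := fun x => abs_resolvent_apply_le (pΓ x) hc
  have bu : ∀ x i, |u x i| ≤ 1 := fun x i => (abs_apply_le_norm _ i).trans (hu1 x)
  obtain ⟨cw, cw0, bw⟩ : ∃ C, 0 ≤ C ∧ ∀ x i, |w x i| ≤ C :=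
    ⟨_, by positivity, fun x i => abs_dotProduct_le (by positivity) (bΓ x i) (bu x)⟩
  obtain ⟨cWw, cWw0, bWw⟩ : ∃ C, 0 ≤ C ∧ ∀ x i, |(W x *ᵥ w x) i| ≤ C :=
    ⟨_, by positivity, fun x i => abs_dotProduct_le zero_le_one (bW x i) (bw x)⟩
  obtain ⟨ca, ca0, ba⟩ : ∃ C, 0 ≤ C ∧ ∀ x, |a x| ≤ C :=
    ⟨_, by positivity, fun x => abs_dotProduct_le cw0 (bw x) (bWw x)⟩
  obtain ⟨cy, cy0, bby⟩ : ∃ C, 0 ≤ C ∧ ∀ x, |y x| ≤ C :=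
    ⟨_, by positivity, fun x => abs_dotProduct_le hB (bm x) (bu x)⟩
  -- traces
  have mtr : Measurable fun x => (W x * Γ x).trace := measurable_trace_mul mW mΓ
  have mtr' : Measurable fun z => (W (r z) * covMat (q' z)).trace :=
    measurable_trace_mul (fun i j => (mW i j).comp hr) mΓ'
  obtain ⟨ct, bt⟩ : ∃ C, ∀ (x : 𝒳) (M : Matrix (Fin d) (Fin d) ℝ),
      (∀ i j, |M i j| ≤ 2 * B * (2 * B)) → |(W x * M).trace| ≤ C := by
    refine ⟨∑ _i : Fin d, ∑ _j : Fin d, 1 * (2 * B * (2 * B)), fun x M hM => ?_⟩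
    simp only [trace, diag, mul_apply]
    refine (Finset.abs_sum_le_sum_abs _ _).trans (Finset.sum_le_sum fun i _ => ?_)
    refine (Finset.abs_sum_le_sum_abs _ _).trans (Finset.sum_le_sum fun j _ => ?_)
    rw [abs_mul]
    exact mul_le_mul (bW x i j) (hM j i) (abs_nonneg _) zero_le_one
  have itr : Integrable (fun z => (W (r z) * Γ (r z)).trace) ζ :=
    integrable_of_abs_le (mtr.comp hr) (Filter.Eventually.of_forall fun z => bt _ _ (bΓ _))
  have itr' : Integrable (fun z => (W (r z) * covMat (q' z)).trace) ζ :=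
    integrable_of_abs_le mtr' (Filter.Eventually.of_forall fun z =>
      bt _ _ (abs_covMat_le hB (hq' z)))
  have ia : Integrable (fun z => a (r z)) ζ :=
    integrable_of_abs_le (ma.comp hr) (Filter.Eventually.of_forall fun z => ba _)
  -- the tangent inequality
  have blog (p : Measure (EuclideanSpace ℝ (Fin d))) [IsProbabilityMeasure p]
      (hp : ∀ᵐ θ ∂p, ‖θ‖ ≤ B) :
      |Real.log (1 + c • covMat p).det| ≤ d * Real.log (1 + c * B ^ 2) := by
    rw [abs_of_nonneg (log_det_one_add_smul_nonneg (covMat_posSemidef hp) hc)]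
    exact log_det_covMat_le hp hc
  have il : Integrable (fun z => Real.log (1 + c • Γ (r z)).det) ζ :=
    integrable_of_abs_le (Real.measurable_log.comp
      ((measurable_det (measurable_one_add_smul mΓ c)).comp hr))
      (Filter.Eventually.of_forall fun z => blog _ (hq _))
  have il' : Integrable (fun z => Real.log (1 + c • covMat (q' z)).det) ζ :=
    integrable_of_abs_le (Real.measurable_log.comp
      (measurable_det (measurable_one_add_smul mΓ' c)))
      (Filter.Eventually.of_forall fun z => blog _ (hq' _))
  have hlog : ∫ z, Real.log (1 + c • covMat (q' z)).det ∂ζ ≤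
      ∫ z, Real.log (1 + c • Γ (r z)).det ∂ζ +
        c * (∫ z, (W (r z) * covMat (q' z)).trace ∂ζ - ∫ z, (W (r z) * Γ (r z)).trace ∂ζ) := by
    rw [← integral_sub itr' itr, ← integral_const_mul,
      ← integral_add il ((integrable_fun_sub itr' itr).const_mul c)]
    refine integral_mono il' (il.add ((integrable_fun_sub itr' itr).const_mul c)) fun z => ?_
    have h := log_det_le_add_trace (posDef_one_add_smul (pΓ (r z)) hc)
      (posDef_one_add_smul (covMat_posSemidef (hq' z)) hc)
    rw [add_sub_add_left_eq_sub, ← smul_sub, Matrix.mul_smul, trace_smul, Matrix.mul_sub,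
      trace_sub, smul_eq_mul] at h
    exact h
  -- the estimator
  set P := ζ ⊗ₘ q' with hP
  have hPB : ∀ᵐ p ∂P, ‖p.2‖ ≤ B :=
    Measure.ae_compProd_of_ae_ae (measurableSet_le (by fun_prop) measurable_const)
      (Filter.Eventually.of_forall hq')
  have hqB : ∀ᵐ p ∂((ζ.map r) ⊗ₘ q), ‖p.2‖ ≤ B :=
    Measure.ae_compProd_of_ae_ae (measurableSet_le (by fun_prop) measurable_const)
      (Filter.Eventually.of_forall hq)
  have hpr : IsProbabilityMeasure (ζ.map r) := Measure.isProbabilityMeasure_map hr.aemeasurable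
  -- By `hdis`, the law of θ given r z is q (r z). Hence functions of (r z, θ) can first be averaged
  -- over q, where the first two moments are known.
  have transfer (Ψ : 𝒳 × EuclideanSpace ℝ (Fin d) → ℝ) (mΨ : Measurable Ψ) (C : ℝ)
      (bΨ : ∀ x θ, ‖θ‖ ≤ B → |Ψ (x, θ)| ≤ C) :
      Integrable (fun p : 𝒵 × EuclideanSpace ℝ (Fin d) => Ψ (r p.1, p.2)) P ∧
      ∫ p, Ψ (r p.1, p.2) ∂P = ∫ z, ∫ θ, Ψ (r z, θ) ∂(q (r z)) ∂ζ := by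
    refine ⟨integrable_of_abs_le (mΨ.comp (by fun_prop)) (hPB.mono fun p hp => bΨ _ _ hp), ?_⟩
    have h1 : ∫ p, Ψ p ∂(P.map (Prod.map r id)) = ∫ p, Ψ (r p.1, p.2) ∂P :=
      integral_map (by fun_prop) mΨ.aestronglyMeasurable
    rw [← h1, hdis, Measure.integral_compProd (integrable_of_abs_le mΨ
      (hqB.mono fun p hp => bΨ p.1 p.2 hp)), integral_map hr.aemeasurable]
    exact (StronglyMeasurable.integral_kernel_prod_right' (κ := q)
      mΨ.stronglyMeasurable).aestronglyMeasurable
  -- The estimator m + λ(Y - y)w changes the mean error by at most (-2λ + λ²/4)a, since Y has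
  -- conditional variance at most 1/4. The choice λ = 4 minimizes this and gives -4a.
  set e : 𝒵 → Fin d → ℝ := fun z => m (r z) + (4 * (Y z - y (r z))) • w (r z) with he
  set Q : 𝒵 × EuclideanSpace ℝ (Fin d) → ℝ := fun p =>
    (p.2.ofLp - e p.1) ⬝ᵥ W (r p.1) *ᵥ (p.2.ofLp - e p.1) with hQ
  -- The factor multiplying Y - y in the upper bound for Q. Its first term comes from the cross term
  -- of the square, its second from the linear majorant of (Y - y)². As Φ depends only on r z and θ,
  -- the hypothesis `hYmean` applies to it.
  set Φ : 𝒳 × EuclideanSpace ℝ (Fin d) → ℝ := fun p =>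
    -(8 * ((W p.1 *ᵥ w p.1) ⬝ᵥ (p.2.ofLp - m p.1))) + 32 * a p.1 * (1 / 2 - y p.1) with hΦ
  set Q0 : 𝒳 × EuclideanSpace ℝ (Fin d) → ℝ := fun p =>
    (p.2.ofLp - m p.1) ⬝ᵥ W p.1 *ᵥ (p.2.ofLp - m p.1) with hQ0
  have mY : Measurable fun p : 𝒵 × EuclideanSpace ℝ (Fin d) => Y p.1 := hY.comp measurable_fst
  have mv : ∀ i, Measurable fun p : 𝒳 × EuclideanSpace ℝ (Fin d) => (p.2.ofLp - m p.1) i :=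
    fun i => (by fun_prop : Measurable fun p : 𝒳 × EuclideanSpace ℝ (Fin d) => p.2 i).sub
      ((mm i).comp measurable_fst)
  have mΦ : Measurable Φ :=
    ((measurable_dotProduct (fun i => (mWw i).comp measurable_fst) mv).const_mul 8).neg.add
      (((ma.comp measurable_fst).const_mul 32).mul
        (measurable_const.sub (my.comp measurable_fst)))
  have mQ0 : Measurable Q0 :=
    measurable_dotProduct mv (measurable_mulVec (fun i j => (mW i j).comp measurable_fst) mv)
  have bv : ∀ (x : 𝒳) (θ : EuclideanSpace ℝ (Fin d)), ‖θ‖ ≤ B → ∀ i,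
      |(θ.ofLp - m x) i| ≤ 2 * B := fun x θ hθ i => by
    have := (abs_sub (θ i) (m x i)).trans
      (add_le_add ((abs_apply_le_norm θ i).trans hθ) (bm x i))
    simp only [Pi.sub_apply]; linarith
  obtain ⟨cΦ, bΦ⟩ : ∃ C, ∀ x θ, ‖θ‖ ≤ B → |Φ (x, θ)| ≤ C := by
    refine ⟨8 * (d * (cWw * (2 * B))) + 32 * ca * (1 / 2 + cy), fun x θ hθ => ?_⟩
    refine (abs_add_le _ _).trans (add_le_add ?_ ?_)
    · rw [abs_neg, abs_mul, abs_of_pos (by norm_num : (0 : ℝ) < 8)]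
      refine mul_le_mul_of_nonneg_left ?_ (by norm_num)
      simpa using abs_dotProduct_le cWw0 (bWw x) (bv x θ hθ)
    · rw [abs_mul, abs_mul, abs_of_pos (by norm_num : (0 : ℝ) < 32)]
      refine mul_le_mul (mul_le_mul_of_nonneg_left (ba x) (by norm_num)) ?_ (abs_nonneg _)
        (by positivity)
      refine (abs_sub _ _).trans (add_le_add (by norm_num [abs_of_pos]) (bby x))
  obtain ⟨cQ, bQ⟩ : ∃ C, ∀ x θ, ‖θ‖ ≤ B → |Q0 (x, θ)| ≤ C :=
    ⟨_, fun x θ hθ => abs_dotProduct_le (by positivity) (bv x θ hθ)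
      (fun i => abs_dotProduct_le zero_le_one (bW x i) (bv x θ hθ))⟩
  have minner : Measurable fun p : 𝒳 × EuclideanSpace ℝ (Fin d) =>
      (u p.1).ofLp ⬝ᵥ (p.2.ofLp - m p.1) :=
    measurable_dotProduct (fun i => (mu i).comp measurable_fst) mv
  obtain ⟨iQ0, eQ0⟩ := transfer Q0 mQ0 cQ bQ
  obtain ⟨iyΦ, -⟩ := transfer (fun p => y p.1 * Φ p) ((my.comp measurable_fst).mul mΦ) (cy * cΦ)
    (fun x θ hθ => by
      rw [abs_mul]; exact mul_le_mul (bby x) (bΦ x θ hθ) (abs_nonneg _) cy0)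
  obtain ⟨iuΦ, euΦ⟩ := transfer (fun p => ((u p.1).ofLp ⬝ᵥ (p.2.ofLp - m p.1)) * Φ p)
    (minner.mul mΦ) (d * (1 * (2 * B)) * cΦ) (fun x θ hθ => by
      rw [abs_mul]
      refine mul_le_mul ?_ (bΦ x θ hθ) (abs_nonneg _) (by positivity)
      simpa using abs_dotProduct_le zero_le_one (bu x) (bv x θ hθ))
  obtain ⟨iaP, eaP⟩ := transfer (fun p => 4 * a p.1) ((ma.comp measurable_fst).const_mul 4)
    (4 * ca) (fun x θ hθ => by
      rw [abs_mul, abs_of_pos (by norm_num : (0 : ℝ) < 4)]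
      exact mul_le_mul_of_nonneg_left (ba x) (by norm_num))
  have mΦr : Measurable fun p : 𝒵 × EuclideanSpace ℝ (Fin d) => Φ (r p.1, p.2) :=
    mΦ.comp (by fun_prop)
  have iYΦ : Integrable (fun p : 𝒵 × EuclideanSpace ℝ (Fin d) => Y p.1 * Φ (r p.1, p.2)) P :=
    integrable_of_abs_le (mY.mul mΦr) (C := 1 * cΦ) (hPB.mono fun p hp => by
      rw [abs_mul]
      refine mul_le_mul ?_ (bΦ _ _ hp) (abs_nonneg _) zero_le_one
      rw [abs_of_nonneg (hY01 p.1).1]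
      exact (hY01 p.1).2)
  -- Replacing Y by ⟨θ, u⟩ turns Y - y into ⟨θ - m, u⟩. Its covariance with ⟨Ww, θ - m⟩ is ⟨Ww, Γu⟩
  -- = a, and the second term of Φ averages to zero.
  have eYΦ : ∫ p, (Y p.1 * Φ (r p.1, p.2) - y (r p.1) * Φ (r p.1, p.2)) ∂P =
      -8 * ∫ z, a (r z) ∂ζ := by
    rw [integral_sub iYΦ iyΦ, hYmean Φ mΦ ⟨cΦ, hPB.mono fun p hp => bΦ _ _ hp⟩]
    have e1 : ∀ p : 𝒵 × EuclideanSpace ℝ (Fin d), inner ℝ p.2 (u (r p.1)) * Φ (r p.1, p.2) =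
        ((u (r p.1)).ofLp ⬝ᵥ (p.2.ofLp - m (r p.1))) * Φ (r p.1, p.2) +
          y (r p.1) * Φ (r p.1, p.2) := fun p => by
      rw [← dotProduct_ofLp, dotProduct_sub, dotProduct_comm _ (m (r p.1)), dotProduct_comm p.2.ofLp]
      ring
    rw [integral_congr_ae (Filter.Eventually.of_forall e1), integral_add iuΦ iyΦ,
      add_sub_cancel_right, euΦ, ← integral_const_mul]
    refine integral_congr_ae (Filter.Eventually.of_forall fun z => ?_)
    have e2 : ∀ θ : EuclideanSpace ℝ (Fin d),
        ((u (r z)).ofLp ⬝ᵥ (θ.ofLp - m (r z))) * Φ (r z, θ) =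
        -8 * (((W (r z) *ᵥ w (r z)) ⬝ᵥ (θ.ofLp - m (r z))) *
          ((u (r z)).ofLp ⬝ᵥ (θ.ofLp - m (r z)))) +
        (32 * a (r z) * (1 / 2 - y (r z))) * ((u (r z)).ofLp ⬝ᵥ (θ.ofLp - m (r z))) :=
      fun θ => by simp only [hΦ]; ring
    have i1 : Integrable (fun θ : EuclideanSpace ℝ (Fin d) =>
        (u (r z)).ofLp ⬝ᵥ (θ.ofLp - m (r z))) (q (r z)) :=
      integrable_of_abs_le (C := d * (1 * (2 * B))) (minner.comp (measurable_prodMk_left (x := r z)))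
        ((hq (r z)).mono fun θ hθ => by
          simpa using abs_dotProduct_le zero_le_one (bu (r z)) (bv (r z) θ hθ))
    have i2 := integrable_dotProduct_sub_mul (hq (r z)) (W (r z) *ᵥ w (r z)) (u (r z)).ofLp
    calc _ = ∫ θ, (-8 * (((W (r z) *ᵥ w (r z)) ⬝ᵥ (θ.ofLp - m (r z))) *
          ((u (r z)).ofLp ⬝ᵥ (θ.ofLp - m (r z)))) +
        (32 * a (r z) * (1 / 2 - y (r z))) * ((u (r z)).ofLp ⬝ᵥ (θ.ofLp - m (r z)))) ∂(q (r z)) :=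
          integral_congr_ae (Filter.Eventually.of_forall e2)
      _ = -8 * a (r z) := by
        rw [integral_add (i2.const_mul _) (i1.const_mul _), integral_const_mul, integral_const_mul,
          integral_dotProduct_sub_mul (hq (r z)), integral_dotProduct_sub (hq (r z)), mul_zero,
          add_zero, dotProduct_comm]
  have pointwise (p : 𝒵 × EuclideanSpace ℝ (Fin d)) : Q p ≤ Q0 (r p.1, p.2) + 4 * a (r p.1) +
      (Y p.1 * Φ (r p.1, p.2) - y (r p.1) * Φ (r p.1, p.2)) := by
    have e1 : p.2.ofLp - e p.1 =
        (p.2.ofLp - m (r p.1)) - (4 * (Y p.1 - y (r p.1))) • w (r p.1) := by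
      simp only [he]; abel
    have e2 : Q p = Q0 (r p.1, p.2) -
        8 * (Y p.1 - y (r p.1)) * ((W (r p.1) *ᵥ w (r p.1)) ⬝ᵥ (p.2.ofLp - m (r p.1))) +
        16 * (Y p.1 - y (r p.1)) ^ 2 * a (r p.1) := by
      simp only [hQ, e1, hQ0, ha]
      generalize p.2.ofLp - m (r p.1) = v
      rw [mulVec_sub, mulVec_smul, dotProduct_sub, sub_dotProduct, sub_dotProduct, dotProduct_smul,
        dotProduct_smul, smul_dotProduct, smul_dotProduct,
        PosSemidef.dotProduct_mulVec_symm (pW (r p.1)) (w (r p.1)) v,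
        dotProduct_comm (W (r p.1) *ᵥ w (r p.1))]
      simp only [smul_eq_mul]
      ring
    have h01 := hY01 p.1
    -- From Y² ≤ Y; the slack is Y(1 - Y) + (1/2 - y)². The majorant is affine in Y, so the
    -- conditional mean of Y is enough to integrate it.
    have h1 : (Y p.1 - y (r p.1)) ^ 2 ≤
        1 / 4 + 2 * (Y p.1 - y (r p.1)) * (1 / 2 - y (r p.1)) := by
      nlinarith [mul_nonneg h01.1 (sub_nonneg.2 h01.2), sq_nonneg (1 / 2 - y (r p.1))]
    rw [e2]
    simp only [hΦ]
    nlinarith [mul_le_mul_of_nonneg_left h1 (a0 (r p.1))]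
  have iG := (iQ0.fun_add iaP).fun_add (integrable_fun_sub iYΦ iyΦ)
  have Q_nonneg (p : 𝒵 × EuclideanSpace ℝ (Fin d)) : 0 ≤ Q p :=
    PosSemidef.dotProduct_mulVec_self_nonneg (pW _) _
  have mQ : Measurable Q := by
    have mve : ∀ i, Measurable fun p : 𝒵 × EuclideanSpace ℝ (Fin d) => (p.2.ofLp - e p.1) i := by
      intro i
      refine (by fun_prop : Measurable fun p : 𝒵 × EuclideanSpace ℝ (Fin d) => p.2 i).sub ?_
      refine Measurable.comp (g := fun z => e z i) ?_ measurable_fst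
      exact ((mm i).comp hr).add (((hY.sub (my.comp hr)).const_mul 4).mul ((mw i).comp hr))
    exact measurable_dotProduct mve
      (measurable_mulVec (fun i j => ((mW i j).comp hr).comp measurable_fst) mve)
  -- Q is nonnegative and lies below an integrable function.
  have iQ : Integrable Q P := iG.mono' mQ.aestronglyMeasurable
    (Filter.Eventually.of_forall fun p => by
      rw [Real.norm_eq_abs, abs_of_nonneg (Q_nonneg p)]; exact pointwise p)
  have hup : ∫ p, Q p ∂P ≤ ∫ z, (W (r z) * Γ (r z)).trace ∂ζ - 4 * ∫ z, a (r z) ∂ζ := by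
    refine (integral_mono iQ iG pointwise).trans (le_of_eq ?_)
    rw [integral_add (iQ0.fun_add iaP) (integrable_fun_sub iYΦ iyΦ), integral_add iQ0 iaP, eQ0, eaP, eYΦ]
    have e1 : ∀ z, ∫ θ, Q0 (r z, θ) ∂(q (r z)) = (W (r z) * Γ (r z)).trace := fun z =>
      integral_quadratic (hq (r z)) (W (r z))
    simp only [e1, integral_const, probReal_univ, one_smul, integral_const_mul]
    ring
  -- Both W and e depend on z alone, and given z the law of θ is q' z. Its mean is the best estimate
  -- in the W-weighted square error.
  have hlow : ∫ z, (W (r z) * covMat (q' z)).trace ∂ζ ≤ ∫ p, Q p ∂P := by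
    rw [Measure.integral_compProd iQ]
    exact integral_mono itr' (Integrable.integral_compProd iQ) fun z =>
      trace_mul_covMat_le (hq' z) (pW (r z)) (e z)
  nlinarith [mul_le_mul_of_nonneg_left (hlow.trans hup) hc]

end Reduction

/-! ### Decoupling the sampled parameter from the feature it selects -/

section Decoupling

variable {d : ℕ} {𝒪 𝒳 𝒵 : Type*} [MeasurableSpace 𝒪] [MeasurableSpace 𝒳] [MeasurableSpace 𝒵]
  {q : Kernel 𝒪 (EuclideanSpace ℝ (Fin d))} [IsMarkovKernel q] {B : ℝ}

section

variable {ξ : Measure 𝒳} [IsProbabilityMeasure ξ] {o : 𝒳 → 𝒪}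
  {τ u : 𝒳 → EuclideanSpace ℝ (Fin d)}

theorem integral_of_map_eq_compProd (ho : Measurable o) (hτ : Measurable τ)
    (hτq : ξ.map (fun x => (o x, τ x)) = (ξ.map o) ⊗ₘ q)
    (hq : ∀ x, ∀ᵐ θ ∂q x, ‖θ‖ ≤ B) {Ψ : 𝒪 × EuclideanSpace ℝ (Fin d) → ℝ} (mΨ : Measurable Ψ)
    {C : ℝ} (bΨ : ∀ x θ, ‖θ‖ ≤ B → |Ψ (x, θ)| ≤ C) :
    Integrable (fun x => Ψ (o x, τ x)) ξ ∧
      ∫ x, Ψ (o x, τ x) ∂ξ = ∫ x, ∫ θ, Ψ (o x, θ) ∂(q (o x)) ∂ξ := by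
  have := Measure.isProbabilityMeasure_map (μ := ξ) ho.aemeasurable
  have hqB : ∀ᵐ p ∂((ξ.map o) ⊗ₘ q), ‖p.2‖ ≤ B :=
    Measure.ae_compProd_of_ae_ae (measurableSet_le (by fun_prop) measurable_const)
      (Filter.Eventually.of_forall hq)
  have hint : Integrable Ψ ((ξ.map o) ⊗ₘ q) :=
    integrable_of_abs_le mΨ (hqB.mono fun p hp => bΨ p.1 p.2 hp)
  have hm : Measurable fun x => (o x, τ x) := ho.prodMk hτ
  refine ⟨?_, ?_⟩
  · rw [← hτq] at hint
    exact hint.comp_measurable hm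
  · rw [← integral_map (φ := fun x => (o x, τ x)) hm.aemeasurable mΨ.aestronglyMeasurable, hτq,
      Measure.integral_compProd hint, integral_map ho.aemeasurable]
    exact (StronglyMeasurable.integral_kernel_prod_right' (κ := q)
      mΨ.stronglyMeasurable).aestronglyMeasurable

theorem measurable_sub_meanVec (i : Fin d) : Measurable
    fun p : 𝒪 × EuclideanSpace ℝ (Fin d) => (p.2.ofLp - meanVec (q p.1)) i :=
  (by fun_prop : Measurable fun p : 𝒪 × EuclideanSpace ℝ (Fin d) => p.2 i).sub
    ((measurable_meanVec q i).comp measurable_fst)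

theorem abs_sub_meanVec_le {q : Measure (EuclideanSpace ℝ (Fin d))} [IsProbabilityMeasure q]
    (hq : ∀ᵐ θ ∂q, ‖θ‖ ≤ B) {θ : EuclideanSpace ℝ (Fin d)} (hθ : ‖θ‖ ≤ B) (i : Fin d) :
    |(θ.ofLp - meanVec q) i| ≤ 2 * B := by
  have := (abs_sub (θ i) (meanVec q i)).trans
    (add_le_add ((abs_apply_le_norm θ i).trans hθ) (abs_meanVec_le hq i))
  simp only [Pi.sub_apply]
  linarith

theorem ae_norm_le_of_map_eq_compProd (ho : Measurable o) (hτ : Measurable τ)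
    (hτq : ξ.map (fun x => (o x, τ x)) = (ξ.map o) ⊗ₘ q)
    (hq : ∀ x, ∀ᵐ θ ∂q x, ‖θ‖ ≤ B) : ∀ᵐ x ∂ξ, ‖τ x‖ ≤ B := by
  have hqB : ∀ᵐ p ∂((ξ.map o) ⊗ₘ q), ‖p.2‖ ≤ B :=
    Measure.ae_compProd_of_ae_ae (measurableSet_le (by fun_prop) measurable_const)
      (Filter.Eventually.of_forall hq)
  rw [← hτq] at hqB
  exact ae_of_ae_map (ho.prodMk hτ).aemeasurable hqB

theorem integrable_dotProduct_sub_meanVec (hB : 0 ≤ B) (ho : Measurable o) (hτ : Measurable τ)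
    (hτq : ξ.map (fun x => (o x, τ x)) = (ξ.map o) ⊗ₘ q)
    (hq : ∀ x, ∀ᵐ θ ∂q x, ‖θ‖ ≤ B) (hu : Measurable u) (hu1 : ∀ x, ‖u x‖ ≤ 1) :
    Integrable (fun x => ((τ x).ofLp - meanVec (q (o x))) ⬝ᵥ (u x).ofLp) ξ := by
  refine integrable_of_abs_le (C := d * (2 * B * 1)) (measurable_dotProduct
    (fun i => (measurable_sub_meanVec i).comp (ho.prodMk hτ)) (fun i => by fun_prop)) ?_
  filter_upwards [ae_norm_le_of_map_eq_compProd ho hτ hτq hq] with x hx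
  simpa using abs_dotProduct_le (by positivity) (abs_sub_meanVec_le (hq (o x)) hx)
    (fun i => (abs_apply_le_norm (u x) i).trans (hu1 x))

/-- Young's inequality with the identity as weight. The mean square of τ - m is at most B² because
the mean is a better estimate than 0. This supplies the crude bound B for a single gap. -/
theorem two_mul_integral_dotProduct_le_norm (hB : 0 ≤ B) (ho : Measurable o) (hτ : Measurable τ)
    (hτq : ξ.map (fun x => (o x, τ x)) = (ξ.map o) ⊗ₘ q)
    (hq : ∀ x, ∀ᵐ θ ∂q x, ‖θ‖ ≤ B) (hu : Measurable u) (hu1 : ∀ x, ‖u x‖ ≤ 1) {t : ℝ}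
    (ht : 0 < t) :
    2 * ∫ x, ((τ x).ofLp - meanVec (q (o x))) ⬝ᵥ (u x).ofLp ∂ξ ≤ t * B ^ 2 + t⁻¹ := by
  have hi := integrable_dotProduct_sub_meanVec hB ho hτ hτq hq hu hu1
  obtain ⟨i2, e2⟩ := integral_of_map_eq_compProd ho hτ hτq hq
    (Ψ := fun p => (p.2.ofLp - meanVec (q p.1)) ⬝ᵥ (p.2.ofLp - meanVec (q p.1)))
    (measurable_dotProduct measurable_sub_meanVec measurable_sub_meanVec)
    (C := d * (2 * B * (2 * B))) (fun x θ hθ => by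
      simpa using abs_dotProduct_le (by positivity) (abs_sub_meanVec_le (hq x) hθ)
        (abs_sub_meanVec_le (hq x) hθ))
  have h1 (x : 𝒳) : 2 * (((τ x).ofLp - meanVec (q (o x))) ⬝ᵥ (u x).ofLp) ≤
      t * (((τ x).ofLp - meanVec (q (o x))) ⬝ᵥ ((τ x).ofLp - meanVec (q (o x)))) + t⁻¹ := by
    have h2 : (u x).ofLp ⬝ᵥ (u x).ofLp ≤ 1 := by
      rw [dotProduct_ofLp_self]; exact pow_le_one₀ (norm_nonneg _) (hu1 x)
    generalize (τ x).ofLp - meanVec (q (o x)) = v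
    have h3 := dotProduct_star_self_nonneg (v - t⁻¹ • (u x).ofLp)
    rw [star_trivial, sub_dotProduct, dotProduct_sub, dotProduct_sub, smul_dotProduct,
      smul_dotProduct, dotProduct_smul, dotProduct_smul, dotProduct_comm (u x).ofLp v] at h3
    simp only [smul_eq_mul] at h3
    have h4 := mul_nonneg ht.le h3
    have ht' : t * t⁻¹ = 1 := mul_inv_cancel₀ ht.ne'
    have h5 : t * (v ⬝ᵥ v - t⁻¹ * v ⬝ᵥ (u x).ofLp -
        (t⁻¹ * v ⬝ᵥ (u x).ofLp - t⁻¹ * (t⁻¹ * (u x).ofLp ⬝ᵥ (u x).ofLp))) =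
        t * (v ⬝ᵥ v) - 2 * (v ⬝ᵥ (u x).ofLp) + t⁻¹ * ((u x).ofLp ⬝ᵥ (u x).ofLp) := by
      linear_combination (-2 * (v ⬝ᵥ (u x).ofLp) + t⁻¹ * ((u x).ofLp ⬝ᵥ (u x).ofLp)) * ht'
    have h6 : t⁻¹ * ((u x).ofLp ⬝ᵥ (u x).ofLp) ≤ t⁻¹ :=
      mul_le_of_le_one_right (inv_nonneg.2 ht.le) h2
    linarith
  have h7 (x : 𝒳) : ∫ θ, (θ.ofLp - meanVec (q (o x))) ⬝ᵥ (θ.ofLp - meanVec (q (o x))) ∂(q (o x)) ≤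
      B ^ 2 := by
    have h8 := integral_quadratic (hq (o x)) 1
    simp only [one_mulVec, one_mul] at h8
    have h9 := trace_mul_covMat_le (hq (o x)) PosSemidef.one 0
    simp only [one_mulVec, one_mul, sub_zero, dotProduct_ofLp_self] at h9
    rw [h8]
    refine h9.trans ?_
    have := norm_integral_le_of_norm_le_const (μ := q (o x))
      (f := fun θ : EuclideanSpace ℝ (Fin d) => ‖θ‖ ^ 2) (C := B ^ 2) ((hq (o x)).mono fun θ hθ => by
        rw [norm_pow, norm_norm]; exact pow_le_pow_left₀ (norm_nonneg _) hθ 2)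
    rw [probReal_univ, mul_one] at this
    exact (le_abs_self _).trans this
  rw [← integral_const_mul]
  calc _ ≤ ∫ x, (t * (((τ x).ofLp - meanVec (q (o x))) ⬝ᵥ ((τ x).ofLp - meanVec (q (o x)))) +
        t⁻¹) ∂ξ := integral_mono (hi.const_mul 2) ((i2.const_mul t).add (integrable_const _)) h1
    _ = t * ∫ x, ∫ θ, (θ.ofLp - meanVec (q (o x))) ⬝ᵥ (θ.ofLp - meanVec (q (o x))) ∂(q (o x)) ∂ξ
        + t⁻¹ := by
      rw [integral_add (i2.const_mul t) (integrable_const _), integral_const_mul, e2]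
      simp
    _ ≤ _ := by
      have := norm_integral_le_of_norm_le_const (μ := ξ) (C := B ^ 2)
        (f := fun x => ∫ θ, (θ.ofLp - meanVec (q (o x))) ⬝ᵥ (θ.ofLp - meanVec (q (o x))) ∂(q (o x)))
        (Filter.Eventually.of_forall fun x => by
          rw [Real.norm_eq_abs, abs_of_nonneg]
          · exact h7 x
          · exact integral_nonneg fun θ => by
              simpa using dotProduct_star_self_nonneg (θ.ofLp - meanVec (q (o x))))
      rw [probReal_univ, mul_one] at this
      have := mul_le_mul_of_nonneg_left ((le_abs_self _).trans this) ht.le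
      linarith

/-- Apply `two_mul_dotProduct_le_resolvent` with t = sc. The first term averages to sc tr(WΓ) ≤ sd
whatever the dependence between τ and u. The second is at most s⁻¹(⟨u, Γu⟩ + 1/c), and trading ⟨u,
Γu⟩ for c⟨Γu, WΓu⟩ costs another 1/c. -/
theorem two_mul_integral_dotProduct_le_resolvent (hB : 0 ≤ B) (ho : Measurable o)
    (hτ : Measurable τ) (hτq : ξ.map (fun x => (o x, τ x)) = (ξ.map o) ⊗ₘ q)
    (hq : ∀ x, ∀ᵐ θ ∂q x, ‖θ‖ ≤ B) (hu : Measurable u) (hu1 : ∀ x, ‖u x‖ ≤ 1) {c s : ℝ}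
    (hc : 0 < c) (hs : 0 < s) :
    2 * ∫ x, ((τ x).ofLp - meanVec (q (o x))) ⬝ᵥ (u x).ofLp ∂ξ ≤ s * d +
      s⁻¹ * (c * ∫ x, (covMat (q (o x)) *ᵥ (u x).ofLp) ⬝ᵥ
        resolvent (covMat (q (o x))) c *ᵥ (covMat (q (o x)) *ᵥ (u x).ofLp) ∂ξ + 2 / c) := by
  have hi := integrable_dotProduct_sub_meanVec hB ho hτ hτq hq hu hu1
  have mΓ := measurable_covMat q hq
  have mW := measurable_resolvent mΓ c
  have mu : ∀ i, Measurable fun x => u x i := fun i => by fun_prop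
  have mw : ∀ i, Measurable fun x => (covMat (q (o x)) *ᵥ (u x).ofLp) i :=
    measurable_mulVec (fun i j => (mΓ i j).comp ho) mu
  have pΓ : ∀ x, (covMat (q x)).PosSemidef := fun x => covMat_posSemidef (hq x)
  have bW : ∀ x i j, |resolvent (covMat (q x)) c i j| ≤ 1 := fun x =>
    abs_resolvent_apply_le (pΓ x) hc.le
  obtain ⟨cw, cw0, bw⟩ : ∃ C, 0 ≤ C ∧ ∀ x i, |(covMat (q (o x)) *ᵥ (u x).ofLp) i| ≤ C :=
    ⟨_, by positivity, fun x i => abs_dotProduct_le (by positivity) (abs_covMat_le hB (hq (o x)) i)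
      (fun i => (abs_apply_le_norm (u x) i).trans (hu1 x))⟩
  have ia : Integrable (fun x => (covMat (q (o x)) *ᵥ (u x).ofLp) ⬝ᵥ
      resolvent (covMat (q (o x))) c *ᵥ (covMat (q (o x)) *ᵥ (u x).ofLp)) ξ :=
    integrable_of_abs_le (measurable_dotProduct mw
      (measurable_mulVec (fun i j => (mW i j).comp ho) mw))
      (Filter.Eventually.of_forall fun x => abs_dotProduct_le cw0 (bw x)
        (fun i => abs_dotProduct_le zero_le_one (bW (o x) i) (bw x)))
  obtain ⟨i2, e2⟩ := integral_of_map_eq_compProd ho hτ hτq hq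
    (Ψ := fun p => (p.2.ofLp - meanVec (q p.1)) ⬝ᵥ
      resolvent (covMat (q p.1)) c *ᵥ (p.2.ofLp - meanVec (q p.1)))
    (measurable_dotProduct measurable_sub_meanVec
      (measurable_mulVec (fun i j => (mW i j).comp measurable_fst) measurable_sub_meanVec))
    (C := Fintype.card (Fin d) * (2 * B * (Fintype.card (Fin d) * (1 * (2 * B)))))
    (fun x θ hθ => abs_dotProduct_le (by positivity) (abs_sub_meanVec_le (hq x) hθ)
        (fun i => abs_dotProduct_le zero_le_one (bW x i) (abs_sub_meanVec_le (hq x) hθ)))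
  have h1 (x : 𝒳) : 2 * (((τ x).ofLp - meanVec (q (o x))) ⬝ᵥ (u x).ofLp) ≤
      s * c * (((τ x).ofLp - meanVec (q (o x))) ⬝ᵥ
        resolvent (covMat (q (o x))) c *ᵥ ((τ x).ofLp - meanVec (q (o x)))) +
      s⁻¹ * (c * ((covMat (q (o x)) *ᵥ (u x).ofLp) ⬝ᵥ
        resolvent (covMat (q (o x))) c *ᵥ (covMat (q (o x)) *ᵥ (u x).ofLp)) + 2 / c) := by
    have h2 : (u x).ofLp ⬝ᵥ (u x).ofLp ≤ 1 := by
      rw [dotProduct_ofLp_self]; exact pow_le_one₀ (norm_nonneg _) (hu1 x)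
    refine (two_mul_dotProduct_le_resolvent (pΓ (o x)) hc (mul_pos hs hc) _ _).trans ?_
    refine add_le_add le_rfl ?_
    rw [mul_inv, mul_assoc]
    refine mul_le_mul_of_nonneg_left ?_ (inv_nonneg.2 hs.le)
    have h3 := dotProduct_mulVec_le_resolvent (pΓ (o x)) hc (u x).ofLp
    have h4 : (u x).ofLp ⬝ᵥ (u x).ofLp / c ≤ 1 / c := by gcongr
    rw [mul_add, ← mul_assoc c⁻¹ c, inv_mul_cancel₀ hc.ne', one_mul, mul_comm c⁻¹, ← div_eq_mul_inv]
    have h5 : (2 : ℝ) / c = 1 / c + 1 / c := by ring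
    linarith
  rw [← integral_const_mul]
  calc _ ≤ ∫ x, (s * c * (((τ x).ofLp - meanVec (q (o x))) ⬝ᵥ
        resolvent (covMat (q (o x))) c *ᵥ ((τ x).ofLp - meanVec (q (o x)))) +
      s⁻¹ * (c * ((covMat (q (o x)) *ᵥ (u x).ofLp) ⬝ᵥ
        resolvent (covMat (q (o x))) c *ᵥ (covMat (q (o x)) *ᵥ (u x).ofLp)) + 2 / c)) ∂ξ :=
        integral_mono (hi.const_mul 2) ((i2.const_mul _).add
          (((ia.const_mul c).add (integrable_const _)).const_mul _)) h1
    _ = s * c * ∫ x, (resolvent (covMat (q (o x))) c * covMat (q (o x))).trace ∂ξ + s⁻¹ *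
      (c * ∫ x, (covMat (q (o x)) *ᵥ (u x).ofLp) ⬝ᵥ
        resolvent (covMat (q (o x))) c *ᵥ (covMat (q (o x)) *ᵥ (u x).ofLp) ∂ξ + 2 / c) := by
      rw [integral_add (i2.const_mul _) (((ia.const_mul c).fun_add (integrable_const _)).const_mul _),
        integral_const_mul, integral_const_mul, integral_add (ia.const_mul c) (integrable_const _),
        integral_const_mul, e2]
      simp only [integral_quadratic (hq _), integral_const, probReal_univ, one_smul]
    _ ≤ _ := by
      have h6 := norm_integral_le_of_norm_le_const (μ := ξ) (C := d / c)
        (f := fun x => (resolvent (covMat (q (o x))) c * covMat (q (o x))).trace)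
        (Filter.Eventually.of_forall fun x => by
          rw [Real.norm_eq_abs, abs_of_nonneg]
          · simpa using trace_resolvent_mul_le (pΓ (o x)) hc
          · rw [← integral_quadratic (hq (o x))]
            exact integral_nonneg fun θ =>
              PosSemidef.dotProduct_mulVec_self_nonneg (resolvent_posSemidef (pΓ (o x)) hc.le) _)
      rw [probReal_univ, mul_one] at h6
      have h7 := mul_le_mul_of_nonneg_left ((le_abs_self _).trans h6) (mul_pos hs hc).le
      have h8 : s * c * (d / c) = s * d := by field_simp
      linarith

end

variable {q' : Kernel 𝒵 (EuclideanSpace ℝ (Fin d))} [IsMarkovKernel q']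
  {ζ : Measure 𝒵} [IsProbabilityMeasure ζ] {r : 𝒵 → 𝒳} {o : 𝒳 → 𝒪}
  {τ u : 𝒳 → EuclideanSpace ℝ (Fin d)}

/-- The feature is a function of r z, and given r z the true parameter has law q (o (r z)); it can
be replaced by the mean of that law. -/
theorem integral_inner_sub_eq (hB : 0 ≤ B) (hq : ∀ x, ∀ᵐ θ ∂q x, ‖θ‖ ≤ B)
    (hr : Measurable r) (ho : Measurable o)
    (hdis : (ζ ⊗ₘ q').map (Prod.map r id) = (ζ.map r) ⊗ₘ (q.comap o ho))
    (hτ : Measurable τ) (hτq : ζ.map (fun z => (o (r z), τ (r z))) = (ζ.map (o ∘ r)) ⊗ₘ q)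
    (hu : Measurable u) (hu1 : ∀ x, ‖u x‖ ≤ 1) :
    ∫ p, inner ℝ (τ (r p.1) - p.2) (u (r p.1)) ∂(ζ ⊗ₘ q') =
      ∫ x, ((τ x).ofLp - meanVec (q (o x))) ⬝ᵥ (u x).ofLp ∂(ζ.map r) := by
  have hpr := Measure.isProbabilityMeasure_map (μ := ζ) hr.aemeasurable
  have hτq' : (ζ.map r).map (fun x => (o x, τ x)) = ((ζ.map r).map o) ⊗ₘ q := by
    rw [Measure.map_map (ho.prodMk hτ) hr, Measure.map_map ho hr, ← hτq]; rfl
  have m1 : Measurable fun p : 𝒳 × EuclideanSpace ℝ (Fin d) => inner ℝ (τ p.1 - p.2) (u p.1) := by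
    fun_prop
  have hqB : ∀ᵐ p ∂((ζ.map r) ⊗ₘ (q.comap o ho)), ‖p.2‖ ≤ B :=
    Measure.ae_compProd_of_ae_ae (measurableSet_le (by fun_prop) measurable_const)
      (Filter.Eventually.of_forall fun x => hq (o x))
  have hτB : ∀ᵐ p ∂((ζ.map r) ⊗ₘ (q.comap o ho)), ‖τ p.1‖ ≤ B :=
    Measure.ae_compProd_of_ae_ae (measurableSet_le (by fun_prop) measurable_const)
      ((ae_norm_le_of_map_eq_compProd ho hτ hτq' hq).mono fun x hx =>
        Filter.Eventually.of_forall fun _ => hx)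
  have hint : Integrable (fun p : 𝒳 × EuclideanSpace ℝ (Fin d) => inner ℝ (τ p.1 - p.2) (u p.1))
      ((ζ.map r) ⊗ₘ (q.comap o ho)) := by
    refine integrable_of_abs_le (C := (2 * B) * 1) m1 ?_
    filter_upwards [hqB, hτB] with p h1 h2
    refine (abs_real_inner_le_norm _ _).trans (mul_le_mul ?_ (hu1 _) (norm_nonneg _) (by positivity))
    have := norm_sub_le (τ p.1) p.2
    linarith
  have h1 : ∫ p, inner ℝ (τ p.1 - p.2) (u p.1) ∂((ζ ⊗ₘ q').map (Prod.map r id)) =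
      ∫ p, inner ℝ (τ (r p.1) - p.2) (u (r p.1)) ∂(ζ ⊗ₘ q') :=
    integral_map (by fun_prop) m1.aestronglyMeasurable
  rw [← h1, hdis, Measure.integral_compProd hint]
  refine integral_congr_ae (Filter.Eventually.of_forall fun x => ?_)
  have e1 (θ : EuclideanSpace ℝ (Fin d)) : inner ℝ (τ x - θ) (u x) =
      ((τ x).ofLp - meanVec (q (o x))) ⬝ᵥ (u x).ofLp -
        (u x).ofLp ⬝ᵥ (θ.ofLp - meanVec (q (o x))) := by
    rw [← dotProduct_ofLp, dotProduct_comm (u x).ofLp, WithLp.ofLp_sub, sub_dotProduct,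
      sub_dotProduct, sub_dotProduct]
    ring
  have i1 : Integrable (fun θ : EuclideanSpace ℝ (Fin d) =>
      (u x).ofLp ⬝ᵥ (θ.ofLp - meanVec (q (o x)))) (q (o x)) :=
    integrable_of_abs_le (C := d * (1 * (2 * B))) (measurable_dotProduct (fun i => measurable_const)
      (fun i => (measurable_sub_meanVec i).comp (measurable_prodMk_left (x := o x))))
      ((hq (o x)).mono fun θ hθ => by
        simpa using abs_dotProduct_le zero_le_one
          (fun i => (abs_apply_le_norm (u x) i).trans (hu1 x)) (abs_sub_meanVec_le (hq (o x)) hθ))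
  simp only [e1, Kernel.comap_apply]
  rw [integral_sub (integrable_const _) i1, integral_dotProduct_sub (hq (o x))]
  simp

/-- The decoupling bound: `θ` has conditional law `q` given `X = r z`, which only depends on
`o X`; the sample `τ X` has conditional law `q` given `o X`; and `Y ∈ [0, 1]` has conditional mean
`⟨θ, u X⟩`. -/
theorem two_mul_integral_inner_le (hB : 0 ≤ B) (hq : ∀ x, ∀ᵐ θ ∂q x, ‖θ‖ ≤ B)
    (hq' : ∀ z, ∀ᵐ θ ∂q' z, ‖θ‖ ≤ B) (hr : Measurable r) (ho : Measurable o)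
    (hdis : (ζ ⊗ₘ q').map (Prod.map r id) = (ζ.map r) ⊗ₘ (q.comap o ho))
    (hτ : Measurable τ) (hτq : ζ.map (fun z => (o (r z), τ (r z))) = (ζ.map (o ∘ r)) ⊗ₘ q)
    (hu : Measurable u) (hu1 : ∀ x, ‖u x‖ ≤ 1)
    {Y : 𝒵 → ℝ} (hY : Measurable Y) (hY01 : ∀ z, Y z ∈ Set.Icc (0 : ℝ) 1)
    (hYmean : ∀ Φ : 𝒳 × EuclideanSpace ℝ (Fin d) → ℝ, Measurable Φ →
      (∃ C, ∀ᵐ p ∂(ζ ⊗ₘ q'), |Φ (r p.1, p.2)| ≤ C) →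
      ∫ p, Y p.1 * Φ (r p.1, p.2) ∂(ζ ⊗ₘ q') =
        ∫ p, inner ℝ p.2 (u (r p.1)) * Φ (r p.1, p.2) ∂(ζ ⊗ₘ q'))
    {c s : ℝ} (hc : 0 < c) (hs : 0 < s) :
    2 * ∫ p, inner ℝ (τ (r p.1) - p.2) (u (r p.1)) ∂(ζ ⊗ₘ q') ≤ s * d +
      s⁻¹ * ((∫ z, Real.log (1 + c • covMat (q (o (r z)))).det ∂ζ -
        ∫ z, Real.log (1 + c • covMat (q' z)).det ∂ζ) / 4 + 2 / c) := by
  have hpr := Measure.isProbabilityMeasure_map (μ := ζ) hr.aemeasurable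
  have hτq' : (ζ.map r).map (fun x => (o x, τ x)) = ((ζ.map r).map o) ⊗ₘ q := by
    rw [Measure.map_map (ho.prodMk hτ) hr, Measure.map_map ho hr, ← hτq]; rfl
  rw [integral_inner_sub_eq hB hq hr ho hdis hτ hτq hu hu1]
  refine (two_mul_integral_dotProduct_le_resolvent hB ho hτ hτq' hq hu hu1 hc hs).trans ?_
  have h := expected_log_det_reduction (q := q.comap o ho) hB (fun x => hq (o x)) hq' hr hdis hu hu1
    hY hY01 hYmean hc.le
  simp only [Kernel.comap_apply] at h
  have mΓ := measurable_covMat q hq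
  have mW := measurable_resolvent mΓ c
  have mu : ∀ i, Measurable fun x => u x i := fun i => by fun_prop
  have mw : ∀ i, Measurable fun x => (covMat (q (o x)) *ᵥ (u x).ofLp) i :=
    measurable_mulVec (fun i j => (mΓ i j).comp ho) mu
  have ma : Measurable fun x => (covMat (q (o x)) *ᵥ (u x).ofLp) ⬝ᵥ
      resolvent (covMat (q (o x))) c *ᵥ (covMat (q (o x)) *ᵥ (u x).ofLp) :=
    measurable_dotProduct mw (measurable_mulVec (fun i j => (mW i j).comp ho) mw)
  rw [integral_map hr.aemeasurable ma.aestronglyMeasurable]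
  have : 0 < s⁻¹ := inv_pos.2 hs
  gcongr
  linarith

end Decoupling

/-- Optimization of a bound `a t + b / t` over `t > 0`. -/
theorem le_sqrt_mul_of_forall_pos {x a b : ℝ} (ha : 0 ≤ a) (hb : 0 ≤ b)
    (h : ∀ t : ℝ, 0 < t → 2 * x ≤ t * a + t⁻¹ * b) : x ≤ √(a * b) := by
  -- The minimizer t = √(b/a) needs a and b positive. The perturbation by ε covers the cases where
  -- one of them vanishes.
  have key (ε : ℝ) (hε : 0 < ε) : x ≤ √((a + ε) * (b + ε)) := by
    have ha' : 0 < a + ε := by positivity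
    have hb' : 0 < b + ε := by positivity
    have h1 := h (√(b + ε) / √(a + ε)) (by positivity)
    have h2 : √(b + ε) / √(a + ε) * a ≤ √(b + ε) / √(a + ε) * (a + ε) := by gcongr; linarith
    have h3 : (√(b + ε) / √(a + ε))⁻¹ * b ≤ (√(b + ε) / √(a + ε))⁻¹ * (b + ε) := by
      gcongr; linarith
    have h4 : √(b + ε) / √(a + ε) * (a + ε) = √((a + ε) * (b + ε)) := by
      rw [Real.sqrt_mul ha'.le, div_mul_eq_mul_div, div_eq_iff (by positivity)]
      linear_combination √(b + ε) * (- Real.mul_self_sqrt ha'.le)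
    have h5 : (√(b + ε) / √(a + ε))⁻¹ * (b + ε) = √((a + ε) * (b + ε)) := by
      rw [Real.sqrt_mul ha'.le, inv_div, div_mul_eq_mul_div, div_eq_iff (by positivity)]
      linear_combination √(a + ε) * (- Real.mul_self_sqrt hb'.le)
    linarith
  have hlim : Filter.Tendsto (fun ε : ℝ => √((a + ε) * (b + ε))) (nhdsWithin 0 (Set.Ioi 0))
      (nhds (√(a * b))) := by
    have : Continuous fun ε : ℝ => √((a + ε) * (b + ε)) := by fun_prop
    have h := this.tendsto 0
    simp only [add_zero] at h
    exact h.mono_left nhdsWithin_le_nhds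
  exact ge_of_tendsto hlim (Filter.eventually_of_mem self_mem_nhdsWithin fun ε hε => key ε hε)

end PSRL

namespace PSRL

/-! ### Bayes' formula with a factorizing likelihood -/

section Bayes

variable {J Ω T E : Type*} [MeasurableSpace J] [MeasurableSpace Ω] [MeasurableSpace T]
  [MeasurableSpace E] [Zero E]

theorem measurableSet_evidence (ν : Measure E) [SFinite ν] {f : J → E → ENNReal}
    (hf : Measurable (Function.uncurry f)) :
    MeasurableSet {z | ∫⁻ θ, f z θ ∂ν ≠ 0 ∧ ∫⁻ θ, f z θ ∂ν ≠ ⊤} := by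
  have h : Measurable fun z => ∫⁻ θ, f z θ ∂ν := hf.lintegral_prod_right'
  exact (h (measurableSet_singleton 0).compl).inter (h (measurableSet_singleton ⊤).compl)

open Classical in
/-- The posterior distribution for the prior `ν` and the likelihood `f`, given by Bayes' formula. -/
noncomputable def bayesKernel (ν : Measure E) [SFinite ν] (f : J → E → ENNReal)
    (hf : Measurable (Function.uncurry f)) : Kernel J E :=
  Kernel.piecewise (measurableSet_evidence ν hf)
    (Kernel.withDensity (Kernel.const J ν) fun z θ => f z θ * (∫⁻ θ, f z θ ∂ν)⁻¹)
    -- The default is a point mass at 0 so that the kernel is Markov and stays, at every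
    -- observation, in each centred ball that carries the prior.
    (Kernel.const J (Measure.dirac 0))

variable {ν : Measure E} {f : J → E → ENNReal} {hf : Measurable (Function.uncurry f)}

theorem bayesKernel_apply_of_mem [SFinite ν] {z : J}
    (hz : ∫⁻ θ, f z θ ∂ν ≠ 0 ∧ ∫⁻ θ, f z θ ∂ν ≠ ⊤) :
    bayesKernel ν f hf z = ν.withDensity fun θ => f z θ * (∫⁻ θ, f z θ ∂ν)⁻¹ := by
  unfold bayesKernel
  rw [Kernel.piecewise_apply, if_pos (by exact hz), Kernel.withDensity_apply]
  · rfl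
  · have h : Measurable fun z => ∫⁻ θ, f z θ ∂ν := hf.lintegral_prod_right'
    exact hf.mul (h.comp measurable_fst).inv

theorem bayesKernel_apply_of_notMem [SFinite ν] {z : J}
    (hz : ¬ (∫⁻ θ, f z θ ∂ν ≠ 0 ∧ ∫⁻ θ, f z θ ∂ν ≠ ⊤)) :
    bayesKernel ν f hf z = Measure.dirac 0 := by
  unfold bayesKernel
  rw [Kernel.piecewise_apply, if_neg (by exact hz), Kernel.const_apply]

instance [SFinite ν] : IsMarkovKernel (bayesKernel ν f hf) := by
  refine ⟨fun z => ?_⟩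
  by_cases hz : ∫⁻ θ, f z θ ∂ν ≠ 0 ∧ ∫⁻ θ, f z θ ∂ν ≠ ⊤
  · rw [bayesKernel_apply_of_mem hz]
    refine ⟨?_⟩
    rw [withDensity_apply _ MeasurableSet.univ, Measure.restrict_univ,
      lintegral_mul_const _ hf.of_uncurry_left, ENNReal.mul_inv_cancel hz.1 hz.2]
  · rw [bayesKernel_apply_of_notMem hz]
    infer_instance

theorem ae_bayesKernel [SFinite ν] {p : E → Prop} (hp : ∀ᵐ θ ∂ν, p θ) (hp0 : p 0)
    (hpm : MeasurableSet {θ | p θ}) (z : J) : ∀ᵐ θ ∂(bayesKernel ν f hf z), p θ := by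
  by_cases hz : ∫⁻ θ, f z θ ∂ν ≠ 0 ∧ ∫⁻ θ, f z θ ∂ν ≠ ⊤
  · rw [bayesKernel_apply_of_mem hz]
    exact (withDensity_absolutelyContinuous ν _).ae_le hp
  · rw [bayesKernel_apply_of_notMem hz]
    exact (ae_dirac_iff hpm).2 hp0

/-- Multiplied through by the evidence, Bayes' formula also holds where the evidence is zero: there
the likelihood vanishes almost everywhere and both sides are 0. -/
theorem lintegral_bayesKernel_mul [SFinite ν] {z : J} {g : E → ENNReal} (hg : Measurable g)
    (hz : ∫⁻ θ, f z θ ∂ν ≠ ⊤) :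
    (∫⁻ θ, g θ ∂(bayesKernel ν f hf z)) * ∫⁻ θ, f z θ ∂ν = ∫⁻ θ, g θ * f z θ ∂ν := by
  have hfz : Measurable (f z) := hf.of_uncurry_left
  by_cases h0 : ∫⁻ θ, f z θ ∂ν = 0
  · rw [h0, mul_zero]
    rw [lintegral_eq_zero_iff hfz] at h0
    symm
    refine (lintegral_eq_zero_iff (hg.mul hfz)).2 ?_
    filter_upwards [h0] with θ hθ
    simp only [Pi.zero_apply] at hθ
    simp [hθ]
  · rw [bayesKernel_apply_of_mem ⟨h0, hz⟩, lintegral_withDensity_eq_lintegral_mul _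
      (hfz.mul_const _) hg]
    simp only [Pi.mul_apply]
    rw [← lintegral_mul_const _ (by fun_prop)]
    refine lintegral_congr fun θ => ?_
    rw [mul_comm (f z θ * _) (g θ), mul_assoc, mul_assoc, ENNReal.inv_mul_cancel h0 hz, mul_one]

variable {μ : Measure Ω} [IsProbabilityMeasure μ] {κ : Kernel Ω J} [IsMarkovKernel κ]
  {Λ : Measure J} [SFinite Λ] {τ : Ω → E} {ψ : Ω → T} {g : J → T → ENNReal}

/-- Bayes' formula for one of two independent components of the parameter, when the likelihood
factorizes. -/
theorem map_compProd_eq_compProd_bayesKernel (hτ : Measurable τ) (hψ : Measurable ψ)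
    (hind : IndepFun τ ψ μ) (hf : Measurable (Function.uncurry f))
    (hg : Measurable (Function.uncurry g))
    (hκ : ∀ᵐ ω ∂μ, κ ω = Λ.withDensity fun z => f z (τ ω) * g z (ψ ω)) :
    (μ ⊗ₘ κ).map (fun p => (p.2, τ p.1)) = (κ ∘ₘ μ) ⊗ₘ (bayesKernel (μ.map τ) f hf) := by
  have hfτ : Measurable fun p : Ω × J => f p.2 (τ p.1) :=
    hf.comp (measurable_snd.prodMk (hτ.comp measurable_fst))
  have hgψ : Measurable fun p : Ω × J => g p.2 (ψ p.1) :=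
    hg.comp (measurable_snd.prodMk (hψ.comp measurable_fst))
  have swap (h : Ω → J → ENNReal) (hh : Measurable (Function.uncurry h)) :
      ∫⁻ ω, ∫⁻ z, h ω z ∂(κ ω) ∂μ = ∫⁻ z, ∫⁻ ω, h ω z * f z (τ ω) * g z (ψ ω) ∂μ ∂Λ := by
    rw [← lintegral_lintegral_swap ((hh.mul hfτ).mul hgψ).aemeasurable]
    refine lintegral_congr_ae (hκ.mono fun ω hω => ?_)
    simp only [hω]
    have hm : Measurable fun z => f z (τ ω) * g z (ψ ω) :=
      (hfτ.comp (measurable_prodMk_left (x := ω))).mul (hgψ.comp (measurable_prodMk_left (x := ω)))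
    rw [lintegral_withDensity_eq_lintegral_mul _ hm hh.of_uncurry_left]
    refine lintegral_congr fun z => ?_
    simp only [Pi.mul_apply]
    ring
  have indep (z : J) (h : E → ENNReal) (hh : Measurable h) :
      ∫⁻ ω, h (τ ω) * f z (τ ω) * g z (ψ ω) ∂μ =
        (∫⁻ θ, h θ * f z θ ∂(μ.map τ)) * ∫⁻ ω, g z (ψ ω) ∂μ := by
    have hm : Measurable fun θ => h θ * f z θ := hh.mul hf.of_uncurry_left
    rw [lintegral_map hm hτ]
    exact lintegral_mul_eq_lintegral_mul_lintegral_of_indepFun'' (hm.comp hτ).aemeasurable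
      ((hg.of_uncurry_left (x := z)).comp hψ).aemeasurable (hind.comp hm (hg.of_uncurry_left (x := z)))
  -- By independence this product is the density with respect to Λ of the marginal law of the
  -- observation. That law has mass one, so the density is finite almost everywhere.
  have hfin : ∀ᵐ z ∂Λ, (∫⁻ θ, f z θ ∂(μ.map τ)) * ∫⁻ ω, g z (ψ ω) ∂μ < ⊤ := by
    have h1 := swap (fun _ _ => 1) measurable_const
    have h2 (z : J) := indep z (fun _ => 1) measurable_const
    simp only [h2] at h1
    simp only [one_mul] at h1
    have hm1 : Measurable fun z => ∫⁻ θ, f z θ ∂(μ.map τ) := hf.lintegral_prod_right'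
    have hm2 : Measurable fun z => ∫⁻ ω, g z (ψ ω) ∂μ :=
      (hg.comp (measurable_fst.prodMk (hψ.comp measurable_snd))).lintegral_prod_right'
    refine ae_lt_top (hm1.mul hm2) ?_
    rw [← h1]
    simp
  refine Measure.ext_of_lintegral _ fun φ hφ => ?_
  have hGm : Measurable fun z => ∫⁻ θ, φ (z, θ) ∂(bayesKernel (μ.map τ) f hf z) :=
    hφ.lintegral_kernel_prod_right'
  have hφm : Measurable fun p : Ω × J => φ (p.2, τ p.1) := hφ.comp (by fun_prop)
  rw [lintegral_map hφ (by fun_prop), Measure.lintegral_compProd hφm,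
    Measure.lintegral_compProd hφ, Measure.lintegral_bind κ.aemeasurable hGm.aemeasurable,
    swap (fun ω z => φ (z, τ ω)) hφm, 
    swap (fun _ z => ∫⁻ θ, φ (z, θ) ∂(bayesKernel (μ.map τ) f hf z)) (hGm.comp measurable_snd)]
  refine lintegral_congr_ae (hfin.mono fun z hz => ?_)
  simp only
  rw [indep z (fun θ => φ (z, θ)) (hφ.comp measurable_prodMk_left),
    indep z (fun _ => ∫⁻ θ, φ (z, θ) ∂(bayesKernel (μ.map τ) f hf z)) measurable_const,
    lintegral_const_mul _ hf.of_uncurry_left]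
  -- If the other factor vanishes there is nothing to prove. Otherwise the finiteness of the product
  -- forces the evidence of τ to be finite.
  by_cases hR : ∫⁻ ω, g z (ψ ω) ∂μ = 0
  · simp [hR]
  · have hZ : ∫⁻ θ, f z θ ∂(μ.map τ) ≠ ⊤ := fun h => by
      rw [h, ENNReal.top_mul hR] at hz
      exact lt_irrefl _ hz
    rw [lintegral_bayesKernel_mul (g := fun θ => φ (z, θ)) (hφ.comp measurable_prodMk_left) hZ]

end Bayes

end PSRL

noncomputable section

namespace PSRL

/-! ### Factorization over stages of the likelihood of an episode -/

namespace LinearMixture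

variable {S A : Type*} [MeasurableSpace S] [MeasurableSpace A] {H d : ℕ}

/-- The state `s_j` of the observations `(s_0, a_0, …, s_k)`, where `j ≤ k`. -/
def stateAt {k : ℕ} (ob : Obs S A k) (j : ℕ) : S :=
  if hj : j < k then (ob.1 ⟨j, hj⟩).1 else ob.2

theorem measurable_stateAt (k j : ℕ) : Measurable fun ob : Obs S A k => stateAt ob j := by
  unfold stateAt
  by_cases hj : j < k
  · simp only [hj, dite_true]; fun_prop
  · simp only [hj, dite_false]; fun_prop

theorem extend_fst_of_lt {k j : ℕ} (q : Obs S A k × (A × S)) (hj : j < k) :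
    (extend k q).1 ⟨j, hj.trans (Nat.lt_succ_self k)⟩ = q.1.1 ⟨j, hj⟩ := by
  have : (⟨j, hj.trans (Nat.lt_succ_self k)⟩ : Fin (k + 1)) = (⟨j, hj⟩ : Fin k).castSucc := rfl
  rw [this]
  simp only [extend, Fin.snoc_castSucc]

theorem extend_fst_last {k : ℕ} (q : Obs S A k × (A × S)) :
    (extend k q).1 ⟨k, Nat.lt_succ_self k⟩ = (q.1.2, q.2.1) := by
  have : (⟨k, Nat.lt_succ_self k⟩ : Fin (k + 1)) = Fin.last k := rfl
  rw [this]
  simp only [extend, Fin.snoc_last]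

theorem stateAt_extend {k j : ℕ} (q : Obs S A k × (A × S)) (hj : j ≤ k) :
    stateAt (extend k q) j = stateAt q.1 j := by
  unfold stateAt
  rcases hj.lt_or_eq with h | rfl
  · rw [dif_pos (h.trans (Nat.lt_succ_self k)), dif_pos h, extend_fst_of_lt]
  · rw [dif_pos (Nat.lt_succ_self j), dif_neg (lt_irrefl j), extend_fst_last]

theorem stateAt_extend_last {k : ℕ} (q : Obs S A k × (A × S)) :
    stateAt (extend k q) (k + 1) = q.2.2 := by
  unfold stateAt
  rw [dif_neg (lt_irrefl _)]; rfl

variable (M : LinearMixture S A H d)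

/-- The contribution of stage `j` to the likelihood of the observations of one episode. -/
@[irreducible] def stageLik (k : ℕ) (ob : Obs S A k) (j : Fin H) (θ : EuclideanSpace ℝ (Fin d)) : ENNReal :=
  if hj : (j : ℕ) < k then
    ENNReal.ofReal (inner ℝ θ (M.φ (j, ob.1 ⟨j, hj⟩) (stateAt ob (j + 1))))
  else 1

theorem measurable_stageLik (k : ℕ) (j : Fin H) :
    Measurable fun p : Obs S A k × EuclideanSpace ℝ (Fin d) => M.stageLik k p.1 j p.2 := by
  unfold stageLik
  by_cases hj : (j : ℕ) < k
  · simp only [hj, dite_true]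
    refine Measurable.ennreal_ofReal (measurable_snd.inner ?_)
    exact M.measurable_φ.comp (g := Function.uncurry M.φ)
      (f := fun p : Obs S A k × EuclideanSpace ℝ (Fin d) =>
        ((j, p.1.1 ⟨j, hj⟩), stateAt p.1 (j + 1)))
      ((by fun_prop : Measurable fun p : Obs S A k × EuclideanSpace ℝ (Fin d) =>
        ((j, p.1.1 ⟨j, hj⟩) : SA S A H)).prodMk
        ((measurable_stateAt k (j + 1)).comp measurable_fst))
  · simp only [hj, dite_false]; fun_prop

theorem stageLik_of_le {k : ℕ} (ob : Obs S A k) {j : Fin H} (hj : k ≤ j)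
    (θ : EuclideanSpace ℝ (Fin d)) : M.stageLik k ob j θ = 1 := by
  unfold stageLik
  rw [dif_neg (not_lt.2 hj)]

/-- The factor of stage j involves (s_j, a_j, s_{j+1}), so appending (a_k, s_{k+1}) only completes
the factor of stage k. -/
theorem stageLik_extend {k : ℕ} (hk : k < H) (q : Obs S A k × (A × S)) (j : Fin H)
    (Θ : Param H d) : M.stageLik (k + 1) (extend k q) j (Θ j) = M.stageLik k q.1 j (Θ j) *
      if j = ⟨k, hk⟩ then ENNReal.ofReal (M.density Θ (⟨k, hk⟩, q.1.2, q.2.1) q.2.2) else 1 := by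
  unfold stageLik
  rcases lt_trichotomy (j : ℕ) k with h | h | h
  · have hne : j ≠ ⟨k, hk⟩ := fun e => by simp [e] at h
    rw [dif_pos (h.trans (Nat.lt_succ_self k)), dif_pos h, if_neg hne, mul_one, extend_fst_of_lt,
      stateAt_extend _ h]
  · subst h
    rw [dif_pos (Nat.lt_succ_self _), dif_neg (lt_irrefl _), if_pos rfl, one_mul, extend_fst_last,
      stateAt_extend_last]
    rfl
  · have hne : j ≠ ⟨k, hk⟩ := fun e => by simp [e] at h
    rw [dif_neg (by omega), dif_neg (by omega), if_neg hne, one_mul]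

theorem prod_stageLik_extend {k : ℕ} (hk : k < H) (q : Obs S A k × (A × S)) (Θ : Param H d) :
    ∏ j, M.stageLik (k + 1) (extend k q) j (Θ j) = (∏ j, M.stageLik k q.1 j (Θ j)) *
      ENNReal.ofReal (M.density Θ (⟨k, hk⟩, q.1.2, q.2.1) q.2.2) := by
  simp only [M.stageLik_extend hk, Finset.prod_mul_distrib]
  simp

section Rollout

variable {W : Type*} [MeasurableSpace W] (π : PolicyFamily W S A H)

theorem measurable_act_state (k : ℕ) (hk : k < H) :
    Measurable fun p : W × Obs S A k => π.act p.1 ⟨k, hk⟩ p.2.2 :=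
  (π.measurable_act ⟨k, hk⟩).comp (g := fun p : W × S => π.act p.1 ⟨k, hk⟩ p.2)
    (f := fun p : W × Obs S A k => (p.1, p.2.2)) (by fun_prop)

/-- One step, with the next state drawn from the reference measure. -/
def baseStep (k : ℕ) (hk : k < H) : Kernel (W × Obs S A k) (A × S) :=
  (Kernel.deterministic (fun p : W × Obs S A k => π.act p.1 ⟨k, hk⟩ p.2.2)
      (measurable_act_state π k hk)) ⊗ₖ
    (M.ν.comap (fun q : (W × Obs S A k) × A => ((⟨k, hk⟩, q.1.2.2, q.2) : SA S A H))
      (by fun_prop))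

instance (k : ℕ) (hk : k < H) : IsSFiniteKernel (M.baseStep π k hk) := by
  unfold baseStep; infer_instance

/-- The measure on the observations up to stage `k` with next states drawn from the reference
measures. -/
def baseRollout : (k : ℕ) → k ≤ H → Kernel W (Obs S A k)
  | 0, _ => Kernel.const _ (M.ρ.map fun s => (Fin.elim0, s))
  | k + 1, hk =>
      ((baseRollout k (Nat.le_of_succ_le hk)) ⊗ₖ (M.baseStep π k hk)).map (extend k)

instance isSFiniteKernel_baseRollout (k : ℕ) (hk : k ≤ H) :
    IsSFiniteKernel (M.baseRollout π k hk) := by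
  cases k with
  | zero =>
    have : IsProbabilityMeasure (M.ρ.map fun s => ((Fin.elim0, s) : Obs S A 0)) :=
      Measure.isProbabilityMeasure_map (by fun_prop)
    unfold baseRollout; infer_instance
  | succ k => rw [baseRollout]; infer_instance

theorem lintegral_step (k : ℕ) (hk : k < H) (p : (Param H d × W) × Obs S A k)
    {g : A × S → ENNReal} (hg : Measurable g) :
    ∫⁻ y, g y ∂(M.step π k hk p) = ∫⁻ s', g (π.act p.1.2 ⟨k, hk⟩ p.2.2, s')
      ∂(M.trans (p.1.1, (⟨k, hk⟩, p.2.2, π.act p.1.2 ⟨k, hk⟩ p.2.2))) := by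
  unfold step
  rw [Kernel.lintegral_compProd _ _ _ hg, Kernel.lintegral_deterministic']
  · rfl
  · exact hg.lintegral_kernel_prod_right'' (a := p)

theorem lintegral_baseStep (k : ℕ) (hk : k < H) (p : W × Obs S A k)
    {g : A × S → ENNReal} (hg : Measurable g) :
    ∫⁻ y, g y ∂(M.baseStep π k hk p) = ∫⁻ s', g (π.act p.1 ⟨k, hk⟩ p.2.2, s')
      ∂(M.ν (⟨k, hk⟩, p.2.2, π.act p.1 ⟨k, hk⟩ p.2.2)) := by
  unfold baseStep
  rw [Kernel.lintegral_compProd _ _ _ hg, Kernel.lintegral_deterministic']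
  · rfl
  · exact hg.lintegral_kernel_prod_right'' (a := p)

theorem lintegral_rollout_succ (k : ℕ) (hk : k + 1 ≤ H) (p : Param H d × W)
    {g : Obs S A (k + 1) → ENNReal} (hg : Measurable g) :
    ∫⁻ ob, g ob ∂(M.rollout π (k + 1) hk p) = ∫⁻ ob, ∫⁻ y, g (extend k (ob, y))
      ∂(M.step π k hk (p, ob)) ∂(M.rollout π k (Nat.le_of_succ_le hk) p) := by
  have hge : Measurable fun q => g (extend (S := S) (A := A) k q) := hg.comp (measurable_extend k)
  rw [rollout, Kernel.lintegral_map _ (measurable_extend k) _ hg,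
    Kernel.lintegral_compProd _ _ _ hge]

theorem lintegral_baseRollout_succ (k : ℕ) (hk : k + 1 ≤ H) (w : W)
    {g : Obs S A (k + 1) → ENNReal} (hg : Measurable g) :
    ∫⁻ ob, g ob ∂(M.baseRollout π (k + 1) hk w) = ∫⁻ ob, ∫⁻ y, g (extend k (ob, y))
      ∂(M.baseStep π k hk (w, ob)) ∂(M.baseRollout π k (Nat.le_of_succ_le hk) w) := by
  have hge : Measurable fun q => g (extend (S := S) (A := A) k q) := hg.comp (measurable_extend k)
  have e : M.baseRollout π (k + 1) hk = ((M.baseRollout π k (Nat.le_of_succ_le hk)) ⊗ₖ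
    (M.baseStep π k hk)).map (extend k) := rfl
  rw [e, Kernel.lintegral_map _ (measurable_extend k) _ hg, Kernel.lintegral_compProd _ _ _ hge]

theorem measurable_prod_stageLik (k : ℕ) (Θ : Param H d) :
    Measurable fun ob : Obs S A k => ∏ j, M.stageLik k ob j (Θ j) :=
  Finset.measurable_fun_prod _ fun j _ =>
    (M.measurable_stageLik k j).comp (measurable_id.prodMk (measurable_const (a := Θ j)))

/-- The law of the observations has a density which is a product over the stages. -/
theorem rollout_eq_withDensity {Θ : Param H d} (hΘ : M.Proper Θ) (w : W) (k : ℕ) (hk : k ≤ H) :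
    M.rollout π k hk (Θ, w) =
      (M.baseRollout π k hk w).withDensity fun ob => ∏ j, M.stageLik k ob j (Θ j) := by
  induction k with
  | zero =>
    have : (fun ob : Obs S A 0 => ∏ j, M.stageLik 0 ob j (Θ j)) = 1 := by
      funext ob
      exact Finset.prod_eq_one fun j _ => M.stageLik_of_le ob (Nat.zero_le _) _
    rw [this, withDensity_one]
    rfl
  | succ k ih =>
    refine Measure.ext_of_lintegral _ fun g hg => ?_
    have hge : Measurable fun q => g (extend (S := S) (A := A) k q) := hg.comp (measurable_extend k)
    have hge' (ob : Obs S A k) : Measurable fun y => g (extend k (ob, y)) :=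
      hge.comp measurable_prodMk_left
    have hL := M.measurable_prod_stageLik (k + 1) Θ
    have hLe (ob : Obs S A k) : Measurable fun y =>
        (∏ j, M.stageLik (k + 1) (extend k (ob, y)) j (Θ j)) * g (extend k (ob, y)) :=
      ((hL.mul hg).comp (measurable_extend k)).comp measurable_prodMk_left
    have hst : Measurable fun ob => ∫⁻ y, g (extend k (ob, y)) ∂(M.step π k hk ((Θ, w), ob)) :=
      Measurable.lintegral_kernel_prod_right' (κ := (M.step π k hk).comap (fun ob => ((Θ, w), ob))
        measurable_prodMk_left) hge
    rw [lintegral_withDensity_eq_lintegral_mul _ hL hg, M.lintegral_rollout_succ π k hk _ hg,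
      M.lintegral_baseRollout_succ π k hk _ (hL.mul hg), ih (Nat.le_of_succ_le hk),
      lintegral_withDensity_eq_lintegral_mul _ (M.measurable_prod_stageLik k Θ) hst]
    refine lintegral_congr fun ob => ?_
    simp only [Pi.mul_apply]
    rw [M.lintegral_step π k hk _ (hge' ob), M.lintegral_baseStep π k hk _ (hLe ob),
      M.trans_apply_of_proper hΘ]
    have hd : Measurable fun s' => ENNReal.ofReal
        (M.density Θ (⟨k, hk⟩, ob.2, π.act w ⟨k, hk⟩ ob.2) s') :=
      (M.measurable_density.of_uncurry_left (x := (Θ, (⟨k, hk⟩, ob.2,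
        π.act w ⟨k, hk⟩ ob.2)))).ennreal_ofReal
    have hgs : Measurable fun s' => g (extend k (ob, (π.act w ⟨k, hk⟩ ob.2, s'))) :=
      (hge' ob).comp (measurable_const.prodMk measurable_id)
    rw [lintegral_withDensity_eq_lintegral_mul _ hd hgs, ← lintegral_const_mul _ (hd.mul hgs)]
    refine lintegral_congr fun s' => ?_
    simp only [Pi.mul_apply]
    rw [M.prod_stageLik_extend hk, mul_assoc]

end Rollout

end LinearMixture

/-- Serves to discard those parts of the observation on which the likelihood of a given stage does
not depend. -/
theorem bayesKernel_comap {J J' E : Type*} [MeasurableSpace J] [MeasurableSpace J']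
    [MeasurableSpace E] [Zero E] (ν : Measure E) [SFinite ν] {f : J → E → ENNReal}
    (hf : Measurable (Function.uncurry f)) {g : J' → J} (hg : Measurable g) {f' : J' → E → ENNReal}
    (hf' : Measurable (Function.uncurry f')) (hff' : ∀ z, f' z = f (g z)) :
    bayesKernel ν f' hf' = (bayesKernel ν f hf).comap g hg := by
  ext1 z
  rw [Kernel.comap_apply]
  by_cases hz : ∫⁻ θ, f (g z) θ ∂ν ≠ 0 ∧ ∫⁻ θ, f (g z) θ ∂ν ≠ ⊤
  · rw [bayesKernel_apply_of_mem hz, bayesKernel_apply_of_mem (by rwa [hff']), hff']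
  · rw [bayesKernel_apply_of_notMem hz, bayesKernel_apply_of_notMem (by rwa [hff'])]

/-! ### Truncated episodes and the joint law of history, sample and observations -/

namespace LinearMixture

variable {S A : Type*} [MeasurableSpace S] [MeasurableSpace A] {H d : ℕ}

/-- The observations up to stage `k` of a longer episode. -/
def trunc (k : ℕ) {k' : ℕ} (h : k ≤ k') (ob : Obs S A k') : Obs S A k :=
  (fun j => ob.1 (Fin.castLE h j), stateAt ob k)

theorem measurable_trunc {k k' : ℕ} (h : k ≤ k') :
    Measurable (trunc (S := S) (A := A) k h) :=
  (by fun_prop : Measurable fun ob : Obs S A k' => fun j => ob.1 (Fin.castLE h j)).prodMk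
    (measurable_stateAt k' k)

theorem trunc_self {k : ℕ} (ob : Obs S A k) : trunc k le_rfl ob = ob := by
  unfold trunc stateAt
  rw [dif_neg (lt_irrefl k)]
  rfl

theorem trunc_extend {k k' : ℕ} (h : k ≤ k') (q : Obs S A k' × (A × S)) :
    trunc k (h.trans (Nat.le_succ k')) (extend k' q) = trunc k h q.1 := by
  unfold trunc
  rw [stateAt_extend _ h]
  refine Prod.ext (funext fun j => ?_) rfl
  exact extend_fst_of_lt q (j.2.trans_le h)

theorem trunc_trunc_succ {k k' : ℕ} (h : k + 1 ≤ k') (ob : Obs S A k') :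
    trunc k (Nat.le_succ k) (trunc (k + 1) h ob) = trunc k (Nat.le_of_succ_le h) ob := by
  unfold trunc
  refine Prod.ext (funext fun j => rfl) ?_
  unfold stateAt
  simp only
  rw [dif_pos (Nat.lt_succ_self k), dif_pos (Nat.lt_of_succ_le h)]
  rfl

theorem stateAt_trunc {k k' : ℕ} (h : k ≤ k') (ob : Obs S A k') :
    (trunc k h ob).2 = stateAt ob k := rfl

variable (M : LinearMixture S A H d)

section

variable {W : Type*} [MeasurableSpace W] (π : PolicyFamily W S A H)

theorem rollout_map_trunc {k k' : ℕ} (h : k ≤ k') (hk' : k' ≤ H) (p : Param H d × W) :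
    (M.rollout π k' hk' p).map (trunc k h) = M.rollout π k (h.trans hk') p := by
  induction k', h using Nat.le_induction with
  | base =>
    have : (trunc k le_rfl : Obs S A k → Obs S A k) = id := funext trunc_self
    rw [this, Measure.map_id]
  | succ k' h ih =>
    refine Measure.ext_of_lintegral _ fun g hg => ?_
    rw [← ih (Nat.le_of_succ_le hk'), lintegral_map hg (measurable_trunc _),
      lintegral_map hg (measurable_trunc _),
      M.lintegral_rollout_succ π k' hk' p (Measurable.fun_comp hg (measurable_trunc _))]
    refine lintegral_congr fun ob => ?_
    simp only [trunc_extend h]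
    simp

end

/-- The contribution of stage `j` to the likelihood of a history of `n` episodes. -/
@[irreducible] def histLik (n : ℕ) (o : Hist S A H n) (j : Fin H)
    (θ : EuclideanSpace ℝ (Fin d)) : ENNReal :=
  ∏ l, M.stageLik H (o l) j θ

theorem measurable_histLik (n : ℕ) (j : Fin H) :
    Measurable (Function.uncurry fun (o : Hist S A H n) θ => M.histLik n o j θ) := by
  unfold histLik Function.uncurry
  refine Finset.measurable_fun_prod _ fun l _ => ?_
  exact (M.measurable_stageLik H j).comp
    (f := fun p : Hist S A H n × EuclideanSpace ℝ (Fin d) => (p.1 l, p.2)) (by fun_prop)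

theorem histLik_snoc (n : ℕ) (o : Hist S A H n) (ob : Obs S A H) (j : Fin H)
    (θ : EuclideanSpace ℝ (Fin d)) :
    M.histLik (n + 1) (Fin.snoc o ob : Hist S A H (n + 1)) j θ =
      M.histLik n o j θ * M.stageLik H ob j θ := by
  unfold histLik
  rw [Fin.prod_univ_castSucc]
  simp only [Fin.snoc_castSucc, Fin.snoc_last]

theorem measurable_histLik_mul_stageLik (n k : ℕ) (j : Fin H) :
    Measurable (Function.uncurry fun (z : (Hist S A H n × Param H d) × Obs S A k) θ =>
      M.histLik n z.1.1 j θ * M.stageLik k z.2 j θ) :=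
  ((M.measurable_histLik n j).comp (f := fun p : ((Hist S A H n × Param H d) × Obs S A k) ×
    EuclideanSpace ℝ (Fin d) => (p.1.1.1, p.2)) (by fun_prop)).mul
    ((M.measurable_stageLik k j).comp (f := fun p : ((Hist S A H n × Param H d) × Obs S A k) ×
    EuclideanSpace ℝ (Fin d) => (p.1.2, p.2)) (by fun_prop))

variable (prior : Measure (Param H d)) [IsProbabilityMeasure prior]
  (π : PolicyFamily (Param H d) S A H)

instance (n : ℕ) : IsMarkovKernel (M.sampler prior π n) := by
  unfold sampler; infer_instance

/-- The law, given the true parameters, of the history of `n` episodes, the sampled parameters of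
the next episode, and the observations of the next episode up to stage `k`. -/
def episode (n k : ℕ) (hk : k ≤ H) :
    Kernel (Param H d) ((Hist S A H n × Param H d) × Obs S A k) :=
  (M.hist prior π n ⊗ₖ (M.sampler prior π n).prodMkLeft (Param H d)) ⊗ₖ
    ((M.rollout π k hk).comap
      (fun p : Param H d × (Hist S A H n × Param H d) => (p.1, p.2.2)) (by fun_prop))

instance (n k : ℕ) (hk : k ≤ H) : IsMarkovKernel (M.episode prior π n k hk) := by
  unfold episode; infer_instance

/-- Append an episode to a history. -/
def append {n : ℕ} (z : (Hist S A H n × Param H d) × Obs S A H) : Hist S A H (n + 1) :=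
  Fin.snoc z.1.1 z.2

theorem measurable_append (n : ℕ) : Measurable (append (S := S) (A := A) (H := H) (d := d)
    (n := n)) :=
  (measurable_snoc n).comp
    (g := fun p : Hist S A H n × Obs S A H => (Fin.snoc p.1 p.2 : Hist S A H (n + 1)))
    (f := fun q : (Hist S A H n × Param H d) × Obs S A H => (q.1.1, q.2)) (by fun_prop)

theorem hist_succ_eq (n : ℕ) :
    M.hist prior π (n + 1) = (M.episode prior π n H le_rfl).map append := rfl

theorem lintegral_episode (n k : ℕ) (hk : k ≤ H) (Θ : Param H d)
    {g : (Hist S A H n × Param H d) × Obs S A k → ENNReal} (hg : Measurable g) :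
    ∫⁻ z, g z ∂(M.episode prior π n k hk Θ) = ∫⁻ o, ∫⁻ Θ', ∫⁻ ob, g ((o, Θ'), ob)
      ∂(M.rollout π k hk (Θ, Θ')) ∂(M.sampler prior π n o) ∂(M.hist prior π n Θ) := by
  unfold episode
  have hm : Measurable fun x : Hist S A H n × Param H d =>
      ∫⁻ ob, g (x, ob) ∂(M.rollout π k hk (Θ, x.2)) :=
    Measurable.lintegral_kernel_prod_right' (κ := (M.rollout π k hk).comap
      (fun x : Hist S A H n × Param H d => (Θ, x.2)) (by fun_prop)) hg
  rw [Kernel.lintegral_compProd _ _ _ hg]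
  simp only [Kernel.comap_apply]
  rw [Kernel.lintegral_compProd _ _ _ hm]
  simp only [Kernel.prodMkLeft_apply]

/-- The base measure for the density of the law of `n` episodes. -/
def baseHist : (n : ℕ) → Measure (Hist S A H n)
  | 0 => Measure.dirac Fin.elim0
  -- The sampler and the policies belong to the base measure, which is free of the true parameters.
  -- The adaptivity of the agent therefore drops out of Bayes' formula.
  | n + 1 => ((baseHist n ⊗ₘ M.sampler prior π n) ⊗ₘ
      (M.baseRollout π H le_rfl).comap Prod.snd measurable_snd).map append

instance sFinite_baseHist (n : ℕ) : SFinite (M.baseHist prior π n) := by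
  cases n with
  | zero => unfold baseHist; infer_instance
  | succ n => unfold baseHist; infer_instance

/-- The base measure for the density of `episode`. -/
def baseEpisode (n k : ℕ) (hk : k ≤ H) : Measure ((Hist S A H n × Param H d) × Obs S A k) :=
  (M.baseHist prior π n ⊗ₘ M.sampler prior π n) ⊗ₘ
      (M.baseRollout π k hk).comap Prod.snd measurable_snd

instance (n k : ℕ) (hk : k ≤ H) : SFinite (M.baseEpisode prior π n k hk) := by
  unfold baseEpisode; infer_instance

theorem baseHist_succ (n : ℕ) : M.baseHist prior π (n + 1) =
    (M.baseEpisode prior π n H le_rfl).map append := rfl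

theorem lintegral_baseEpisode (n k : ℕ) (hk : k ≤ H)
    {g : (Hist S A H n × Param H d) × Obs S A k → ENNReal} (hg : Measurable g) :
    ∫⁻ z, g z ∂(M.baseEpisode prior π n k hk) = ∫⁻ o, ∫⁻ Θ', ∫⁻ ob, g ((o, Θ'), ob)
      ∂(M.baseRollout π k hk Θ') ∂(M.sampler prior π n o) ∂(M.baseHist prior π n) := by
  unfold baseEpisode
  have hm : Measurable fun x : Hist S A H n × Param H d =>
      ∫⁻ ob, g (x, ob) ∂(M.baseRollout π k hk x.2) :=
    Measurable.lintegral_kernel_prod_right' (κ := (M.baseRollout π k hk).comap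
      (fun x : Hist S A H n × Param H d => x.2) (by fun_prop)) hg
  rw [Measure.lintegral_compProd hg]
  simp only [Kernel.comap_apply]
  rw [Measure.lintegral_compProd hm]

theorem measurable_prod_histLik (n : ℕ) (Θ : Param H d) :
    Measurable fun o : Hist S A H n => ∏ j, M.histLik n o j (Θ j) :=
  Finset.measurable_fun_prod _ fun j _ => (M.measurable_histLik n j).comp
    (f := fun o : Hist S A H n => (o, Θ j)) (by fun_prop)

theorem episode_eq_withDensity_of_hist {Θ : Param H d} (hΘ : M.Proper Θ) {n : ℕ}
    (hn : M.hist prior π n Θ =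
      (M.baseHist prior π n).withDensity fun o => ∏ j, M.histLik n o j (Θ j))
    (k : ℕ) (hk : k ≤ H) :
    M.episode prior π n k hk Θ = (M.baseEpisode prior π n k hk).withDensity fun z =>
      ∏ j, (M.histLik n z.1.1 j (Θ j) * M.stageLik k z.2 j (Θ j)) := by
  have mh := M.measurable_prod_histLik n Θ
  have ms := M.measurable_prod_stageLik k Θ
  have mz : Measurable fun z : (Hist S A H n × Param H d) × Obs S A k =>
      (∏ j, M.histLik n z.1.1 j (Θ j)) * ∏ j, M.stageLik k z.2 j (Θ j) :=
    (mh.comp (f := fun z : (Hist S A H n × Param H d) × Obs S A k => z.1.1) (by fun_prop)).mul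
      (ms.comp measurable_snd)
  simp only [Finset.prod_mul_distrib]
  refine Measure.ext_of_lintegral _ fun g hg => ?_
  have hg2 (o : Hist S A H n) (Θ' : Param H d) : Measurable fun ob => g ((o, Θ'), ob) :=
    hg.comp measurable_prodMk_left
  have m1 : Measurable fun x : Hist S A H n × Param H d =>
      ∫⁻ ob, g (x, ob) ∂(M.rollout π k hk (Θ, x.2)) :=
    Measurable.lintegral_kernel_prod_right' (κ := (M.rollout π k hk).comap
      (fun x : Hist S A H n × Param H d => (Θ, x.2)) (by fun_prop)) hg
  have m2 : Measurable fun o => ∫⁻ Θ', ∫⁻ ob, g ((o, Θ'), ob)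
      ∂(M.rollout π k hk (Θ, Θ')) ∂(M.sampler prior π n o) :=
    m1.lintegral_kernel_prod_right' (κ := M.sampler prior π n)
  rw [lintegral_withDensity_eq_lintegral_mul _ mz hg, M.lintegral_episode prior π n k hk Θ hg,
    M.lintegral_baseEpisode prior π n k hk (mz.mul hg), hn,
    lintegral_withDensity_eq_lintegral_mul _ mh m2]
  refine lintegral_congr fun o => ?_
  simp only [Pi.mul_apply]
  rw [← lintegral_const_mul _ (Measurable.fun_comp m1 (measurable_prodMk_left (x := o)))]
  refine lintegral_congr fun Θ' => ?_
  rw [M.rollout_eq_withDensity π hΘ, lintegral_withDensity_eq_lintegral_mul _ ms (hg2 o Θ'),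
    ← lintegral_const_mul _ (ms.mul (hg2 o Θ'))]
  refine lintegral_congr fun ob => ?_
  simp only [Pi.mul_apply]
  rw [mul_assoc]

/-- The law of the history has a density which is a product over the stages. -/
theorem hist_eq_withDensity {Θ : Param H d} (hΘ : M.Proper Θ) (n : ℕ) :
    M.hist prior π n Θ =
      (M.baseHist prior π n).withDensity fun o => ∏ j, M.histLik n o j (Θ j) := by
  induction n with
  | zero =>
    have : (fun o : Hist S A H 0 => ∏ j, M.histLik 0 o j (Θ j)) = 1 := by
      funext o
      exact Finset.prod_eq_one fun j _ => by unfold histLik; simp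
    rw [this, withDensity_one]
    rfl
  | succ n ih =>
    refine Measure.ext_of_lintegral _ fun g hg => ?_
    have mh := M.measurable_prod_histLik (n + 1) Θ
    have ma := measurable_append (S := S) (A := A) (H := H) (d := d) n
    have e : (fun z : (Hist S A H n × Param H d) × Obs S A H =>
        ∏ j, (M.histLik n z.1.1 j (Θ j) * M.stageLik H z.2 j (Θ j))) =
        fun z => ∏ j, M.histLik (n + 1) (append z) j (Θ j) :=
      funext fun z => Finset.prod_congr rfl fun j _ => (M.histLik_snoc n z.1.1 z.2 j (Θ j)).symm
    rw [lintegral_withDensity_eq_lintegral_mul _ mh hg, hist_succ_eq, baseHist_succ,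
      Kernel.lintegral_map _ ma _ hg, lintegral_map (mh.mul hg) ma,
      M.episode_eq_withDensity_of_hist prior π hΘ ih, e,
      lintegral_withDensity_eq_lintegral_mul _ (Measurable.fun_comp mh ma) (Measurable.fun_comp hg ma)]
    rfl

theorem episode_eq_withDensity {Θ : Param H d} (hΘ : M.Proper Θ) (n k : ℕ) (hk : k ≤ H) :
    M.episode prior π n k hk Θ = (M.baseEpisode prior π n k hk).withDensity fun z =>
      ∏ j, (M.histLik n z.1.1 j (Θ j) * M.stageLik k z.2 j (Θ j)) :=
  M.episode_eq_withDensity_of_hist prior π hΘ (M.hist_eq_withDensity prior π hΘ n) k hk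

theorem episode_map_trunc (n : ℕ) {k : ℕ} (hk : k ≤ H) (Θ : Param H d) :
    (M.episode prior π n H le_rfl Θ).map (Prod.map id (trunc k hk)) =
      M.episode prior π n k hk Θ := by
  refine Measure.ext_of_lintegral _ fun g hg => ?_
  have mt : Measurable (Prod.map id (trunc k hk) :
    (Hist S A H n × Param H d) × Obs S A H → (Hist S A H n × Param H d) × Obs S A k) :=
    measurable_id.prodMap (measurable_trunc hk)
  rw [lintegral_map hg mt, M.lintegral_episode prior π n H le_rfl Θ (Measurable.fun_comp hg mt),
    M.lintegral_episode prior π n k hk Θ hg]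
  refine lintegral_congr fun o => lintegral_congr fun Θ' => ?_
  rw [← M.rollout_map_trunc π hk le_rfl,
    lintegral_map (Measurable.fun_comp hg (measurable_prodMk_left (x := (o, Θ'))))
      (measurable_trunc hk)]
  rfl

theorem episode_map_fst (n k : ℕ) (hk : k ≤ H) :
    (M.episode prior π n k hk).map Prod.fst =
      M.hist prior π n ⊗ₖ (M.sampler prior π n).prodMkLeft (Param H d) := by
  rw [← Kernel.fst_eq]
  unfold episode
  rw [Kernel.fst_compProd]

/-- The posterior law of the parameters of stage `j` given a history of `n` episodes. -/
def stagePosterior (n : ℕ) (j : Fin H) : Kernel (Hist S A H n) (EuclideanSpace ℝ (Fin d)) :=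
  bayesKernel (prior.map fun Θ => Θ j) (fun o θ => M.histLik n o j θ) (M.measurable_histLik n j)

instance (n : ℕ) (j : Fin H) : IsMarkovKernel (M.stagePosterior prior n j) := by
  unfold stagePosterior; infer_instance

theorem ae_stagePosterior_norm_le {B : ℝ} (hB : 0 ≤ B) {j : Fin H}
    (hprior : ∀ᵐ Θ ∂prior, ‖Θ j‖ ≤ B) (n : ℕ) (o : Hist S A H n) :
    ∀ᵐ θ ∂(M.stagePosterior prior n j o), ‖θ‖ ≤ B := by
  have hm : MeasurableSet {θ : EuclideanSpace ℝ (Fin d) | ‖θ‖ ≤ B} :=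
    measurableSet_le measurable_norm measurable_const
  exact ae_bayesKernel ((ae_map_iff (measurable_pi_apply j).aemeasurable hm).2 hprior)
    (by simpa using hB) hm o

theorem indepFun_others (hind : iIndepFun (fun (h : Fin H) (Θ : Param H d) => Θ h) prior)
    (j : Fin H) : IndepFun (fun Θ : Param H d => Θ j)
      (fun (Θ : Param H d) (i : (Finset.univ.erase j : Finset (Fin H))) => Θ i) prior := by
  have h := hind.indepFun_finset {j} (Finset.univ.erase j)
    (by simp) (fun i => measurable_pi_apply i)
  exact h.comp (φ := fun v : (({j} : Finset (Fin H)) → EuclideanSpace ℝ (Fin d)) =>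
    v ⟨j, Finset.mem_singleton_self j⟩) (measurable_pi_apply _) measurable_id

/-- Bayes' formula for one stage, for observations whose likelihood factorizes. -/
theorem map_compProd_stage {J : Type*} [MeasurableSpace J]
    (hind : iIndepFun (fun (h : Fin H) (Θ : Param H d) => Θ h) prior) {κ : Kernel (Param H d) J}
    [IsMarkovKernel κ] {Λ : Measure J} [SFinite Λ]
    {D : J → Fin H → EuclideanSpace ℝ (Fin d) → ENNReal}
    (hD : ∀ j, Measurable (Function.uncurry fun z θ => D z j θ))
    (hκ : ∀ᵐ Θ ∂prior, κ Θ = Λ.withDensity fun z => ∏ j, D z j (Θ j)) (j : Fin H) :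
    (prior ⊗ₘ κ).map (fun p => (p.2, p.1 j)) =
      (κ ∘ₘ prior) ⊗ₘ (bayesKernel (prior.map fun Θ => Θ j) (fun z θ => D z j θ) (hD j)) := by
  refine map_compProd_eq_compProd_bayesKernel (τ := fun Θ : Param H d => Θ j)
    (f := fun z θ => D z j θ)
    (ψ := fun (Θ : Param H d) (i : (Finset.univ.erase j : Finset (Fin H))) => Θ i)
    (g := fun z v => ∏ i : (Finset.univ.erase j : Finset (Fin H)), D z i (v i))
    (Λ := Λ) (measurable_pi_apply j) (by fun_prop) (indepFun_others prior hind j) (hD j) ?_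
    (hκ.mono fun Θ hΘ => ?_)
  · unfold Function.uncurry
    refine Finset.measurable_fun_prod _ fun i _ => ?_
    exact (hD i).comp (f := fun p : J × ((i : (Finset.univ.erase j : Finset (Fin H))) →
      EuclideanSpace ℝ (Fin d)) => (p.1, p.2 i)) (by fun_prop)
  · rw [hΘ]
    congr 1
    funext z
    rw [← Finset.mul_prod_erase Finset.univ _ (Finset.mem_univ j)]
    congr 1
    exact (Finset.prod_coe_sort (Finset.univ.erase j) fun i => D z i (Θ i)).symm

/-! ### Disintegration of the joint laws by the stagewise posteriors -/

variable (hproper : ∀ᵐ Θ ∂prior, M.Proper Θ)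
  (hind : iIndepFun (fun (h : Fin H) (Θ : Param H d) => Θ h) prior)

include hproper hind

theorem map_compProd_hist (n : ℕ) (j : Fin H) :
    (prior ⊗ₘ M.hist prior π n).map (fun p => (p.2, p.1 j)) =
      (M.hist prior π n ∘ₘ prior) ⊗ₘ (M.stagePosterior prior n j) :=
  map_compProd_stage prior hind (M.measurable_histLik n)
    (hproper.mono fun _ hΘ => M.hist_eq_withDensity prior π hΘ n) j

/-- Up to s_j no transition out of stage j has been seen in the current episode, so the stage-j
factor of its likelihood is 1. The sample and the partial episode thus leave the posterior of θ_j as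
the past episodes made it. -/
theorem map_compProd_episode_stage (n : ℕ) (j : Fin H) :
    (prior ⊗ₘ M.episode prior π n j j.2.le).map (fun p => (p.2, p.1 j)) =
      (M.episode prior π n j j.2.le ∘ₘ prior) ⊗ₘ
        ((M.stagePosterior prior n j).comap (fun x => x.1.1) (by fun_prop)) := by
  have h := map_compProd_stage prior hind (κ := M.episode prior π n j j.2.le)
    (Λ := M.baseEpisode prior π n j j.2.le)
    (D := fun z i θ => M.histLik n z.1.1 i θ * M.stageLik (j : ℕ) z.2 i θ)
    (M.measurable_histLik_mul_stageLik n j)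
    (by filter_upwards [hproper] with Θ hΘ using M.episode_eq_withDensity prior π hΘ n j j.2.le) j
  rw [h]
  congr 1
  unfold stagePosterior
  refine bayesKernel_comap (f := fun o θ => M.histLik n o j θ)
    (g := fun x : (Hist S A H n × Param H d) × Obs S A j => x.1.1)
    (f' := fun z θ => M.histLik n z.1.1 j θ * M.stageLik (j : ℕ) z.2 j θ)
    _ (M.measurable_histLik n j) (by fun_prop)
    (M.measurable_histLik_mul_stageLik n j j) fun z => ?_
  funext θ
  rw [M.stageLik_of_le _ le_rfl, mul_one]

/-- A complete episode multiplies the stage-j likelihood by one factor, which makes it the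
likelihood of the appended history. -/
theorem map_compProd_episode (n : ℕ) (j : Fin H) :
    (prior ⊗ₘ M.episode prior π n H le_rfl).map (fun p => (p.2, p.1 j)) =
      (M.episode prior π n H le_rfl ∘ₘ prior) ⊗ₘ
        ((M.stagePosterior prior (n + 1) j).comap append (measurable_append n)) := by
  have h := map_compProd_stage prior hind (κ := M.episode prior π n H le_rfl)
    (Λ := M.baseEpisode prior π n H le_rfl)
    (D := fun z i θ => M.histLik n z.1.1 i θ * M.stageLik H z.2 i θ)
    (M.measurable_histLik_mul_stageLik n H)
    (by filter_upwards [hproper] with Θ hΘ using M.episode_eq_withDensity prior π hΘ n H le_rfl) j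
  rw [h]
  congr 1
  unfold stagePosterior
  refine bayesKernel_comap (f := fun o θ => M.histLik (n + 1) o j θ) (g := append)
    (f' := fun (z : (Hist S A H n × Param H d) × Obs S A H) θ =>
      M.histLik n z.1.1 j θ * M.stageLik H z.2 j θ)
    _ (M.measurable_histLik (n + 1) j) (measurable_append n)
    (M.measurable_histLik_mul_stageLik n H j) fun z => ?_
  funext θ
  exact (M.histLik_snoc n z.1.1 z.2 j θ).symm

end LinearMixture

namespace LinearMixture

variable {S A : Type*} [MeasurableSpace S] [MeasurableSpace A] {H d : ℕ}
  (M : LinearMixture S A H d)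

/-! ### Value functions and the simulation lemma -/

section Simulation

variable {W : Type*} [MeasurableSpace W] (π : PolicyFamily W S A H)

theorem step_eq_map (k : ℕ) (hk : k < H) (p : (Param H d × W) × Obs S A k) :
    M.step π k hk p =
      (M.trans (p.1.1, (⟨k, hk⟩, p.2.2, π.act p.1.2 ⟨k, hk⟩ p.2.2))).map
        (Prod.mk (π.act p.1.2 ⟨k, hk⟩ p.2.2)) := by
  refine Measure.ext_of_lintegral _ fun g hg => ?_
  rw [M.lintegral_step π k hk p hg, lintegral_map hg measurable_prodMk_left]

theorem integral_rollout_succ (k : ℕ) (hk : k + 1 ≤ H) (p : Param H d × W)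
    {g : Obs S A (k + 1) → ℝ} (hg : Measurable g) {C : ℝ} (hC : ∀ ob, |g ob| ≤ C) :
    ∫ ob, g ob ∂(M.rollout π (k + 1) hk p) =
      ∫ ob, ∫ s', g (extend k (ob, (π.act p.2 ⟨k, hk⟩ ob.2, s')))
        ∂(M.trans (p.1, (⟨k, hk⟩, ob.2, π.act p.2 ⟨k, hk⟩ ob.2)))
        ∂(M.rollout π k (Nat.le_of_succ_le hk) p) := by
  have hge : Measurable fun q => g (extend (S := S) (A := A) k q) := hg.comp (measurable_extend k)
  have e : M.rollout π (k + 1) hk = ((M.rollout π k (Nat.le_of_succ_le hk)) ⊗ₖ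
    (M.step π k hk)).map (extend k) := rfl
  rw [e, Kernel.map_apply _ (measurable_extend k), integral_map (measurable_extend k).aemeasurable
    hg.aestronglyMeasurable, integral_compProd (integrable_of_abs_le hge
      (Filter.Eventually.of_forall fun q => hC _))]
  refine integral_congr_ae (Filter.Eventually.of_forall fun ob => ?_)
  simp only
  rw [M.step_eq_map π k hk, integral_map measurable_prodMk_left.aemeasurable
    (Measurable.fun_comp hge measurable_prodMk_left).aestronglyMeasurable]

theorem integral_rollout_trunc {k : ℕ} (hk : k ≤ H) (p : Param H d × W)
    {g : Obs S A k → ℝ} (hg : Measurable g) :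
    ∫ ob, g (trunc k hk ob) ∂(M.rollout π H le_rfl p) = ∫ ob, g ob ∂(M.rollout π k hk p) := by
  rw [← M.rollout_map_trunc π hk le_rfl, integral_map (measurable_trunc hk).aemeasurable
    hg.aestronglyMeasurable]

theorem rollout_at (w : W) (Θ : Param H d) (k : ℕ) (hk : k ≤ H) :
    M.rollout (π.at w) k hk (Θ, ()) = M.rollout π k hk (Θ, w) := by
  induction k with
  | zero => rfl
  | succ k ih =>
    refine Measure.ext_of_lintegral _ fun g hg => ?_
    have hge : Measurable fun q => g (extend (S := S) (A := A) k q) := hg.comp (measurable_extend k)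
    rw [M.lintegral_rollout_succ _ k hk _ hg, M.lintegral_rollout_succ _ k hk _ hg,
      ih (Nat.le_of_succ_le hk)]
    refine lintegral_congr fun ob => ?_
    rw [M.lintegral_step _ k hk _ (Measurable.fun_comp hge (measurable_prodMk_left (x := ob))),
      M.lintegral_step _ k hk _ (Measurable.fun_comp hge (measurable_prodMk_left (x := ob)))]
    rfl

theorem measurable_totalReward : Measurable M.totalReward := by
  unfold totalReward
  exact Finset.measurable_fun_sum _ fun h _ => M.measurable_R.comp
    (f := fun o : Obs S A H => ((h, o.1 h) : SA S A H)) (by fun_prop)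

theorem abs_totalReward_le (ob : Obs S A H) : |M.totalReward ob| ≤ H := by
  unfold totalReward
  refine (Finset.abs_sum_le_sum_abs _ _).trans ?_
  calc ∑ h : Fin H, |M.R (h, ob.1 h)| ≤ ∑ _h : Fin H, (1 : ℝ) := Finset.sum_le_sum fun h _ => by
        rw [abs_of_nonneg (M.R_mem _).1]; exact (M.R_mem _).2
    _ = H := by simp

/-- The expected value of the policy `π^w` in the MDP `M(Θ)`. -/
def familyValue (p : Param H d × W) : ℝ := ∫ ob, M.totalReward ob ∂(M.rollout π H le_rfl p)

theorem value_at (Θ : Param H d) (w : W) : M.value Θ (π.at w) = M.familyValue π (Θ, w) := by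
  unfold value familyValue
  rw [rollout_at]

theorem measurable_familyValue : Measurable (M.familyValue π) := by
  unfold familyValue
  exact (StronglyMeasurable.integral_kernel (κ := M.rollout π H le_rfl)
    M.measurable_totalReward.stronglyMeasurable).measurable

theorem abs_familyValue_le (p : Param H d × W) : |M.familyValue π p| ≤ H := by
  have := norm_integral_le_of_norm_le_const (μ := M.rollout π H le_rfl p)
    (f := M.totalReward) (C := H) (Filter.Eventually.of_forall fun ob => by
      rw [Real.norm_eq_abs]; exact M.abs_totalReward_le ob)
  simpa [familyValue] using this

/-- The expected reward of the last `m` stages of an episode. -/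
def lastValue : ℕ → (Param H d × W) × S → ℝ
  | 0 => fun _ => 0
  | m + 1 => fun p =>
      -- The recursion runs over the number of remaining stages, backwards from the horizon. The
      -- test fails only for H = 0.
      if hm : H - (m + 1) < H then
        M.R (⟨H - (m + 1), hm⟩, p.2, π.act p.1.2 ⟨H - (m + 1), hm⟩ p.2) +
          ∫ s', lastValue m (p.1, s')
            ∂(M.trans (p.1.1, (⟨H - (m + 1), hm⟩, p.2, π.act p.1.2 ⟨H - (m + 1), hm⟩ p.2)))
      else 0

theorem measurable_stage (h : Fin H) : Measurable fun p : (Param H d × W) × S =>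
    ((h, p.2, π.act p.1.2 h p.2) : SA S A H) :=
  measurable_const.prodMk (measurable_snd.prodMk ((π.measurable_act h).comp
    (f := fun p : (Param H d × W) × S => (p.1.2, p.2)) (by fun_prop)))

theorem measurable_lastValue (m : ℕ) : Measurable (M.lastValue π m) := by
  induction m with
  | zero => exact measurable_const
  | succ m ih =>
    unfold lastValue
    by_cases hm : H - (m + 1) < H
    · simp only [hm, dite_true]
      have hst := measurable_stage (d := d) π ⟨H - (m + 1), hm⟩
      refine (M.measurable_R.comp hst).add ?_
      have hκ : Measurable fun p : (Param H d × W) × S => ((p.1.1, (⟨H - (m + 1), hm⟩, p.2,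
          π.act p.1.2 ⟨H - (m + 1), hm⟩ p.2)) : Param H d × SA S A H) :=
        (measurable_fst.comp measurable_fst).prodMk hst
      have hm' : Measurable fun q : ((Param H d × W) × S) × S => M.lastValue π m (q.1.1, q.2) :=
        ih.comp (f := fun q : ((Param H d × W) × S) × S => (q.1.1, q.2)) (by fun_prop)
      exact (StronglyMeasurable.integral_kernel_prod_right'
        (κ := M.trans.comap _ hκ) hm'.stronglyMeasurable).measurable
    · simp only [hm, dite_false]; exact measurable_const

theorem lastValue_mem (m : ℕ) (p : (Param H d × W) × S) :
    M.lastValue π m p ∈ Set.Icc (0 : ℝ) m := by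
  induction m generalizing p with
  | zero => simp [lastValue]
  | succ m ih =>
    unfold lastValue
    split_ifs with hm
    · have h1 := M.R_mem (⟨H - (m + 1), hm⟩, p.2, π.act p.1.2 ⟨H - (m + 1), hm⟩ p.2)
      have h2 : 0 ≤ ∫ s', M.lastValue π m (p.1, s')
            ∂(M.trans (p.1.1, (⟨H - (m + 1), hm⟩, p.2, π.act p.1.2 ⟨H - (m + 1), hm⟩ p.2))) :=
        integral_nonneg fun s' => (ih _).1
      have h3 := norm_integral_le_of_norm_le_const (C := m) (f := fun s' => M.lastValue π m (p.1, s'))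
        (μ := M.trans (p.1.1, (⟨H - (m + 1), hm⟩, p.2, π.act p.1.2 ⟨H - (m + 1), hm⟩ p.2)))
        (Filter.Eventually.of_forall fun s' => by
          rw [Real.norm_eq_abs, abs_of_nonneg (ih _).1]; exact (ih _).2)
      rw [probReal_univ, mul_one] at h3
      have h4 := (le_abs_self _).trans h3
      refine ⟨add_nonneg h1.1 h2, ?_⟩
      push_cast
      linarith [h1.2]
    · refine ⟨le_rfl, by positivity⟩

/-- The value function of the policy `π^w` in the MDP `M(Θ)` at stage `h`, for `p = (Θ, w)`. -/
def stageValue (h : ℕ) (p : Param H d × W) (s : S) : ℝ := M.lastValue π (H - h) (p, s)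

theorem measurable_stageValue (h : ℕ) :
    Measurable fun q : (Param H d × W) × S => M.stageValue π h q.1 q.2 :=
  M.measurable_lastValue π (H - h)

theorem measurable_stageValue_right (h : ℕ) (p : Param H d × W) : Measurable (M.stageValue π h p) :=
  (M.measurable_stageValue π h).comp (measurable_prodMk_left (x := p))

theorem stageValue_mem (h : ℕ) (p : Param H d × W) (s : S) :
    M.stageValue π h p s ∈ Set.Icc (0 : ℝ) H :=
  ⟨(M.lastValue_mem π (H - h) (p, s)).1, (M.lastValue_mem π (H - h) (p, s)).2.trans
    (by exact_mod_cast Nat.sub_le H h)⟩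

theorem abs_stageValue_le (h : ℕ) (p : Param H d × W) (s : S) : |M.stageValue π h p s| ≤ H := by
  rw [abs_of_nonneg (M.stageValue_mem π h p s).1]
  exact (M.stageValue_mem π h p s).2

theorem stageValue_horizon (p : Param H d × W) (s : S) : M.stageValue π H p s = 0 := by
  unfold stageValue
  rw [Nat.sub_self]
  rfl

theorem stageValue_eq (h : ℕ) (hh : h < H) (p : Param H d × W) (s : S) :
    M.stageValue π h p s = M.R (⟨h, hh⟩, s, π.act p.2 ⟨h, hh⟩ s) +
      ∫ s', M.stageValue π (h + 1) p s' ∂(M.trans (p.1, (⟨h, hh⟩, s, π.act p.2 ⟨h, hh⟩ s))) := by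
  unfold stageValue
  obtain ⟨m, hm⟩ : ∃ m, H - h = m + 1 := ⟨H - h - 1, by omega⟩
  have hm' : H - (h + 1) = m := by omega
  have hhm : H - (m + 1) = h := by omega
  rw [hm, hm']
  -- The stage H - (m + 1) equals h only propositionally, hence the free index i to substitute under
  -- the `Fin` bounds.
  have key : ∀ (i : ℕ) (hi : i = h) (hiH : i < H),
      M.R (⟨i, hiH⟩, s, π.act p.2 ⟨i, hiH⟩ s) + ∫ s', M.lastValue π m (p, s')
        ∂(M.trans (p.1, (⟨i, hiH⟩, s, π.act p.2 ⟨i, hiH⟩ s))) =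
      M.R (⟨h, hh⟩, s, π.act p.2 ⟨h, hh⟩ s) + ∫ s', M.lastValue π m (p, s')
        ∂(M.trans (p.1, (⟨h, hh⟩, s, π.act p.2 ⟨h, hh⟩ s))) := by
    intro i hi hiH
    subst hi
    rfl
  simp only [lastValue]
  rw [dif_pos (by omega : H - (m + 1) < H)]
  exact key _ hhm _

/-- The triple `(h, s_h, π^w_h(s_h))`. -/
def playedStage (h : ℕ) (hh : h < H) (w : W) (s : S) : SA S A H := (⟨h, hh⟩, s, π.act w ⟨h, hh⟩ s)

theorem measurable_integral_stageValue (h k : ℕ) (hh : h < H) (Θ : Param H d)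
    (p : Param H d × W) : Measurable fun s =>
      ∫ s', M.stageValue π k p s' ∂(M.trans (Θ, playedStage π h hh p.2 s)) := by
  have hm : Measurable fun s => (Θ, playedStage π h hh p.2 s) :=
    measurable_const.prodMk (measurable_const.prodMk (measurable_id.prodMk
      ((π.measurable_act ⟨h, hh⟩).comp (f := fun s : S => (p.2, s)) (by fun_prop))))
  exact (StronglyMeasurable.integral_kernel (κ := M.trans.comap _ hm)
    (M.measurable_stageValue_right π k p).stronglyMeasurable).measurable

theorem abs_integral_stageValue_le (k : ℕ) (p : Param H d × W) (q : Param H d × SA S A H) :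
    |∫ s', M.stageValue π k p s' ∂(M.trans q)| ≤ H := by
  have := norm_integral_le_of_norm_le_const (μ := M.trans q)
    (f := M.stageValue π k p) (C := H) (Filter.Eventually.of_forall fun s => by
      rw [Real.norm_eq_abs]; exact M.abs_stageValue_le π k p s)
  simpa using this

theorem integral_reward (h : Fin H) (p : Param H d × W) :
    ∫ ob, M.R (h, ob.1 h) ∂(M.rollout π H le_rfl p) =
      ∫ ob, M.R (playedStage π h h.2 p.2 ob.2) ∂(M.rollout π h h.2.le p) := by
  have hm : Measurable fun ob : Obs S A (h + 1) => M.R (h, ob.1 ⟨h, Nat.lt_succ_self h⟩) :=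
    M.measurable_R.comp (f := fun ob : Obs S A (h + 1) =>
      ((h, ob.1 ⟨h, Nat.lt_succ_self h⟩) : SA S A H)) (by fun_prop)
  have h1 := M.integral_rollout_trunc π (k := h + 1) h.2 p hm
  have h2 := M.integral_rollout_succ π h h.2 p hm (C := 1) (fun ob => by
    rw [abs_of_nonneg (M.R_mem _).1]; exact (M.R_mem _).2)
  simp only [extend_fst_last, integral_const, probReal_univ, one_smul] at h2
  exact h1.trans h2

theorem integral_next_stageValue (h : ℕ) (hh : h < H) (Θ : Param H d) (p : Param H d × W) :
    ∫ ob, M.stageValue π (h + 1) p ob.2 ∂(M.rollout π (h + 1) hh (Θ, p.2)) =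
      ∫ ob, ∫ s', M.stageValue π (h + 1) p s' ∂(M.trans (Θ, playedStage π h hh p.2 ob.2))
        ∂(M.rollout π h hh.le (Θ, p.2)) :=
  M.integral_rollout_succ π h hh (Θ, p.2) (g := fun ob => M.stageValue π (h + 1) p ob.2)
    ((M.measurable_stageValue_right π (h + 1) p).comp measurable_snd)
    (fun _ => M.abs_stageValue_le π _ p _)

/-- The telescoping identity behind the simulation lemma. -/
theorem familyValue_eq_sub_sum (Θ : Param H d) (p : Param H d × W) :
    M.familyValue π (Θ, p.2) =
      ∫ ob, M.stageValue π 0 p ob.2 ∂(M.rollout π 0 (Nat.zero_le H) (Θ, p.2)) -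
      ∑ h : Fin H, ∫ ob, (∫ s', M.stageValue π (h + 1) p s'
          ∂(M.trans (p.1, playedStage π h h.2 p.2 ob.2)) -
        ∫ s', M.stageValue π (h + 1) p s' ∂(M.trans (Θ, playedStage π h h.2 p.2 ob.2)))
        ∂(M.rollout π h h.2.le (Θ, p.2)) := by
  -- The planned value function at s_k, averaged along the true dynamics. The planned Bellman
  -- equation expresses a h and the true transition expresses a (h + 1), so each one-step error is a
  -- h - a (h + 1) minus the mean reward of stage h.
  set a : ℕ → ℝ := fun k => if hk : k ≤ H then
    ∫ ob, M.stageValue π k p ob.2 ∂(M.rollout π k hk (Θ, p.2)) else 0 with ha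
  have hR : M.familyValue π (Θ, p.2) =
      ∑ h : Fin H, ∫ ob, M.R (h, ob.1 h) ∂(M.rollout π H le_rfl (Θ, p.2)) := by
    unfold familyValue totalReward
    refine integral_finsetSum _ fun h _ => integrable_of_abs_le (C := 1) ?_ ?_
    · exact M.measurable_R.comp (f := fun o : Obs S A H => ((h, o.1 h) : SA S A H)) (by fun_prop)
    · exact Filter.Eventually.of_forall fun ob => by
        rw [abs_of_nonneg (M.R_mem _).1]; exact (M.R_mem _).2
  have hstep (h : Fin H) : ∫ ob, (∫ s', M.stageValue π (h + 1) p s'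
          ∂(M.trans (p.1, playedStage π h h.2 p.2 ob.2)) -
        ∫ s', M.stageValue π (h + 1) p s' ∂(M.trans (Θ, playedStage π h h.2 p.2 ob.2)))
        ∂(M.rollout π h h.2.le (Θ, p.2)) =
      a h - a (h + 1) - ∫ ob, M.R (h, ob.1 h) ∂(M.rollout π H le_rfl (Θ, p.2)) := by
    have i1 (Θ₁ : Param H d) : Integrable (fun ob : Obs S A h => ∫ s', M.stageValue π (h + 1) p s'
          ∂(M.trans (Θ₁, playedStage π h h.2 p.2 ob.2))) (M.rollout π h h.2.le (Θ, p.2)) :=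
      integrable_of_abs_le ((M.measurable_integral_stageValue π h (h + 1) h.2 Θ₁ p).comp
        measurable_snd) (Filter.Eventually.of_forall fun ob => M.abs_integral_stageValue_le π _ p _)
    have iR : Integrable (fun ob : Obs S A h => M.R (playedStage π h h.2 p.2 ob.2))
        (M.rollout π h h.2.le (Θ, p.2)) := by
      refine integrable_of_abs_le (C := 1) (M.measurable_R.comp
        (f := fun ob : Obs S A h => playedStage π h h.2 p.2 ob.2) ?_) ?_
      · exact measurable_const.prodMk (measurable_snd.prodMk
          ((π.measurable_act h).comp (f := fun ob : Obs S A h => (p.2, ob.2)) (by fun_prop)))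
      · exact Filter.Eventually.of_forall fun ob => by
          rw [abs_of_nonneg (M.R_mem _).1]; exact (M.R_mem _).2
    have e1 : a h = ∫ ob, M.R (playedStage π h h.2 p.2 ob.2) ∂(M.rollout π h h.2.le (Θ, p.2)) +
        ∫ ob, ∫ s', M.stageValue π (h + 1) p s' ∂(M.trans (p.1, playedStage π h h.2 p.2 ob.2))
          ∂(M.rollout π h h.2.le (Θ, p.2)) := by
      rw [← integral_add iR (i1 p.1)]
      simp only [ha, h.2.le, dite_true]
      exact integral_congr_ae (Filter.Eventually.of_forall fun ob =>
        M.stageValue_eq π h h.2 p ob.2)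
    have e2 : a (h + 1) = ∫ ob, ∫ s', M.stageValue π (h + 1) p s'
        ∂(M.trans (Θ, playedStage π h h.2 p.2 ob.2)) ∂(M.rollout π h h.2.le (Θ, p.2)) := by
      have : (h : ℕ) + 1 ≤ H := h.2
      simp only [ha, this, dite_true]
      exact M.integral_next_stageValue π h h.2 Θ p
    rw [integral_sub (i1 p.1) (i1 Θ), e1, e2, M.integral_reward π h (Θ, p.2)]
    ring
  have htel : ∑ h : Fin H, (a h - a (h + 1)) = a 0 - a H := by
    rw [Fin.sum_univ_eq_sum_range (fun h => a h - a (h + 1)) H, Finset.sum_range_sub']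
  have haH : a H = 0 := by
    simp [ha, M.stageValue_horizon π p]
  have ha0 : a 0 = ∫ ob, M.stageValue π 0 p ob.2 ∂(M.rollout π 0 (Nat.zero_le H) (Θ, p.2)) := by
    simp [ha]
  rw [hR, Finset.sum_congr rfl fun h _ => hstep h, Finset.sum_sub_distrib, htel, haH, ha0]
  ring

/-- The simulation lemma: the difference of the values of a policy in two MDPs. -/
theorem familyValue_sub_familyValue (Θ : Param H d) (p : Param H d × W) :
    M.familyValue π p - M.familyValue π (Θ, p.2) =
      ∑ h : Fin H, ∫ ob, (∫ s', M.stageValue π (h + 1) p s'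
          ∂(M.trans (p.1, playedStage π h h.2 p.2 ob.2)) -
        ∫ s', M.stageValue π (h + 1) p s' ∂(M.trans (Θ, playedStage π h h.2 p.2 ob.2)))
        ∂(M.rollout π h h.2.le (Θ, p.2)) := by
  have h1 := M.familyValue_eq_sub_sum π Θ p
  -- When the true model is the planned one, all one-step errors vanish. This identifies the initial
  -- term, whose law ρ does not depend on the parameters, with the planned value.
  have h2 := M.familyValue_eq_sub_sum π p.1 p
  simp only [sub_self, integral_zero, Finset.sum_const_zero, sub_zero] at h2
  have h3 : M.rollout π 0 (Nat.zero_le H) (p.1, p.2) = M.rollout π 0 (Nat.zero_le H) (Θ, p.2) := rfl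
  rw [h3] at h2
  rw [h1]
  have h4 : M.familyValue π p = M.familyValue π (p.1, p.2) := rfl
  rw [h4, h2]
  ring

end Simulation

/-- For proper parameters, the expectation of a function of the next state is linear. -/
theorem integral_trans_eq_inner {Θ : Param H d} (hΘ : M.Proper Θ) (x : SA S A H) {V : S → ℝ}
    (hV : Measurable V) {C : ℝ} (hC : ∀ s, |V s| ≤ C) :
    ∫ s', V s' ∂(M.trans (Θ, x)) = inner ℝ (Θ x.1) (M.valueFeature V x) := by
  have hi : Integrable (fun s' => V s' • M.φ x s') (M.ν x) :=
    (M.integrable_φ x).bdd_smul C hV.aestronglyMeasurable (Filter.Eventually.of_forall hC)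
  have hd : Measurable fun s' => ENNReal.ofReal (M.density Θ x s') :=
    (M.measurable_density.of_uncurry_left (x := (Θ, x))).ennreal_ofReal
  unfold valueFeature
  rw [M.trans_apply_of_proper hΘ, integral_withDensity_eq_integral_toReal_smul hd
    (Filter.Eventually.of_forall fun _ => ENNReal.ofReal_lt_top), ← integral_inner hi]
  refine integral_congr_ae ((hΘ x).1.mono fun s' hs' => ?_)
  simp only [smul_eq_mul]
  rw [ENNReal.toReal_ofReal hs', inner_smul_right, mul_comm]
  rfl

end LinearMixture

theorem compProd_prodMkLeft_comp {α β γ : Type*} [MeasurableSpace α] [MeasurableSpace β]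
    [MeasurableSpace γ] (μ : Measure α) [SFinite μ] (κ : Kernel α β) [IsSFiniteKernel κ]
    (η : Kernel β γ) [IsSFiniteKernel η] :
    (κ ⊗ₖ η.prodMkLeft α) ∘ₘ μ = (κ ∘ₘ μ) ⊗ₘ η := by
  refine Measure.ext_of_lintegral _ fun g hg => ?_
  rw [Measure.lintegral_bind (Kernel.aemeasurable _) hg.aemeasurable, Measure.lintegral_compProd hg,
    Measure.lintegral_bind (Kernel.aemeasurable _) (Measurable.lintegral_kernel_prod_right' hg).aemeasurable]
  refine lintegral_congr fun a => ?_
  rw [Kernel.lintegral_compProd _ _ _ hg]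
  simp only [Kernel.prodMkLeft_apply]

namespace LinearMixture

variable {S A : Type*} [MeasurableSpace S] [MeasurableSpace A] {H d : ℕ}
  (M : LinearMixture S A H d)

/-! ### Features of the planned value functions -/

section Feature

variable (π : PolicyFamily (Param H d) S A H)

/-- The feature at `(h, s, π^Θ(s))` of the normalized next-stage value function of `Θ`. -/
def plannedFeature (h : Fin H) (q : Param H d × S) : EuclideanSpace ℝ (Fin d) :=
  M.valueFeature (fun s' => M.stageValue π (h + 1) (q.1, q.1) s' / H) (playedStage π h h.2 q.1 q.2)

theorem measurable_plannedFeature (h : Fin H) : Measurable (M.plannedFeature π h) := by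
  have hst : Measurable fun q : Param H d × S => playedStage π h h.2 q.1 q.2 :=
    measurable_const.prodMk (measurable_snd.prodMk (π.measurable_act h))
  have hV : Measurable fun q : (Param H d × S) × S =>
      M.stageValue π (h + 1) (q.1.1, q.1.1) q.2 / H :=
    ((M.measurable_stageValue π (h + 1)).comp (f := fun q : (Param H d × S) × S =>
      (((q.1.1, q.1.1), q.2) : (Param H d × Param H d) × S)) (by fun_prop)).div_const _
  have hφ : Measurable fun q : (Param H d × S) × S =>
      M.φ (playedStage π h h.2 q.1.1 q.1.2) q.2 :=
    M.measurable_φ.comp (f := fun q : (Param H d × S) × S =>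
      (playedStage π h h.2 q.1.1 q.1.2, q.2)) ((hst.comp measurable_fst).prodMk measurable_snd)
  exact (StronglyMeasurable.integral_kernel_prod_right' (κ := M.ν.comap _ hst)
    (hV.smul hφ).stronglyMeasurable).measurable

theorem stageValue_div_mem (h : ℕ) (p : Param H d × Param H d) (s : S) :
    M.stageValue π h p s / H ∈ Set.Icc (0 : ℝ) 1 :=
  ⟨div_nonneg (M.stageValue_mem π h p s).1 (Nat.cast_nonneg _),
    div_le_one_of_le₀ (M.stageValue_mem π h p s).2 (Nat.cast_nonneg _)⟩

theorem norm_plannedFeature_le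
    (hφ : ∀ (x : SA S A H) (V : S → ℝ), Measurable V → (∀ s, V s ∈ Set.Icc (0 : ℝ) 1) →
      ‖M.valueFeature V x‖ ≤ 1) (h : Fin H) (q : Param H d × S) :
    ‖M.plannedFeature π h q‖ ≤ 1 :=
  hφ _ _ ((M.measurable_stageValue_right π (h + 1) (q.1, q.1)).div_const _)
    (M.stageValue_div_mem π _ _)

theorem integral_trans_eq_inner_plannedFeature (h : Fin H) {Θ : Param H d} (hΘ : M.Proper Θ)
    (q : Param H d × S) :
    ∫ s', M.stageValue π (h + 1) (q.1, q.1) s' / H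
      ∂(M.trans (Θ, playedStage π h h.2 q.1 q.2)) = inner ℝ (Θ h) (M.plannedFeature π h q) :=
  M.integral_trans_eq_inner hΘ _ ((M.measurable_stageValue_right π (h + 1) (q.1, q.1)).div_const _)
    (C := 1) fun s => by
      rw [abs_of_nonneg (M.stageValue_div_mem π _ _ s).1]; exact (M.stageValue_div_mem π _ _ s).2

/-- Conditioning on the observations up to s_h: g and the played action are fixed there, and the
normalized planned value of s_{h+1} has mean ⟨θ_h, u⟩. The normalization by H puts this value in [0,
1]. -/
theorem integral_stateAt_mul (h : Fin H) {Θ : Param H d} (hΘ : M.Proper Θ) (Θ' : Param H d)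
    {g : Obs S A h → ℝ} (hg : Measurable g) {C : ℝ} (hC : ∀ ob, |g ob| ≤ C) :
    ∫ ob, M.stageValue π (h + 1) (Θ', Θ') (stateAt ob (h + 1)) / H * g (trunc h h.2.le ob)
        ∂(M.rollout π H le_rfl (Θ, Θ')) =
      ∫ ob, inner ℝ (Θ h) (M.plannedFeature π h (Θ', (trunc h h.2.le ob).2)) *
        g (trunc h h.2.le ob) ∂(M.rollout π H le_rfl (Θ, Θ')) := by
  have hV : Measurable fun ob : Obs S A (h + 1) =>
      M.stageValue π (h + 1) (Θ', Θ') ob.2 / H :=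
    ((M.measurable_stageValue_right π (h + 1) (Θ', Θ')).div_const _).comp measurable_snd
  have hm : Measurable fun ob : Obs S A (h + 1) =>
      M.stageValue π (h + 1) (Θ', Θ') ob.2 / H * g (trunc h (Nat.le_succ h) ob) :=
    hV.mul (hg.comp (measurable_trunc _))
  have hb (ob : Obs S A (h + 1)) :
      |M.stageValue π (h + 1) (Θ', Θ') ob.2 / H * g (trunc h (Nat.le_succ h) ob)| ≤ C := by
    have h1 := M.stageValue_div_mem π (h + 1) (Θ', Θ') ob.2
    rw [abs_mul, abs_of_nonneg h1.1]
    exact (mul_le_of_le_one_left (abs_nonneg _) h1.2).trans (hC _)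
  have e1 := M.integral_rollout_trunc π (k := h + 1) h.2 (Θ, Θ') hm
  have e2 := M.integral_rollout_succ π h h.2 (Θ, Θ') hm hb
  have hu : Measurable fun ob : Obs S A h =>
      inner ℝ (Θ h) (M.plannedFeature π h (Θ', ob.2)) * g ob := by
    refine Measurable.mul ?_ hg
    exact measurable_const.inner ((M.measurable_plannedFeature π h).comp (by fun_prop))
  have e3 := M.integral_rollout_trunc π h.2.le (Θ, Θ') hu
  simp only [trunc_trunc_succ] at e1
  refine e1.trans (e2.trans (Eq.trans ?_ e3.symm))
  refine integral_congr_ae (Filter.Eventually.of_forall fun ob => ?_)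
  simp only [trunc_extend le_rfl, trunc_self]
  rw [integral_mul_const]
  congr 1
  exact M.integral_trans_eq_inner_plannedFeature π h hΘ (Θ', ob.2)

theorem familyValue_sub_eq_sum_inner {Θ Θ' : Param H d} (hΘ : M.Proper Θ) (hΘ' : M.Proper Θ') :
    M.familyValue π (Θ', Θ') - M.familyValue π (Θ, Θ') =
      ∑ h : Fin H, H * ∫ ob, inner ℝ (Θ' h - Θ h) (M.plannedFeature π h (Θ', stateAt ob h))
        ∂(M.rollout π H le_rfl (Θ, Θ')) := by
  have h0 := M.familyValue_sub_familyValue π Θ (Θ', Θ')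
  rw [h0]
  refine Finset.sum_congr rfl fun h _ => ?_
  have hH : (H : ℝ) ≠ 0 := by exact_mod_cast (h.pos).ne'
  have hu : Measurable fun ob : Obs S A h =>
      inner ℝ (Θ' h - Θ h) (M.plannedFeature π h (Θ', ob.2)) :=
    measurable_const.inner ((M.measurable_plannedFeature π h).comp (by fun_prop))
  have e3 := M.integral_rollout_trunc π h.2.le (Θ, Θ') hu
  simp only [stateAt_trunc] at e3
  rw [e3, ← integral_const_mul]
  refine integral_congr_ae (Filter.Eventually.of_forall fun ob => ?_)
  have key {Θ₁ : Param H d} (h1 : M.Proper Θ₁) :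
      ∫ s', M.stageValue π (h + 1) (Θ', Θ') s' ∂(M.trans (Θ₁, playedStage π h h.2 Θ' ob.2)) =
      H * inner ℝ (Θ₁ h) (M.plannedFeature π h (Θ', ob.2)) := by
    rw [← M.integral_trans_eq_inner_plannedFeature π h h1, integral_div, mul_div_cancel₀ _ hH]
  simp only [key hΘ, key hΘ', inner_sub_left]
  ring

end Feature

/-! ### Joint laws under posterior sampling -/

section Bayes

variable (prior : Measure (Param H d)) [IsProbabilityMeasure prior]
  (π : PolicyFamily (Param H d) S A H)

instance (n : ℕ) : IsMarkovKernel (M.sampler prior π n) := by unfold sampler; infer_instance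

theorem integral_episode (n k : ℕ) (hk : k ≤ H) (Θ : Param H d)
    {g : (Hist S A H n × Param H d) × Obs S A k → ℝ} (hg : Measurable g) {C : ℝ}
    (hC : ∀ z, |g z| ≤ C) :
    ∫ z, g z ∂(M.episode prior π n k hk Θ) = ∫ o, ∫ Θ', ∫ ob, g ((o, Θ'), ob)
      ∂(M.rollout π k hk (Θ, Θ')) ∂(M.sampler prior π n o) ∂(M.hist prior π n Θ) := by
  have hm : Measurable fun x : Hist S A H n × Param H d =>
      ∫ ob, g (x, ob) ∂(M.rollout π k hk (Θ, x.2)) :=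
    (StronglyMeasurable.integral_kernel_prod_right' (κ := (M.rollout π k hk).comap
      (fun x : Hist S A H n × Param H d => (Θ, x.2)) (by fun_prop)) hg.stronglyMeasurable).measurable
  have hb (x : Hist S A H n × Param H d) :
      |∫ ob, g (x, ob) ∂(M.rollout π k hk (Θ, x.2))| ≤ C := by
    have := norm_integral_le_of_norm_le_const (μ := M.rollout π k hk (Θ, x.2))
      (f := fun ob => g (x, ob)) (C := C) (Filter.Eventually.of_forall fun ob => by
        rw [Real.norm_eq_abs]; exact hC _)
    simpa using this
  unfold episode
  rw [integral_compProd (integrable_of_abs_le hg (Filter.Eventually.of_forall hC))]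
  simp only [Kernel.comap_apply]
  rw [integral_compProd (integrable_of_abs_le hm (Filter.Eventually.of_forall hb))]
  simp only [Kernel.prodMkLeft_apply]

theorem comp_episode_map_fst (n k : ℕ) (hk : k ≤ H) :
    (M.episode prior π n k hk ∘ₘ prior).map Prod.fst =
      (M.hist prior π n ∘ₘ prior) ⊗ₘ M.sampler prior π n := by
  rw [Measure.map_comp _ _ measurable_fst, episode_map_fst, compProd_prodMkLeft_comp]

/-- The defining property of posterior sampling: paired with the history, the sample is distributed
as the truth. -/
theorem compProd_sampler (n : ℕ) : (M.hist prior π n ∘ₘ prior) ⊗ₘ M.sampler prior π n =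
    (prior ⊗ₘ M.hist prior π n).map Prod.swap := by
  unfold sampler
  rw [compProd_posterior_eq_map_swap]

theorem comp_episode_map_hist (n k : ℕ) (hk : k ≤ H) :
    (M.episode prior π n k hk ∘ₘ prior).map (fun z => z.1.1) = M.hist prior π n ∘ₘ prior := by
  have : (fun z : (Hist S A H n × Param H d) × Obs S A k => z.1.1) = Prod.fst ∘ Prod.fst := rfl
  rw [this, ← Measure.map_map measurable_fst measurable_fst, comp_episode_map_fst]
  exact Measure.fst_compProd _ _

theorem comp_episode_map_append (n : ℕ) :
    (M.episode prior π n H le_rfl ∘ₘ prior).map append = M.hist prior π (n + 1) ∘ₘ prior := by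
  rw [Measure.map_comp _ _ (measurable_append n), hist_succ_eq]

theorem comp_episode_map_trunc (n : ℕ) {k : ℕ} (hk : k ≤ H) :
    (M.episode prior π n H le_rfl ∘ₘ prior).map (Prod.map id (trunc k hk)) =
      M.episode prior π n k hk ∘ₘ prior := by
  have mt : Measurable (Prod.map id (trunc k hk) :
    (Hist S A H n × Param H d) × Obs S A H → (Hist S A H n × Param H d) × Obs S A k) :=
    measurable_id.prodMap (measurable_trunc hk)
  rw [Measure.map_comp _ _ mt]
  congr 1
  ext1 Θ
  rw [Kernel.map_apply _ mt, episode_map_trunc]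

theorem compProd_episode_map_trunc (n : ℕ) {k : ℕ} (hk : k ≤ H) :
    (prior ⊗ₘ M.episode prior π n H le_rfl).map (Prod.map id (Prod.map id (trunc k hk))) =
      prior ⊗ₘ M.episode prior π n k hk := by
  have mt : Measurable (Prod.map id (trunc k hk) :
    (Hist S A H n × Param H d) × Obs S A H → (Hist S A H n × Param H d) × Obs S A k) :=
    measurable_id.prodMap (measurable_trunc hk)
  rw [← Measure.compProd_map mt]
  congr 1
  ext1 Θ
  rw [Kernel.map_apply _ mt, episode_map_trunc]

end Bayes

end LinearMixture

/-! ### Stage gaps and mean log-determinants -/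

namespace LinearMixture

open Matrix

variable {S A : Type*} [MeasurableSpace S] [MeasurableSpace A] {H d : ℕ}
  (M : LinearMixture S A H d) (prior : Measure (Param H d)) [IsProbabilityMeasure prior]
  (π : PolicyFamily (Param H d) S A H)

theorem ae_compProd_episode_fst (n k : ℕ) (hk : k ≤ H) {P : Param H d → Prop}
    (hP : ∀ᵐ Θ ∂prior, P Θ) : ∀ᵐ p ∂(prior ⊗ₘ M.episode prior π n k hk), P p.1 := by
  have h : (prior ⊗ₘ M.episode prior π n k hk).map Prod.fst = prior := Measure.fst_compProd _ _
  rw [← h] at hP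
  exact ae_of_ae_map measurable_fst.aemeasurable hP

/-- The law of the parameters sampled by the agent is the prior. -/
theorem compProd_episode_map_sample (n k : ℕ) (hk : k ≤ H) :
    (prior ⊗ₘ M.episode prior π n k hk).map (fun p => p.2.1.2) = prior := by
  have e1 : (fun p : Param H d × ((Hist S A H n × Param H d) × Obs S A k) => p.2.1.2) =
    Prod.snd ∘ Prod.fst ∘ Prod.snd := rfl
  have e2 : (prior ⊗ₘ M.episode prior π n k hk).map Prod.snd = M.episode prior π n k hk ∘ₘ prior :=
    Measure.snd_compProd _ _
  rw [e1, ← Measure.map_map measurable_snd (by fun_prop), ← Measure.map_map measurable_fst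
    measurable_snd, e2, comp_episode_map_fst, compProd_sampler,
    Measure.map_map measurable_snd measurable_swap]
  exact Measure.fst_compProd _ _

theorem ae_compProd_episode_sample (n k : ℕ) (hk : k ≤ H) {P : Param H d → Prop}
    (hP : ∀ᵐ Θ ∂prior, P Θ) : ∀ᵐ p ∂(prior ⊗ₘ M.episode prior π n k hk), P p.2.1.2 := by
  rw [← M.compProd_episode_map_sample prior π n k hk] at hP
  exact ae_of_ae_map (by fun_prop) hP

/-- The expected gap of stage `h` in episode `n + 1`, up to the factor `H`. -/
def stageGap (n : ℕ) (h : Fin H) : ℝ :=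
  ∫ p, inner ℝ (p.2.1.2 h - p.1 h) (M.plannedFeature π h (p.2.1.2, stateAt p.2.2 h))
    ∂(prior ⊗ₘ M.episode prior π n H le_rfl)

/-- The mean log-determinant of the posterior covariance matrix after `n` episodes. -/
def meanLogDet (n : ℕ) (h : Fin H) (c : ℝ) : ℝ :=
  ∫ o, Real.log (1 + c • covMat (M.stagePosterior prior n h o)).det ∂(M.hist prior π n ∘ₘ prior)

variable {prior π} {B : ℝ} (hB : 0 ≤ B)
  (hproper : ∀ᵐ Θ ∂prior, M.Proper Θ)
  (hφ : ∀ (x : SA S A H) (V : S → ℝ), Measurable V → (∀ s, V s ∈ Set.Icc (0 : ℝ) 1) →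
    ‖M.valueFeature V x‖ ≤ 1)
  (hind : iIndepFun (fun (h : Fin H) (Θ : Param H d) => Θ h) prior)
  (hprior : ∀ᵐ Θ ∂prior, ∀ h, ‖Θ h‖ ≤ B)

include hB hprior in
theorem meanLogDet_le (n : ℕ) (h : Fin H) {c : ℝ} (hc : 0 ≤ c) :
    M.meanLogDet prior π n h c ≤ d * Real.log (1 + c * B ^ 2) := by
  have hq := M.ae_stagePosterior_norm_le prior hB (hprior.mono fun _ hΘ => hΘ h) n
  have hnn (o : Hist S A H n) := log_det_one_add_smul_nonneg (covMat_posSemidef (hq o)) hc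
  have hle (o : Hist S A H n) := log_det_covMat_le (hq o) hc
  have := norm_integral_le_of_norm_le_const (μ := M.hist prior π n ∘ₘ prior)
    (f := fun o => Real.log (1 + c • covMat (M.stagePosterior prior n h o)).det)
    (C := d * Real.log (1 + c * B ^ 2)) (Filter.Eventually.of_forall fun o => by
      rw [Real.norm_eq_abs, abs_of_nonneg (hnn o)]; exact hle o)
  rw [probReal_univ, mul_one] at this
  exact (le_abs_self _).trans this

include hB hprior in
theorem meanLogDet_nonneg (n : ℕ) (h : Fin H) {c : ℝ} (hc : 0 ≤ c) :
    0 ≤ M.meanLogDet prior π n h c := by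
  have hq := M.ae_stagePosterior_norm_le prior hB (hprior.mono fun _ hΘ => hΘ h) n
  exact integral_nonneg fun o => log_det_one_add_smul_nonneg (covMat_posSemidef (hq o)) hc

include hB hprior in
theorem measurable_logDet (n : ℕ) (h : Fin H) (c : ℝ) :
    Measurable fun o => Real.log (1 + c • covMat (M.stagePosterior prior n h o)).det := by
  have hq := M.ae_stagePosterior_norm_le prior hB (hprior.mono fun _ hΘ => hΘ h) n
  exact Real.measurable_log.comp (measurable_det
    (measurable_one_add_smul (measurable_covMat _ hq) c))

include hB hprior in
theorem meanLogDet_eq (n : ℕ) (h : Fin H) (c : ℝ) : M.meanLogDet prior π n h c =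
    ∫ z, Real.log (1 + c • covMat (M.stagePosterior prior n h z.1.1)).det
      ∂(M.episode prior π n H le_rfl ∘ₘ prior) := by
  unfold meanLogDet
  rw [← M.comp_episode_map_hist prior π n H le_rfl, integral_map (by fun_prop)
    (M.measurable_logDet hB hprior n h c).aestronglyMeasurable]

include hB hprior in
theorem meanLogDet_succ_eq (n : ℕ) (h : Fin H) (c : ℝ) : M.meanLogDet prior π (n + 1) h c =
    ∫ z, Real.log (1 + c • covMat (M.stagePosterior prior (n + 1) h (append z))).det
      ∂(M.episode prior π n H le_rfl ∘ₘ prior) := by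
  unfold meanLogDet
  rw [← M.comp_episode_map_append prior π n, integral_map (measurable_append n).aemeasurable
    (M.measurable_logDet hB hprior (n + 1) h c).aestronglyMeasurable]

-- Paired with the history, the sample and the truth have the same law, so the disintegration
-- obtained for the true stage parameter also holds for the sampled one.
include hproper hind in
theorem comp_episode_map_sample_stage (n k : ℕ) (hk : k ≤ H) (h : Fin H) :
    (M.episode prior π n k hk ∘ₘ prior).map (fun z => (z.1.1, z.1.2 h)) =
      (M.hist prior π n ∘ₘ prior) ⊗ₘ M.stagePosterior prior n h := by
  have e1 : (fun z : (Hist S A H n × Param H d) × Obs S A k => (z.1.1, z.1.2 h)) =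
    (fun x => (x.1, x.2 h)) ∘ Prod.fst := rfl
  rw [e1, ← Measure.map_map (by fun_prop) measurable_fst, comp_episode_map_fst, compProd_sampler,
    Measure.map_map (by fun_prop) measurable_swap, ← M.map_compProd_hist prior π hproper hind n h]
  rfl

include hproper hind in
theorem stageGap_eq (n : ℕ) (h : Fin H) : M.stageGap prior π n h =
    ∫ p, inner ℝ (p.1.1.2 h - p.2) (M.plannedFeature π h (p.1.1.2, stateAt p.1.2 h))
      ∂((M.episode prior π n H le_rfl ∘ₘ prior) ⊗ₘ
        ((M.stagePosterior prior (n + 1) h).comap append (measurable_append n))) := by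
  have hm : Measurable fun p : ((Hist S A H n × Param H d) × Obs S A H) ×
      EuclideanSpace ℝ (Fin d) =>
      inner ℝ (p.1.1.2 h - p.2) (M.plannedFeature π h (p.1.1.2, stateAt p.1.2 h)) := by
    refine Measurable.inner (by fun_prop) ((M.measurable_plannedFeature π h).comp ?_)
    exact (by fun_prop : Measurable fun p : ((Hist S A H n × Param H d) × Obs S A H) ×
      EuclideanSpace ℝ (Fin d) => p.1.1.2).prodMk ((measurable_stateAt H h).comp (by fun_prop))
  rw [← M.map_compProd_episode prior π hproper hind n h, integral_map (by fun_prop)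
    hm.aestronglyMeasurable]
  rfl

-- Both sides are the joint law of θ_h and the data up to s_h: one disintegrates after the whole
-- episode and then forgets, the other disintegrates before stage h is played. This is the
-- refinement hypothesis of the log-determinant estimate.
include hproper hind in
theorem map_trunc_compProd_stagePosterior (n : ℕ) (h : Fin H) :
    ((M.episode prior π n H le_rfl ∘ₘ prior) ⊗ₘ
        ((M.stagePosterior prior (n + 1) h).comap append (measurable_append n))).map
      (Prod.map (Prod.map id (trunc h h.2.le)) id) =
    ((M.episode prior π n H le_rfl ∘ₘ prior).map (Prod.map id (trunc h h.2.le))) ⊗ₘ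
      ((M.stagePosterior prior n h).comap (fun x => x.1.1) (by fun_prop)) := by
  have mt : Measurable (Prod.map id (trunc h h.2.le) :
    (Hist S A H n × Param H d) × Obs S A H → (Hist S A H n × Param H d) × Obs S A h) :=
    measurable_id.prodMap (measurable_trunc h.2.le)
  rw [comp_episode_map_trunc, ← M.map_compProd_episode prior π hproper hind n h,
    ← M.map_compProd_episode_stage prior π hproper hind n h,
    ← M.compProd_episode_map_trunc prior π n h.2.le, Measure.map_map (mt.prodMap measurable_id)
      (by fun_prop), Measure.map_map (by fun_prop) (measurable_id.prodMap mt)]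
  rfl

end LinearMixture

namespace LinearMixture

open Matrix

variable {S A : Type*} [MeasurableSpace S] [MeasurableSpace A] {H d : ℕ}
  (M : LinearMixture S A H d) {prior : Measure (Param H d)} [IsProbabilityMeasure prior]
  {π : PolicyFamily (Param H d) S A H} {B : ℝ} (hB : 0 ≤ B)
  (hproper : ∀ᵐ Θ ∂prior, M.Proper Θ)
  (hφ : ∀ (x : SA S A H) (V : S → ℝ), Measurable V → (∀ s, V s ∈ Set.Icc (0 : ℝ) 1) →
    ‖M.valueFeature V x‖ ≤ 1)
  (hind : iIndepFun (fun (h : Fin H) (Θ : Param H d) => Θ h) prior)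
  (hprior : ∀ᵐ Θ ∂prior, ∀ h, ‖Θ h‖ ≤ B)

theorem measurable_nextValue (n : ℕ) (h : Fin H) :
    Measurable fun z : (Hist S A H n × Param H d) × Obs S A H =>
      M.stageValue π (h + 1) (z.1.2, z.1.2) (stateAt z.2 (h + 1)) / H := by
  refine Measurable.div_const ((M.measurable_stageValue π (h + 1)).comp
    (f := fun z : (Hist S A H n × Param H d) × Obs S A H =>
      (((z.1.2, z.1.2), stateAt z.2 (h + 1)) : (Param H d × Param H d) × S)) ?_) _
  exact (by fun_prop : Measurable fun z : (Hist S A H n × Param H d) × Obs S A H =>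
    (z.1.2, z.1.2)).prodMk ((measurable_stateAt H (h + 1)).comp measurable_snd)

theorem measurable_obsFeature (n : ℕ) (h : Fin H) :
    Measurable fun x : (Hist S A H n × Param H d) × Obs S A h =>
      M.plannedFeature π h (x.1.2, x.2.2) :=
  (M.measurable_plannedFeature π h).comp
    (f := fun x : (Hist S A H n × Param H d) × Obs S A h => (x.1.2, x.2.2)) (by fun_prop)

include hφ in
theorem integral_episode_nextValue_mul (n : ℕ) (h : Fin H) {Θ : Param H d} (hΘ : M.Proper Θ)
    {Φ : ((Hist S A H n × Param H d) × Obs S A h) → ℝ} (hΦ : Measurable Φ) {C : ℝ}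
    (hC : ∀ x, |Φ x| ≤ C) :
    ∫ z, M.stageValue π (h + 1) (z.1.2, z.1.2) (stateAt z.2 (h + 1)) / H *
        Φ (Prod.map id (trunc h h.2.le) z) ∂(M.episode prior π n H le_rfl Θ) =
      ∫ z, inner ℝ (Θ h) (M.plannedFeature π h (z.1.2, (trunc h h.2.le z.2).2)) *
        Φ (Prod.map id (trunc h h.2.le) z) ∂(M.episode prior π n H le_rfl Θ) := by
  have mt : Measurable (Prod.map id (trunc h h.2.le) :
    (Hist S A H n × Param H d) × Obs S A H → (Hist S A H n × Param H d) × Obs S A h) :=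
    measurable_id.prodMap (measurable_trunc h.2.le)
  have hΦt : Measurable fun z : (Hist S A H n × Param H d) × Obs S A H =>
    Φ (Prod.map id (trunc h h.2.le) z) := Measurable.fun_comp hΦ mt
  have hu : Measurable fun z : (Hist S A H n × Param H d) × Obs S A H =>
      M.plannedFeature π h (z.1.2, (trunc h h.2.le z.2).2) :=
    (M.measurable_obsFeature (π := π) n h).comp mt
  rw [M.integral_episode prior π n H le_rfl Θ (C := C) ((M.measurable_nextValue (π := π) n h).fun_mul hΦt)
    (fun z => by
      have h1 := M.stageValue_div_mem π (h + 1) (z.1.2, z.1.2) (stateAt z.2 (h + 1))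
      rw [abs_mul, abs_of_nonneg h1.1]
      exact (mul_le_of_le_one_left (abs_nonneg _) h1.2).trans (hC _)),
    M.integral_episode prior π n H le_rfl Θ (C := ‖Θ h‖ * 1 * C)
      ((measurable_const.inner hu).fun_mul hΦt) (fun z => by
      rw [abs_mul]
      refine mul_le_mul ((abs_real_inner_le_norm _ _).trans ?_) (hC _) (abs_nonneg _)
        (by positivity)
      exact mul_le_mul_of_nonneg_left (M.norm_plannedFeature_le π hφ h _) (norm_nonneg _))]
  refine integral_congr_ae (Filter.Eventually.of_forall fun o => ?_)
  refine integral_congr_ae (Filter.Eventually.of_forall fun Θ' => ?_)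
  exact M.integral_stateAt_mul π h hΘ Θ' (Measurable.fun_comp hΦ (measurable_prodMk_left
    (x := (o, Θ')))) (fun ob => hC _)

include hproper hφ hind hprior hB in
theorem integral_nextValue_mul (n : ℕ) (h : Fin H)
    (Φ : ((Hist S A H n × Param H d) × Obs S A h) × EuclideanSpace ℝ (Fin d) → ℝ)
    (hΦ : Measurable Φ)
    (hC : ∃ C, ∀ᵐ p ∂((M.episode prior π n H le_rfl ∘ₘ prior) ⊗ₘ
        ((M.stagePosterior prior (n + 1) h).comap append (measurable_append n))),
      |Φ (Prod.map id (trunc h h.2.le) p.1, p.2)| ≤ C) :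
    ∫ p, M.stageValue π (h + 1) (p.1.1.2, p.1.1.2) (stateAt p.1.2 (h + 1)) / H *
        Φ (Prod.map id (trunc h h.2.le) p.1, p.2) ∂((M.episode prior π n H le_rfl ∘ₘ prior) ⊗ₘ
        ((M.stagePosterior prior (n + 1) h).comap append (measurable_append n))) =
      ∫ p, inner ℝ p.2 (M.plannedFeature π h (p.1.1.2, (trunc h h.2.le p.1.2).2)) *
        Φ (Prod.map id (trunc h h.2.le) p.1, p.2) ∂((M.episode prior π n H le_rfl ∘ₘ prior) ⊗ₘ
        ((M.stagePosterior prior (n + 1) h).comap append (measurable_append n))) := by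
  obtain ⟨C, hC⟩ := hC
  set Q := (M.episode prior π n H le_rfl ∘ₘ prior) ⊗ₘ
        ((M.stagePosterior prior (n + 1) h).comap append (measurable_append n)) with hQ
  have mt : Measurable (Prod.map id (trunc h h.2.le) :
    (Hist S A H n × Param H d) × Obs S A H → (Hist S A H n × Param H d) × Obs S A h) :=
    measurable_id.prodMap (measurable_trunc h.2.le)
  -- Φ is bounded only almost everywhere for the joint law, whereas the identity for fixed
  -- parameters is used with a bound valid everywhere. Clipping changes Φ on a null set only.
  set Φ' := fun x => max (-|C|) (min |C| (Φ x)) with hΦ'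
  have mΦ' : Measurable Φ' := measurable_const.max (measurable_const.min hΦ)
  have bΦ' (x) : |Φ' x| ≤ |C| :=
    abs_le.2 ⟨le_max_left _ _, max_le (by linarith [abs_nonneg C]) (min_le_left _ _)⟩
  have eΦ : ∀ᵐ p ∂Q, Φ (Prod.map id (trunc h h.2.le) p.1, p.2) =
      Φ' (Prod.map id (trunc h h.2.le) p.1, p.2) := by
    filter_upwards [hC] with p hp
    have := abs_le.1 (hp.trans (le_abs_self C))
    simp only [hΦ']
    rw [min_eq_right this.2, max_eq_right this.1]
  have e1 : ∫ p, M.stageValue π (h + 1) (p.1.1.2, p.1.1.2) (stateAt p.1.2 (h + 1)) / H *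
      Φ (Prod.map id (trunc h h.2.le) p.1, p.2) ∂Q = ∫ p, M.stageValue π (h + 1)
      (p.1.1.2, p.1.1.2) (stateAt p.1.2 (h + 1)) / H * Φ' (Prod.map id (trunc h h.2.le) p.1, p.2) ∂Q :=
    integral_congr_ae (eΦ.mono fun p hp => by simp only; rw [hp])
  have e2 : ∫ p, inner ℝ p.2 (M.plannedFeature π h (p.1.1.2, (trunc h h.2.le p.1.2).2)) *
      Φ (Prod.map id (trunc h h.2.le) p.1, p.2) ∂Q = ∫ p, inner ℝ p.2 (M.plannedFeature π h
      (p.1.1.2, (trunc h h.2.le p.1.2).2)) * Φ' (Prod.map id (trunc h h.2.le) p.1, p.2) ∂Q :=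
    integral_congr_ae (eΦ.mono fun p hp => by simp only; rw [hp])
  rw [e1, e2]
  have mj : Measurable fun p : ((Hist S A H n × Param H d) × Obs S A H) ×
      EuclideanSpace ℝ (Fin d) => Φ' (Prod.map id (trunc h h.2.le) p.1, p.2) :=
    Measurable.fun_comp mΦ' (mt.prodMap measurable_id)
  have mu : Measurable fun p : ((Hist S A H n × Param H d) × Obs S A H) ×
      EuclideanSpace ℝ (Fin d) => M.plannedFeature π h (p.1.1.2, (trunc h h.2.le p.1.2).2) :=
    (M.measurable_obsFeature (π := π) n h).comp (mt.comp measurable_fst)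
  have m1 : Measurable fun p : ((Hist S A H n × Param H d) × Obs S A H) ×
      EuclideanSpace ℝ (Fin d) => M.stageValue π (h + 1) (p.1.1.2, p.1.1.2)
      (stateAt p.1.2 (h + 1)) / H * Φ' (Prod.map id (trunc h h.2.le) p.1, p.2) :=
    ((M.measurable_nextValue n h).comp measurable_fst).mul mj
  have m2 : Measurable fun p : ((Hist S A H n × Param H d) × Obs S A H) ×
      EuclideanSpace ℝ (Fin d) => inner ℝ p.2 (M.plannedFeature π h (p.1.1.2,
      (trunc h h.2.le p.1.2).2)) * Φ' (Prod.map id (trunc h h.2.le) p.1, p.2) :=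
    (measurable_snd.inner mu).mul mj
  have mpair : Measurable fun p : Param H d × ((Hist S A H n × Param H d) × Obs S A H) =>
    (p.2, p.1 h) := by fun_prop
  rw [hQ, ← M.map_compProd_episode prior π hproper hind n h,
    integral_map mpair.aemeasurable m1.aestronglyMeasurable,
    integral_map mpair.aemeasurable m2.aestronglyMeasurable,
    Measure.integral_compProd, Measure.integral_compProd]
  · refine integral_congr_ae (hproper.mono fun Θ hΘ => ?_)
    exact M.integral_episode_nextValue_mul hφ n h hΘ (Φ := fun x => Φ' (x, Θ h))
      (Measurable.fun_comp mΦ' measurable_prodMk_right) (fun x => bΦ' _)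
  · refine integrable_of_abs_le (C := B * |C|) (m2.comp mpair) ?_
    filter_upwards [M.ae_compProd_episode_fst prior π n H le_rfl hprior] with p hp
    rw [abs_mul]
    refine mul_le_mul ((abs_real_inner_le_norm _ _).trans ?_) (bΦ' _) (abs_nonneg _) hB
    exact (mul_le_mul (hp h) (M.norm_plannedFeature_le π hφ h _) (norm_nonneg _) hB).trans_eq
      (mul_one B)
  · refine integrable_of_abs_le (C := |C|) (m1.comp mpair) (Filter.Eventually.of_forall fun p => ?_)
    have h1 := M.stageValue_div_mem π (h + 1) (p.2.1.2, p.2.1.2) (stateAt p.2.2 (h + 1))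
    simp only
    rw [abs_mul, abs_of_nonneg h1.1]
    exact (mul_le_of_le_one_left (abs_nonneg _) h1.2).trans (bΦ' _)

-- The decoupling bound applies with z the history, the sample and the full episode, r the
-- truncation at s_h, o the history, and Y the normalized planned value of s_{h+1}. Although the
-- full episode reveals more than Y, its posterior mean still has error at most that of the
-- estimator built from Y.
include hproper hφ hind hprior hB in
theorem two_mul_stageGap_le (n : ℕ) (h : Fin H) {c s : ℝ} (hc : 0 < c) (hs : 0 < s) :
    2 * M.stageGap prior π n h ≤ s * d + s⁻¹ *
      ((M.meanLogDet prior π n h c - M.meanLogDet prior π (n + 1) h c) / 4 + 2 / c) := by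
  have mt : Measurable (Prod.map id (trunc h h.2.le) :
    (Hist S A H n × Param H d) × Obs S A H → (Hist S A H n × Param H d) × Obs S A h) :=
    measurable_id.prodMap (measurable_trunc h.2.le)
  have hq (n : ℕ) := M.ae_stagePosterior_norm_le prior hB (hprior.mono fun _ hΘ => hΘ h) n
  rw [M.stageGap_eq hproper hind, M.meanLogDet_eq hB hprior, M.meanLogDet_succ_eq hB hprior]
  refine two_mul_integral_inner_le (ζ := M.episode prior π n H le_rfl ∘ₘ prior)
    (q := M.stagePosterior prior n h) (o := fun x => x.1.1) (r := Prod.map id (trunc h h.2.le))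
    (q' := (M.stagePosterior prior (n + 1) h).comap append (measurable_append n))
    (τ := fun x => x.1.2 h) (u := fun x => M.plannedFeature π h (x.1.2, x.2.2))
    (Y := fun z => M.stageValue π (h + 1) (z.1.2, z.1.2) (stateAt z.2 (h + 1)) / H)
    hB (hq n) (fun z => hq (n + 1) _) mt (by fun_prop)
    (M.map_trunc_compProd_stagePosterior hproper hind n h) (by fun_prop) ?_
    (M.measurable_obsFeature n h) (fun x => M.norm_plannedFeature_le π hφ h _)
    (M.measurable_nextValue n h) (fun z => M.stageValue_div_mem π _ _ _)
    (M.integral_nextValue_mul hB hproper hφ hind hprior n h) hc hs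
  have e : (M.episode prior π n H le_rfl ∘ₘ prior).map
      ((fun x => x.1.1) ∘ (Prod.map id (trunc h h.2.le) :
        (Hist S A H n × Param H d) × Obs S A H → _)) = M.hist prior π n ∘ₘ prior :=
    M.comp_episode_map_hist prior π n H le_rfl
  rw [e]
  exact M.comp_episode_map_sample_stage hproper hind n H le_rfl h

include hproper hφ hind hprior hB in
theorem two_mul_stageGap_le_norm (n : ℕ) (h : Fin H) {t : ℝ} (ht : 0 < t) :
    2 * M.stageGap prior π n h ≤ t * B ^ 2 + t⁻¹ := by
  have mt : Measurable (Prod.map id (trunc h h.2.le) :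
    (Hist S A H n × Param H d) × Obs S A H → (Hist S A H n × Param H d) × Obs S A h) :=
    measurable_id.prodMap (measurable_trunc h.2.le)
  have hq (n : ℕ) := M.ae_stagePosterior_norm_le prior hB (hprior.mono fun _ hΘ => hΘ h) n
  have hτ (k : ℕ) (hk : k ≤ H) := M.comp_episode_map_sample_stage (π := π) hproper hind n k hk h
  have e : (M.episode prior π n H le_rfl ∘ₘ prior).map
      ((fun x => x.1.1) ∘ (Prod.map id (trunc h h.2.le) :
        (Hist S A H n × Param H d) × Obs S A H → _)) = M.hist prior π n ∘ₘ prior :=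
    M.comp_episode_map_hist prior π n H le_rfl
  have h1 := integral_inner_sub_eq (ζ := M.episode prior π n H le_rfl ∘ₘ prior)
    (q := M.stagePosterior prior n h) (o := fun x => x.1.1) (r := Prod.map id (trunc h h.2.le))
    (q' := (M.stagePosterior prior (n + 1) h).comap append (measurable_append n))
    (τ := fun x => x.1.2 h) (u := fun x => M.plannedFeature π h (x.1.2, x.2.2))
    hB (hq n) mt (by fun_prop) (M.map_trunc_compProd_stagePosterior hproper hind n h)
    (by fun_prop) (by rw [e]; exact hτ H le_rfl)
    (M.measurable_obsFeature n h) (fun x => M.norm_plannedFeature_le π hφ h _)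
  rw [M.stageGap_eq hproper hind]
  refine (congrArg (2 * ·) h1).trans_le ?_
  rw [M.comp_episode_map_trunc]
  refine two_mul_integral_dotProduct_le_norm hB (by fun_prop) (by fun_prop) ?_ (hq n)
    (M.measurable_obsFeature n h) (fun x => M.norm_plannedFeature_le π hφ h _) ht
  rw [M.comp_episode_map_hist]
  exact hτ h h.2.le

end LinearMixture

/-! ### Combining the logarithmic and the crude bound -/

theorem exp_eight_sevenths_le : Real.exp (8 / 7) ≤ 23 / 7 := by
  have h1 : Real.exp (8 / 7) ^ 7 = Real.exp 1 ^ 8 := by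
    rw [← Real.exp_nat_mul, ← Real.exp_nat_mul]; norm_num
  have h2 : Real.exp 1 ^ 8 ≤ 2.7182818286 ^ 8 :=
    pow_le_pow_left₀ (Real.exp_pos 1).le Real.exp_one_lt_d9.le 8
  refine le_of_pow_le_pow_left₀ (n := 7) (by norm_num) (by norm_num) ?_
  rw [h1]
  exact h2.trans (by norm_num)

/-- On [0, 8/7] the convex exponential lies below its chord, whose slope is at most (23/7 - 1)/(8/7)
= 2. With y = log(1 + z) this reads 1 + z ≤ 1 + 2y. -/
theorem le_two_mul_log_one_add {z : ℝ} (hz : 0 ≤ z) (h : Real.log (1 + z) ≤ 8 / 7) :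
    z ≤ 2 * Real.log (1 + z) := by
  set y := Real.log (1 + z) with hy
  have hy0 : 0 ≤ y := Real.log_nonneg (by linarith)
  have hexp : Real.exp y = 1 + z := Real.exp_log (by linarith)
  have hc := convexOn_exp.2 (Set.mem_univ (0 : ℝ)) (Set.mem_univ (8 / 7 : ℝ))
    (by linarith : 0 ≤ 1 - 7 / 8 * y) (by linarith : 0 ≤ 7 / 8 * y) (by ring)
  simp only [smul_eq_mul, mul_zero, zero_add, Real.exp_zero, mul_one] at hc
  rw [show 7 / 8 * y * (8 / 7) = y by ring, hexp] at hc
  have := mul_le_mul_of_nonneg_left exp_eight_sevenths_le (by linarith : 0 ≤ 7 / 8 * y)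
  linarith

/-- Let l be the logarithm. The threshold 8/7 solves l/4 + 2 = 2l, so above it the first bound
absorbs the additive 2 for every d ≥ 1. Below it, LB² ≤ 2l turns LB into √(2Ll). -/
theorem le_sqrt_two_mul_of_le {X B : ℝ} {d L : ℕ} (hB : 0 ≤ B)
    (h1 : X ≤ √((L * d) * (d * Real.log (1 + L * B ^ 2) / 4 + 2))) (h2 : X ≤ L * B) :
    X ≤ √2 * d * √(L * Real.log (1 + L * B ^ 2)) := by
  set z : ℝ := L * B ^ 2 with hz
  have hz0 : 0 ≤ z := by positivity
  have hl : 0 ≤ Real.log (1 + z) := Real.log_nonneg (by linarith)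
  rcases Nat.eq_zero_or_pos d with rfl | hd
  · simpa using h1
  have hd1 : (1 : ℝ) ≤ d := by exact_mod_cast hd
  rcases le_total (Real.log (1 + z)) (8 / 7) with hs | hs
  · refine h2.trans ?_
    have e : (L : ℝ) * B = √(L * z) := by
      rw [hz, show (L : ℝ) * (L * B ^ 2) = (L * B) ^ 2 by ring, Real.sqrt_sq (by positivity)]
    have h3 : √(L * z) ≤ √2 * √(L * Real.log (1 + z)) := by
      rw [← Real.sqrt_mul (by norm_num)]
      refine Real.sqrt_le_sqrt ?_
      have := mul_le_mul_of_nonneg_left (le_two_mul_log_one_add hz0 hs) (Nat.cast_nonneg (α := ℝ) L)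
      linarith
    rw [e]
    refine h3.trans (mul_le_mul_of_nonneg_right ?_ (Real.sqrt_nonneg _))
    exact le_mul_of_one_le_right (Real.sqrt_nonneg _) hd1
  · refine h1.trans (Real.sqrt_le_iff.2 ⟨by positivity, ?_⟩)
    rw [mul_pow, mul_pow, Real.sq_sqrt (by norm_num), Real.sq_sqrt (by positivity)]
    have h3 : d * Real.log (1 + z) / 4 + 2 ≤ 2 * (d * Real.log (1 + z)) := by
      nlinarith [mul_le_mul_of_nonneg_right hd1 hl]
    exact (mul_le_mul_of_nonneg_left h3 (by positivity)).trans_eq (by ring)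

/-! ### The Bayesian regret bound -/

namespace LinearMixture

variable {S A : Type*} [MeasurableSpace S] [MeasurableSpace A] {H d : ℕ}
  (M : LinearMixture S A H d) {prior : Measure (Param H d)} [IsProbabilityMeasure prior]
  {π : PolicyFamily (Param H d) S A H} {B : ℝ} (hB : 0 ≤ B)
  (hproper : ∀ᵐ Θ ∂prior, M.Proper Θ)
  (hφ : ∀ (x : SA S A H) (V : S → ℝ), Measurable V → (∀ s, V s ∈ Set.Icc (0 : ℝ) 1) →
    ‖M.valueFeature V x‖ ≤ 1)
  (hind : iIndepFun (fun (h : Fin H) (Θ : Param H d) => Θ h) prior)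
  (hprior : ∀ᵐ Θ ∂prior, ∀ h, ‖Θ h‖ ≤ B)

include hproper hφ hind hprior hB in
theorem sum_stageGap_le (L : ℕ) (h : Fin H) :
    ∑ n ∈ Finset.range L, M.stageGap prior π n h ≤
      √2 * d * √(L * Real.log (1 + L * B ^ 2)) := by
  rcases Nat.eq_zero_or_pos L with rfl | hL
  · simp
  have hL' : (0 : ℝ) < L := by exact_mod_cast hL
  have hl : 0 ≤ Real.log (1 + L * B ^ 2) := Real.log_nonneg (by nlinarith [sq_nonneg B])
  refine le_sqrt_two_mul_of_le hB ?_ ?_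
  · refine le_sqrt_mul_of_forall_pos (by positivity) (by positivity) fun s hs => ?_
    -- With c = L and the same s in every episode, the log-determinants telescope and the L errors
    -- 2/c add up to 2.
    have h1 := Finset.sum_le_sum fun n (_ : n ∈ Finset.range L) =>
      M.two_mul_stageGap_le (π := π) hB hproper hφ hind hprior n h hL' hs
    rw [← Finset.mul_sum, Finset.sum_add_distrib, Finset.sum_const, ← Finset.mul_sum,
      Finset.sum_add_distrib, ← Finset.sum_div, Finset.sum_range_sub', Finset.sum_const,
      Finset.card_range, nsmul_eq_mul, nsmul_eq_mul] at h1
    rw [mul_div_cancel₀ _ hL'.ne'] at h1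
    refine h1.trans ?_
    have h2 := M.meanLogDet_le (π := π) hB hprior 0 h hL'.le
    have h3 := M.meanLogDet_nonneg (π := π) hB hprior L h hL'.le
    have h4 : s⁻¹ * ((M.meanLogDet prior π 0 h L - M.meanLogDet prior π L h L) / 4 + 2) ≤
        s⁻¹ * (d * Real.log (1 + L * B ^ 2) / 4 + 2) :=
      mul_le_mul_of_nonneg_left (by linarith) (inv_nonneg.2 hs.le)
    linarith
  · have h1 (n : ℕ) : M.stageGap prior π n h ≤ B := by
      have := le_sqrt_mul_of_forall_pos (x := M.stageGap prior π n h) (a := B ^ 2) (b := 1)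
        (by positivity) zero_le_one fun t ht => by
          rw [mul_one]; exact M.two_mul_stageGap_le_norm hB hproper hφ hind hprior n h ht
      rwa [mul_one, Real.sqrt_sq hB] at this
    calc ∑ n ∈ Finset.range L, M.stageGap prior π n h ≤ ∑ _n ∈ Finset.range L, B :=
        Finset.sum_le_sum fun n _ => h1 n
      _ = L * B := by simp

include hφ in
theorem familyValue_sub_eq_integral {Θ Θ' : Param H d} (hΘ : M.Proper Θ) (hΘ' : M.Proper Θ') :
    M.familyValue π (Θ', Θ') - M.familyValue π (Θ, Θ') =
      ∫ ob, ∑ h : Fin H, H * inner ℝ (Θ' h - Θ h) (M.plannedFeature π h (Θ', stateAt ob h))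
        ∂(M.rollout π H le_rfl (Θ, Θ')) := by
  rw [M.familyValue_sub_eq_sum_inner π hΘ hΘ', integral_finsetSum]
  · simp only [integral_const_mul]
  · intro h _
    refine Integrable.const_mul (integrable_of_abs_le (C := ‖Θ' h - Θ h‖ * 1) ?_
      (Filter.Eventually.of_forall fun ob => ?_)) _
    · exact measurable_const.inner ((M.measurable_plannedFeature π h).comp
        (measurable_const.prodMk (measurable_stateAt H h)))
    · exact (abs_real_inner_le_norm _ _).trans
        (mul_le_mul_of_nonneg_left (M.norm_plannedFeature_le π hφ h _) (norm_nonneg _))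

theorem measurable_gap (n : ℕ) (h : Fin H) :
    Measurable fun p : Param H d × ((Hist S A H n × Param H d) × Obs S A H) =>
      inner ℝ (p.2.1.2 h - p.1 h) (M.plannedFeature π h (p.2.1.2, stateAt p.2.2 h)) := by
  refine Measurable.inner (by fun_prop) ((M.measurable_plannedFeature π h).comp ?_)
  exact (by fun_prop : Measurable fun p : Param H d × ((Hist S A H n × Param H d) × Obs S A H) =>
    p.2.1.2).prodMk ((measurable_stateAt H h).comp (by fun_prop))

include hφ hprior hB in
theorem integrable_gap (n : ℕ) (h : Fin H) :
    Integrable (fun p => inner ℝ (p.2.1.2 h - p.1 h)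
      (M.plannedFeature π h (p.2.1.2, stateAt p.2.2 h)))
      (prior ⊗ₘ M.episode prior π n H le_rfl) := by
  refine integrable_of_abs_le (C := (B + B) * 1) (M.measurable_gap n h) ?_
  filter_upwards [M.ae_compProd_episode_fst prior π n H le_rfl hprior,
    M.ae_compProd_episode_sample prior π n H le_rfl hprior] with p h1 h2
  exact (abs_real_inner_le_norm _ _).trans (mul_le_mul ((norm_sub_le _ _).trans
    (add_le_add (h2 h) (h1 h))) (M.norm_plannedFeature_le π hφ h _) (norm_nonneg _) (by positivity))

include hproper hφ hprior hB in
theorem integral_familyValue_sub (n : ℕ) :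
    ∫ p, (M.familyValue π (p.2.1.2, p.2.1.2) - M.familyValue π (p.1, p.2.1.2))
        ∂(prior ⊗ₘ M.episode prior π n H le_rfl) = ∑ h : Fin H, H * M.stageGap prior π n h := by
  have hg (h : Fin H) := M.integrable_gap (π := π) hB hφ hprior n h
  have m1 : Measurable fun p : Param H d × ((Hist S A H n × Param H d) × Obs S A H) =>
      M.familyValue π (p.2.1.2, p.2.1.2) - M.familyValue π (p.1, p.2.1.2) :=
    (Measurable.fun_comp (M.measurable_familyValue π) (by fun_prop)).sub
      (Measurable.fun_comp (M.measurable_familyValue π) (by fun_prop))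
  have i1 : Integrable (fun p : Param H d × ((Hist S A H n × Param H d) × Obs S A H) =>
      M.familyValue π (p.2.1.2, p.2.1.2) - M.familyValue π (p.1, p.2.1.2))
      (prior ⊗ₘ M.episode prior π n H le_rfl) :=
    integrable_of_abs_le (C := H + H) m1 (Filter.Eventually.of_forall fun p =>
      (abs_sub _ _).trans (add_le_add (M.abs_familyValue_le π _) (M.abs_familyValue_le π _)))
  have i2 : Integrable (fun p : Param H d × ((Hist S A H n × Param H d) × Obs S A H) =>
      ∑ h : Fin H, H * inner ℝ (p.2.1.2 h - p.1 h)
        (M.plannedFeature π h (p.2.1.2, stateAt p.2.2 h)))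
      (prior ⊗ₘ M.episode prior π n H le_rfl) :=
    integrable_finsetSum _ fun h _ => (hg h).const_mul _
  have e : ∑ h : Fin H, H * M.stageGap prior π n h = ∫ p, ∑ h : Fin H, H *
      inner ℝ (p.2.1.2 h - p.1 h) (M.plannedFeature π h (p.2.1.2, stateAt p.2.2 h))
      ∂(prior ⊗ₘ M.episode prior π n H le_rfl) := by
    rw [integral_finsetSum _ fun h _ => (hg h).const_mul _]
    simp only [integral_const_mul]
    rfl
  rw [e, Measure.integral_compProd i1, Measure.integral_compProd i2]
  refine integral_congr_ae ?_
  filter_upwards [hproper, Measure.ae_ae_of_ae_compProd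
    (M.ae_compProd_episode_sample prior π n H le_rfl hproper), ((Measure.integrable_compProd_iff i1.1).1 i1).1,
    ((Measure.integrable_compProd_iff i2.1).1 i2).1] with Θ hΘ hΘ' j1 j2
  unfold episode at hΘ' j1 j2 ⊢
  rw [integral_compProd j1, integral_compProd j2]
  refine integral_congr_ae ?_
  filter_upwards [Kernel.ae_ae_of_ae_compProd hΘ'] with x hx
  -- Properness of the sample is independent of the episode, whose law is a probability measure, so
  -- it may be read off at any one episode.
  obtain ⟨_, hx⟩ := hx.exists
  simp only [integral_const, probReal_univ, one_smul, Kernel.comap_apply]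
  exact M.familyValue_sub_eq_integral hφ hΘ hx

-- The optimal value of the true model is exchanged in mean for the planned value of the sampled
-- one; the remaining difference concerns a single policy in two models.
include hproper hφ hprior hB in
theorem bayesRegret_eq (L : ℕ) : M.bayesRegret prior π L =
    ∑ h : Fin H, H * ∑ n ∈ Finset.range L, M.stageGap prior π n h := by
  have m1 (n : ℕ) : Measurable fun p : Param H d × ((Hist S A H n × Param H d) × Obs S A H) =>
      M.familyValue π (p.1, p.1) :=
    Measurable.fun_comp (M.measurable_familyValue π) (by fun_prop)
  have m2 (n : ℕ) : Measurable fun p : Param H d × ((Hist S A H n × Param H d) × Obs S A H) =>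
      M.familyValue π (p.1, p.2.1.2) :=
    Measurable.fun_comp (M.measurable_familyValue π) (by fun_prop)
  have m3 (n : ℕ) : Measurable fun p : Param H d × ((Hist S A H n × Param H d) × Obs S A H) =>
      M.familyValue π (p.2.1.2, p.2.1.2) :=
    Measurable.fun_comp (M.measurable_familyValue π) (by fun_prop)
  have i {n : ℕ} {f : Param H d × ((Hist S A H n × Param H d) × Obs S A H) → Param H d × Param H d}
      (hf : Measurable fun p => M.familyValue π (f p)) :
      Integrable (fun p => M.familyValue π (f p)) (prior ⊗ₘ M.episode prior π n H le_rfl) :=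
    integrable_of_abs_le (C := H) hf (Filter.Eventually.of_forall fun p => M.abs_familyValue_le π _)
  have hi (n : ℕ) : Integrable (fun p => M.familyValue π (p.1, p.1) -
      M.familyValue π (p.1, p.2.1.2)) (prior ⊗ₘ M.episode prior π n H le_rfl) :=
    (i (m1 n)).sub (i (m2 n))
  have hΘ (n : ℕ) (Θ : Param H d) : ∫ o, ∫ Θ', (M.value Θ (π.at Θ) - M.value Θ (π.at Θ'))
      ∂(M.sampler prior π n o) ∂(M.hist prior π n Θ) =
      ∫ z, (M.familyValue π (Θ, Θ) - M.familyValue π (Θ, z.1.2))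
        ∂(M.episode prior π n H le_rfl Θ) := by
    rw [M.integral_episode prior π n H le_rfl Θ (C := H + H)
      (Measurable.fun_sub (f := fun _ => M.familyValue π (Θ, Θ)) measurable_const
        (Measurable.fun_comp (m2 n) (measurable_prodMk_left (x := Θ))))
      (fun z => (abs_sub _ _).trans
        (add_le_add (M.abs_familyValue_le π _) (M.abs_familyValue_le π _)))]
    simp only [value_at, integral_const, probReal_univ, one_smul]
  have hn (n : ℕ) : ∫ Θ, ∫ z, (M.familyValue π (Θ, Θ) - M.familyValue π (Θ, z.1.2))
        ∂(M.episode prior π n H le_rfl Θ) ∂prior = ∑ h : Fin H, H * M.stageGap prior π n h := by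
    rw [← M.integral_familyValue_sub hB hproper hφ hprior n, integral_sub (i (m3 n)) (i (m2 n))]
    refine (Measure.integral_compProd (hi n)).symm.trans ?_
    refine (integral_sub (i (m1 n)) (i (m2 n))).trans ?_
    -- The truth and the sample both have the prior as their law, so the terms V^Θ_{π^Θ} at the two
    -- have the same mean.
    congr 1
    have md : Measurable fun Θ : Param H d => M.familyValue π (Θ, Θ) :=
      Measurable.fun_comp (M.measurable_familyValue π) (by fun_prop)
    have e1 := integral_map (μ := prior ⊗ₘ M.episode prior π n H le_rfl)
      measurable_fst.aemeasurable md.aestronglyMeasurable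
    have e2 := integral_map (μ := prior ⊗ₘ M.episode prior π n H le_rfl)
      (φ := fun p => p.2.1.2) (by fun_prop) md.aestronglyMeasurable
    rw [compProd_episode_map_sample] at e2
    have e3 : (prior ⊗ₘ M.episode prior π n H le_rfl).map Prod.fst = prior := Measure.fst_compProd _ _
    rw [e3] at e1
    exact e1.symm.trans e2
  have hint (n : ℕ) : Integrable (fun Θ => ∫ z, (M.familyValue π (Θ, Θ) -
      M.familyValue π (Θ, z.1.2)) ∂(M.episode prior π n H le_rfl Θ)) prior :=
    Integrable.integral_compProd (hi n)
  unfold bayesRegret regret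
  simp only [hΘ]
  rw [integral_finsetSum _ fun n _ => hint n]
  simp only [hn]
  rw [Finset.sum_comm]
  simp only [Finset.mul_sum]

include hproper hφ hind hprior in
theorem bayesRegret_le (L : ℕ) : M.bayesRegret prior π L ≤
    √2 * d * √((H : ℝ) ^ 4 * L * Real.log (1 + L * B ^ 2)) := by
  -- Without stages the norm bound is vacuous and B may be negative. With at least one stage it
  -- forces B ≥ 0.
  rcases Nat.eq_zero_or_pos H with rfl | hH
  · rw [M.bayesRegret_eq le_rfl hproper hφ (by simp) L]
    simp
  have hB : 0 ≤ B := by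
    obtain ⟨Θ, hΘ⟩ := hprior.exists
    exact (norm_nonneg _).trans (hΘ ⟨0, hH⟩)
  rw [M.bayesRegret_eq hB hproper hφ hprior L]
  calc ∑ h : Fin H, H * ∑ n ∈ Finset.range L, M.stageGap prior π n h
      ≤ ∑ _h : Fin H, H * (√2 * d * √(L * Real.log (1 + L * B ^ 2))) :=
        Finset.sum_le_sum fun h _ => mul_le_mul_of_nonneg_left
          (M.sum_stageGap_le hB hproper hφ hind hprior L h) (Nat.cast_nonneg _)
    _ = √2 * d * √((H : ℝ) ^ 4 * L * Real.log (1 + L * B ^ 2)) := by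
        rw [mul_assoc ((H : ℝ) ^ 4), Real.sqrt_mul (by positivity : (0 : ℝ) ≤ (H : ℝ) ^ 4),
          show (H : ℝ) ^ 4 = (H ^ 2) ^ 2 by ring, Real.sqrt_sq (by positivity)]
        simp only [Finset.sum_const, Finset.card_univ, Fintype.card_fin, nsmul_eq_mul]
        ring

end LinearMixture

/-! ### The prior covariance and the orders of growth -/

theorem priorCov_eq_covMat {H d : ℕ} (prior : Measure (Param H d)) (h : Fin H) :
    priorCov prior h = covMat (prior.map fun Θ => Θ h) := by
  ext i j
  unfold priorCov covMat
  exact (covariance_map (μ := prior) (Z := fun Θ => Θ h) (X := fun θ => θ i) (Y := fun θ => θ j)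
    (by fun_prop) (by fun_prop) (measurable_pi_apply h).aemeasurable).symm

/-- Since L ≥ 1, one has 1 + LB² ≤ L(1 + B²). -/
theorem log_one_add_mul_sq_le {L : ℕ} (hL : 1 ≤ L) (B : ℝ) :
    Real.log (1 + L * B ^ 2) ≤ Real.log L + Real.log (1 + B ^ 2) := by
  have hL' : (1 : ℝ) ≤ L := by exact_mod_cast hL
  have hB := sq_nonneg B
  rw [← Real.log_mul (by positivity) (by positivity)]
  exact Real.log_le_log (by positivity) (by nlinarith)

theorem log_add_le_mul_log {x b : ℝ} {T : ℕ} (hT : 2 ≤ T) (hb : 0 ≤ b) (hx : x ≤ Real.log T) :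
    x + b ≤ (1 + b / Real.log 2) * Real.log T := by
  have h2 : 0 < Real.log 2 := Real.log_pos (by norm_num)
  have hle : Real.log 2 ≤ Real.log T :=
    Real.log_le_log (by norm_num) (by exact_mod_cast hT)
  have : b ≤ b / Real.log 2 * Real.log T := by
    rw [div_mul_eq_mul_div, le_div_iff₀ h2]
    exact mul_le_mul_of_nonneg_left hle hb
  linarith

theorem sqrt_two_mul_sqrt_le {d : ℕ} {K a x y : ℝ} (hK : 0 ≤ K) (ha : 0 ≤ a) (h : x ≤ K * y) :
    √2 * d * √(a * x) ≤ √(2 * K) * (d * √(a * y)) := by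
  have h1 : √(a * x) ≤ √K * √(a * y) := by
    rw [← Real.sqrt_mul hK]
    exact Real.sqrt_le_sqrt ((mul_le_mul_of_nonneg_left h ha).trans_eq (by ring))
  rw [Real.sqrt_mul (by norm_num : (0 : ℝ) ≤ 2)]
  exact (mul_le_mul_of_nonneg_left h1 (by positivity)).trans_eq (by ring)

theorem rate_comparison (d H T : ℕ) :
    d * (H : ℝ) ^ (3 / 2 : ℝ) * √T * Real.log T =
      √(Real.log T) * (d * √((H : ℝ) ^ 3 * T * Real.log T)) := by
  have hl : 0 ≤ Real.log T := Real.log_natCast_nonneg T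
  have e : (H : ℝ) ^ (3 / 2 : ℝ) = √((H : ℝ) ^ 3) := by
    rw [Real.sqrt_eq_rpow, ← Real.rpow_natCast, ← Real.rpow_mul (Nat.cast_nonneg _)]
    norm_num
  have e2 : Real.log T = √(Real.log T) * √(Real.log T) := (Real.mul_self_sqrt hl).symm
  rw [e, Real.sqrt_mul (by positivity), Real.sqrt_mul (by positivity)]
  nth_rewrite 1 [e2]
  ring

end PSRL

end

open PSRL in
theorem mainTheorem2 (B : ℝ) :
    ∃ C : ℝ, 0 < C ∧
    (∀ {S A : Type*} [MeasurableSpace S] [MeasurableSpace A] (H d L : ℕ)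
      (M : LinearMixture S A H d)
      (prior : Measure (Param H d)) [IsProbabilityMeasure prior]
      (π : PolicyFamily (Param H d) S A H),
      -- the prior is supported on parameters that induce proper transition kernels
      (∀ᵐ Θ ∂prior, M.Proper Θ) →
      -- the planner returns an optimal policy of the MDP with the given parameters
      (∀ᵐ Θ ∂prior, M.IsOptimal Θ (π.at Θ)) →
      -- value-correlated features of functions with values in [0, 1] have norm at most one
      (∀ (x : SA S A H) (V : S → ℝ), Measurable V → (∀ s, V s ∈ Set.Icc (0 : ℝ) 1) →
        ‖M.valueFeature V x‖ ≤ 1) →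
      -- the stage parameters are mutually independent
      iIndepFun (fun (h : Fin H) (Θ : Param H d) => Θ h) prior →
      -- the stage parameters are bounded
      (∀ᵐ Θ ∂prior, ∀ h, ‖Θ h‖ ≤ B) →
      (∀ h, (B ^ 2 • (1 : Matrix (Fin d) (Fin d) ℝ) - priorCov prior h).PosSemidef) ∧
      (∀ h, ∀ c : ℝ, 0 ≤ c →
        Real.log (1 + c • priorCov prior h).det ≤ d * Real.log (1 + c * B ^ 2)) ∧
      M.bayesRegret prior π L ≤
        √2 * d * √((H : ℝ) ^ 4 * L * Real.log (1 + L * B ^ 2))) ∧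
    -- the orders of growth, with `T = H * L`
    (∀ H d L T : ℕ, T = H * L →
      (2 ≤ L → √2 * d * √((H : ℝ) ^ 4 * L * Real.log (1 + L * B ^ 2)) ≤
        C * (d * √((H : ℝ) ^ 3 * T * Real.log L))) ∧
      (2 ≤ T → √2 * d * √((H : ℝ) ^ 4 * L * Real.log (1 + L * B ^ 2)) ≤
        C * (d * √((H : ℝ) ^ 3 * T * Real.log T))) ∧
      -- comparison with the rate `d H^(3/2) √T log T`
      (d * (H : ℝ) ^ (3 / 2 : ℝ) * √T * Real.log T =
        √(Real.log T) * (d * √((H : ℝ) ^ 3 * T * Real.log T)))) := by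
  have hb : 0 ≤ Real.log (1 + B ^ 2) := Real.log_nonneg (by linarith [sq_nonneg B])
  have h2 : 0 < Real.log 2 := Real.log_pos (by norm_num)
  have hK : 0 < 1 + Real.log (1 + B ^ 2) / Real.log 2 := by positivity
  -- With K = 1 + log(1 + B²)/log 2 one has log(1 + LB²) ≤ log L + log(1 + B²) ≤ K log L for L ≥ 2,
  -- and likewise ≤ K log T for T ≥ 2 because L ≤ T. The constant is √(2K).
  refine ⟨√(2 * (1 + Real.log (1 + B ^ 2) / Real.log 2)), by positivity, ?_, ?_⟩
  · intro S A _ _ H d L M prior _ π hproper _ hφ hind hprior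
    have hq (h : Fin H) : ∀ᵐ θ ∂(prior.map fun Θ => Θ h), ‖θ‖ ≤ B :=
      (ae_map_iff (measurable_pi_apply h).aemeasurable
        (measurableSet_le measurable_norm measurable_const)).2 (hprior.mono fun _ hΘ => hΘ h)
    have hp (h : Fin H) : IsProbabilityMeasure (prior.map fun Θ => Θ h) :=
      Measure.isProbabilityMeasure_map (measurable_pi_apply h).aemeasurable
    refine ⟨fun h => ?_, fun h c hc => ?_, M.bayesRegret_le hproper hφ hind hprior L⟩
    · have := hp h
      rw [priorCov_eq_covMat]
      exact smul_one_sub_covMat_posSemidef (hq h)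
    · have := hp h
      rw [priorCov_eq_covMat]
      exact log_det_covMat_le (hq h) hc
  · rintro H d L T rfl
    have e : (H : ℝ) ^ 3 * (H * L : ℕ) = (H : ℝ) ^ 4 * L := by push_cast; ring
    refine ⟨fun hL => ?_, fun hT => ?_, rate_comparison d H (H * L)⟩
    · rw [e]
      exact sqrt_two_mul_sqrt_le hK.le (by positivity)
        ((log_one_add_mul_sq_le (by omega) B).trans (log_add_le_mul_log hL hb le_rfl))
    · have hHL : 1 ≤ H ∧ 1 ≤ L := by
        constructor <;> rw [Nat.one_le_iff_ne_zero] <;> rintro rfl <;> simp at hT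
      rw [e]
      refine sqrt_two_mul_sqrt_le hK.le (by positivity)
        ((log_one_add_mul_sq_le hHL.2 B).trans (log_add_le_mul_log hT hb ?_))
      refine Real.log_le_log (by exact_mod_cast hHL.2) ?_
      exact_mod_cast Nat.le_mul_of_pos_left L hHL.1
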